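/- Let $m>0$ and let $\sigma=(\sigma_{\mu\nu})$ be a real antisymmetric nondegenerate $4\times4$ matrix. On $\mathbb R^4$ write $k^2=k_0^2-|\mathbf k|^2$ and $(k\sigma)_\nu=k^\mu\sigma_{\mu\nu}$, $k\sigma l=(k\sigma)_\nu l^\nu$; let $\omega_l=\sqrt{|\mathbf l|^2+m^2}$, $l_+=(\omega_l,\mathbf l)$, and $\Omega=\{k: m/2<\sqrt{k^2}<3m/2\}$ (so $k^2>0$). Let $\hat\Delta_+$ be the measure $(2\pi)^{-1}\theta(l^0)\delta(l^2-m^2)$ on $\mathbb R^4$, i.e. the image of $(2\pi)^{-1}d^3l/(2\omega_l)$ under $\mathbf l\mapsto l_+$, and $\hat\Delta_R(p)=(2\pi)^{-2}\frac{-1}{p^2-m^2}$ for $p^2\ne m^2$. Let $\varepsilon\in\{1,-1\}$ and consider $$\Sigma_{np}(k)=\int d^4l\,\hat\Delta_+(l)\,e^{i\varepsilon k\sigma l}\big(\hat\Delta_R(k-l)+\hat\Delta_R(k+l)\big),\qquad k\in\Omega .$$ *Definitions.* A symbol of order $r$, $a\in\mathrm{Sym}(\Omega,t,r)$, is a smooth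 $a:\Omega\times\mathbb R^t\to\mathbb C$ such that all seminorms $\sup_{k\in K,\,l}(1+|l|)^{|\beta|-r}|D_k^\alpha D_l^\beta a(k,l)|$ ($K\subset\Omega$ compact, $\alpha,\beta$ multi-indices) are finite; these seminorms define the topology. An asymptotic symbol of order $r$ is a sum $a_1+a_2$ with $a_1\in\mathrm{Sym}(\Omega,t,r)$ and $a_2$ of compact support in $l$ (locally uniformly in $k$) such that $k\mapsto a_2(k,\cdot)$ is a $C^\infty$ map $\Omega\to L^\infty(\mathbb R^t)$. A phase function is a continuous $\phi:\Omega\times\mathbb R^t\to\mathbb R$, homogeneous of degree one in $l$ under factors $\lambda\ge0$, and smooth with $(\nabla_k\phi,\nabla_l\phi)\neq(0,0)$ for $l\ne0$. An oscillatory integral for $\phi$ is a linear map $T_\phi$ from the asymptotic symbols (of all orders) to $\mathcal D'(\Omega)$ such that (i) if $a$ has compact support in $l$, then $T_\phi(a)$ is the function $k\mapsto\int d^tl\,a(k,l)e^{i\phi(k,l)}$, which is $C^\infty$ on $\Omega$; (ii) for each $r$ the restriction of $T_\phi$ to $\mathrm{Sym}(\Omega,t,r)$ is continuous into $\mathcal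 D'(\Omega)$ with the topology of pointwise convergence on test functions. *Theorem.* 1. For $k\in\Omega$ and $\mathbf l\in\mathbb R^3$ one has $(k\pm l_+)^2\neq m^2$. With $\phi(k,\mathbf l)=\varepsilon\,k\sigma(|\mathbf l|,\mathbf l)$ and $$a(k,\mathbf l)=\frac1{(2\pi)^3}\frac1{2\omega_l}\Big(\frac{-1}{(k-l_+)^2-m^2}+\frac{-1}{(k+l_+)^2-m^2}\Big)e^{i\varepsilon(k\sigma)_0(\omega_l-|\mathbf l|)},$$ the integrand of $\Sigma_{np}$, expressed as a function of $\mathbf l\in\mathbb R^3$, is $a\,e^{i\phi}$. Here $\phi$ is a phase function on $\Omega\times\mathbb R^3$ and $a$ is an asymptotic symbol of order $-3$. 2. There is exactly one oscillatory integral $T_\phi$, so that $\Sigma_{np}:=T_\phi(a)$ is a well-defined distribution on $\Omega$. 3. For $k\in\Omega$ one has $-(k\sigma)^2>0$, the integral $$F(k)=-2(2\pi)^{-2}\int_0^\infty dl\,\frac{l^2}{\omega_l(k^2-4\omega_l^2)}\,\frac{\sin\big(l\sqrt{-(k\sigma)^2}\big)}{l\sqrt{-(k\sigma)^2}}$$ (with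 $\omega_l=\sqrt{l^2+m^2}$ for the number $l$) converges absolutely, $F$ is $C^\infty$ on $\Omega$, and $T_\phi(a)=F$ as distributions on $\Omega$. 4. For $k\in\Omega$ let $\Lambda_k$ be the pure boost with velocity $\mathbf k/k_0$; it preserves the Minkowski square and takes $k$ to $(\operatorname{sgn}(k_0)\sqrt{k^2},\mathbf 0)$. Let $\underline\Lambda_k p$ be the spatial part of $\Lambda_k p$. Let $g\in C^\infty(\mathbb R)$ be complex-valued with $g(x)=1$ for $|x|\le1$ and $g(x)=0$ for $|x|\ge2$, and for $n\ge1$ put $G_n(k,\mathbf l)=g\big(|\underline\Lambda_k l_+/n|^2\big)$. Then $G_n$ has compact support in $\mathbf l$ (locally uniformly in $k$), $G_n\in\mathrm{Sym}(\Omega,3,0)$, and $G_n\to1$ in $\mathrm{Sym}(\Omega,3,1)$. For each $n\ge1$ and $k\in\Omega$ the function $l\mapsto g(|\underline\Lambda_k l/n|^2)\,e^{i\varepsilon k\sigma l}(\hat\Delta_R(k-l)+\hat\Delta_R(k+l))$ is integrable with respect to $\hat\Delta_+$, and for every test function $f\in\mathcal D(\Omega)$ $$\lim_{n\to\infty}\int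 d^4k\,f(k)\int d^4l\,\hat\Delta_+(l)\,g\big(|\underline\Lambda_k l/n|^2\big)e^{i\varepsilon k\sigma l}\big(\hat\Delta_R(k-l)+\hat\Delta_R(k+l)\big)=\int d^4k\,f(k)F(k).$$ -/

import Mathlib

open MeasureTheory Set Filter TopologicalSpace
open scoped Topology ContDiff Distributions

noncomputable section

/-! ### Symbols, asymptotic symbols and oscillatory integrals on `Ω × ℝᵗ`, `Ω ⊆ ℝᵈ` open

Functions on `Ω × ℝᵗ` are represented by functions `ℝᵈ → ℝᵗ → ℂ` of which only the values at
points `(k, l)` with `k ∈ Ω` matter. -/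

/-- The mixed partial derivative `D_k^α D_l^β a (k, l)`. A multi-index is given as the list of the
coordinates with respect to which one differentiates, so `|α|` is the length of the list. -/
def mixedPartial {d t : ℕ} (α : List (Fin d)) (β : List (Fin t))
    (a : EuclideanSpace ℝ (Fin d) → EuclideanSpace ℝ (Fin t) → ℂ)
    (k : EuclideanSpace ℝ (Fin d)) (l : EuclideanSpace ℝ (Fin t)) : ℂ :=
  iteratedFDeriv ℝ (α.length + β.length) (Function.uncurry a) (k, l)
    (Fin.append
      (fun i => ((EuclideanSpace.single (α.get i) (1 : ℝ), 0) :
        EuclideanSpace ℝ (Fin d) × EuclideanSpace ℝ (Fin t)))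
      (fun j => (0, EuclideanSpace.single (β.get j) (1 : ℝ))))

/-- `(1 + |l|)^(|β| - r) |D_k^α D_l^β a (k, l)|`. -/
def symWeight {d t : ℕ} (r : ℝ) (α : List (Fin d)) (β : List (Fin t))
    (a : EuclideanSpace ℝ (Fin d) → EuclideanSpace ℝ (Fin t) → ℂ)
    (k : EuclideanSpace ℝ (Fin d)) (l : EuclideanSpace ℝ (Fin t)) : ℝ :=
  (1 + ‖l‖) ^ ((β.length : ℝ) - r) * ‖mixedPartial α β a k l‖

/-- Smoothness on `Ω × ℝᵗ`. -/
def SmoothOnProd {d t : ℕ} (Ω : Opens (EuclideanSpace ℝ (Fin d)))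
    (a : EuclideanSpace ℝ (Fin d) → EuclideanSpace ℝ (Fin t) → ℂ) : Prop :=
  ContDiffOn ℝ ∞ (Function.uncurry a) ((Ω : Set (EuclideanSpace ℝ (Fin d))) ×ˢ univ)

/-- The compact subsets of `Ω`. -/
abbrev CompactsIn {d : ℕ} (Ω : Opens (EuclideanSpace ℝ (Fin d))) : Type :=
  {K : Set (EuclideanSpace ℝ (Fin d)) // IsCompact K ∧ K ⊆ Ω}

theorem SmoothOnProd.contDiffAt_prod {d t : ℕ} {Ω : Opens (EuclideanSpace ℝ (Fin d))}
    {a : EuclideanSpace ℝ (Fin d) → EuclideanSpace ℝ (Fin t) → ℂ} (ha : SmoothOnProd Ω a)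
    {k : EuclideanSpace ℝ (Fin d)} (hk : k ∈ Ω) (l : EuclideanSpace ℝ (Fin t)) (n : ℕ) :
    ContDiffAt ℝ n (Function.uncurry a) (k, l) := by
  have h := ContDiffOn.contDiffAt ha (x := (k, l)) ((Ω.isOpen.prod isOpen_univ).mem_nhds ⟨hk, mem_univ _⟩)
  exact h.of_le (by exact_mod_cast le_top)

theorem mixedPartial_add {d t : ℕ} {Ω : Opens (EuclideanSpace ℝ (Fin d))}
    {a b : EuclideanSpace ℝ (Fin d) → EuclideanSpace ℝ (Fin t) → ℂ}
    (ha : SmoothOnProd Ω a) (hb : SmoothOnProd Ω b) (α : List (Fin d)) (β : List (Fin t))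
    {k : EuclideanSpace ℝ (Fin d)} (hk : k ∈ Ω) (l : EuclideanSpace ℝ (Fin t)) :
    mixedPartial α β (a + b) k l = mixedPartial α β a k l + mixedPartial α β b k l := by
  have h : Function.uncurry (a + b) = Function.uncurry a + Function.uncurry b := rfl
  rw [mixedPartial, h, iteratedFDeriv_add_apply (ha.contDiffAt_prod hk l _) (hb.contDiffAt_prod hk l _)]
  rfl

theorem mixedPartial_smul {d t : ℕ} {Ω : Opens (EuclideanSpace ℝ (Fin d))}
    {a : EuclideanSpace ℝ (Fin d) → EuclideanSpace ℝ (Fin t) → ℂ}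
    (ha : SmoothOnProd Ω a) (c : ℂ) (α : List (Fin d)) (β : List (Fin t))
    {k : EuclideanSpace ℝ (Fin d)} (hk : k ∈ Ω) (l : EuclideanSpace ℝ (Fin t)) :
    mixedPartial α β (c • a) k l = c * mixedPartial α β a k l := by
  have h : Function.uncurry (c • a) = c • Function.uncurry a := rfl
  rw [mixedPartial, h, iteratedFDeriv_const_smul_apply (ha.contDiffAt_prod hk l _)]
  rfl

theorem symWeight_nonneg {d t : ℕ} (r : ℝ) (α : List (Fin d)) (β : List (Fin t))
    (a : EuclideanSpace ℝ (Fin d) → EuclideanSpace ℝ (Fin t) → ℂ)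
    (k : EuclideanSpace ℝ (Fin d)) (l : EuclideanSpace ℝ (Fin t)) : 0 ≤ symWeight r α β a k l := by
  unfold symWeight; positivity

theorem symWeight_add_le {d t : ℕ} {Ω : Opens (EuclideanSpace ℝ (Fin d))}
    {a b : EuclideanSpace ℝ (Fin d) → EuclideanSpace ℝ (Fin t) → ℂ}
    (ha : SmoothOnProd Ω a) (hb : SmoothOnProd Ω b) (r : ℝ) (α : List (Fin d)) (β : List (Fin t))
    {k : EuclideanSpace ℝ (Fin d)} (hk : k ∈ Ω) (l : EuclideanSpace ℝ (Fin t)) :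
    symWeight r α β (a + b) k l ≤ symWeight r α β a k l + symWeight r α β b k l := by
  rw [symWeight, mixedPartial_add ha hb α β hk, symWeight, symWeight, ← mul_add]
  exact mul_le_mul_of_nonneg_left (norm_add_le _ _) (by positivity)

theorem symWeight_smul {d t : ℕ} {Ω : Opens (EuclideanSpace ℝ (Fin d))}
    {a : EuclideanSpace ℝ (Fin d) → EuclideanSpace ℝ (Fin t) → ℂ}
    (ha : SmoothOnProd Ω a) (c : ℂ) (r : ℝ) (α : List (Fin d)) (β : List (Fin t))
    {k : EuclideanSpace ℝ (Fin d)} (hk : k ∈ Ω) (l : EuclideanSpace ℝ (Fin t)) :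
    symWeight r α β (c • a) k l = ‖c‖ * symWeight r α β a k l := by
  rw [symWeight, mixedPartial_smul ha c α β hk, symWeight, norm_mul]; ring

/-- The space of symbols of order `r` on `Ω × ℝᵗ`, as a space of functions. -/
def symSubmodule {d : ℕ} (Ω : Opens (EuclideanSpace ℝ (Fin d))) (t : ℕ) (r : ℝ) :
    Submodule ℂ (EuclideanSpace ℝ (Fin d) → EuclideanSpace ℝ (Fin t) → ℂ) where
  carrier := {a | SmoothOnProd Ω a ∧
    ∀ (K : CompactsIn Ω) (α : List (Fin d)) (β : List (Fin t)),
      BddAbove (range fun z : K.1 × EuclideanSpace ℝ (Fin t) => symWeight r α β a z.1 z.2)}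
  zero_mem' := by
    have h0 : SmoothOnProd Ω
        (0 : EuclideanSpace ℝ (Fin d) → EuclideanSpace ℝ (Fin t) → ℂ) :=
      contDiffOn_const (c := (0 : ℂ))
    refine ⟨h0, fun K α β => ⟨0, ?_⟩⟩
    rintro _ ⟨z, rfl⟩
    have h := symWeight_smul h0 0 r α β (K.2.2 z.1.2) z.2
    rw [zero_smul, norm_zero, zero_mul] at h
    exact h.le
  add_mem' := by
    rintro a b ⟨ha, ha'⟩ ⟨hb, hb'⟩
    refine ⟨ContDiffOn.add ha hb, fun K α β => ?_⟩
    obtain ⟨A, hA⟩ := ha' K α β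
    obtain ⟨B, hB⟩ := hb' K α β
    refine ⟨A + B, ?_⟩
    rintro _ ⟨z, rfl⟩
    exact (symWeight_add_le ha hb r α β (K.2.2 z.1.2) z.2).trans
      (add_le_add (hA ⟨z, rfl⟩) (hB ⟨z, rfl⟩))
  smul_mem' := by
    rintro c a ⟨ha, ha'⟩
    refine ⟨ContDiffOn.const_smul (R := ℂ) c ha, fun K α β => ?_⟩
    obtain ⟨A, hA⟩ := ha' K α β
    refine ⟨‖c‖ * A, ?_⟩
    rintro _ ⟨z, rfl⟩
    exact (symWeight_smul ha c r α β (K.2.2 z.1.2) z.2).le.trans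
      (mul_le_mul_of_nonneg_left (hA ⟨z, rfl⟩) (norm_nonneg c))

/-- `Sym(Ω, t, r)`: the symbols of order `r`, with the topology of the seminorms
`‖a‖_{K,α,β} = sup_{k ∈ K, l} (1 + |l|)^(|β| - r) |D_k^α D_l^β a (k, l)|`. -/
def SymbolSpace {d : ℕ} (Ω : Opens (EuclideanSpace ℝ (Fin d))) (t : ℕ) (r : ℝ) : Type :=
  symSubmodule Ω t r

instance {d : ℕ} (Ω : Opens (EuclideanSpace ℝ (Fin d))) (t : ℕ) (r : ℝ) :
    AddCommGroup (SymbolSpace Ω t r) :=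
  inferInstanceAs (AddCommGroup (symSubmodule Ω t r))

instance {d : ℕ} (Ω : Opens (EuclideanSpace ℝ (Fin d))) (t : ℕ) (r : ℝ) :
    Module ℂ (SymbolSpace Ω t r) :=
  inferInstanceAs (Module ℂ (symSubmodule Ω t r))

/-- The seminorm `‖a‖_{K,α,β}` on `Sym(Ω, t, r)`. -/
def symSeminorm {d : ℕ} (Ω : Opens (EuclideanSpace ℝ (Fin d))) (t : ℕ) (r : ℝ) :
    SeminormFamily ℂ (SymbolSpace Ω t r) (CompactsIn Ω × List (Fin d) × List (Fin t)) := fun p =>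
  Seminorm.of
    (fun a : SymbolSpace Ω t r =>
      ⨆ z : p.1.1 × EuclideanSpace ℝ (Fin t), symWeight r p.2.1 p.2.2 a.1 z.1 z.2)
    (fun a b => by
      have hA := a.2.2 p.1 p.2.1 p.2.2
      have hB := b.2.2 p.1 p.2.1 p.2.2
      refine Real.iSup_le (fun z => ?_) (add_nonneg
        (Real.iSup_nonneg fun z => symWeight_nonneg _ _ _ _ _ _)
        (Real.iSup_nonneg fun z => symWeight_nonneg _ _ _ _ _ _))
      exact (symWeight_add_le a.2.1 b.2.1 r _ _ (p.1.2.2 z.1.2) z.2).trans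
        (add_le_add (le_ciSup hA z) (le_ciSup hB z)))
    (fun c a => by
      rw [Real.mul_iSup_of_nonneg (norm_nonneg c)]
      exact iSup_congr fun z => symWeight_smul a.2.1 c r _ _ (p.1.2.2 z.1.2) z.2)

instance {d : ℕ} (Ω : Opens (EuclideanSpace ℝ (Fin d))) (t : ℕ) (r : ℝ) :
    TopologicalSpace (SymbolSpace Ω t r) :=
  (symSeminorm Ω t r).moduleFilterBasis.topology

theorem SymbolSpace.withSeminorms {d : ℕ} (Ω : Opens (EuclideanSpace ℝ (Fin d))) (t : ℕ) (r : ℝ) :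
    WithSeminorms (symSeminorm Ω t r) := ⟨rfl⟩

/-- `a` has compact support in `l`, locally uniformly in `k ∈ Ω`. -/
def HasCompactSupportInL {d t : ℕ} (Ω : Opens (EuclideanSpace ℝ (Fin d)))
    (a : EuclideanSpace ℝ (Fin d) → EuclideanSpace ℝ (Fin t) → ℂ) : Prop :=
  ∀ K : CompactsIn Ω, ∃ R : ℝ, ∀ k ∈ K.1, ∀ l, R < ‖l‖ → a k l = 0

/-- The functions `a` of compact support in `l` for which `k ↦ a (k, ·)` is a smooth map
from `Ω` to `L^∞(ℝᵗ)`. -/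
def smoothLinftySubmodule {d : ℕ} (Ω : Opens (EuclideanSpace ℝ (Fin d))) (t : ℕ) :
    Submodule ℂ (EuclideanSpace ℝ (Fin d) → EuclideanSpace ℝ (Fin t) → ℂ) where
  carrier := {a | HasCompactSupportInL Ω a ∧
    ∃ A : EuclideanSpace ℝ (Fin d) → Lp ℂ ⊤ (volume : Measure (EuclideanSpace ℝ (Fin t))),
      ContDiffOn ℝ ∞ A Ω ∧ ∀ k ∈ Ω, A k =ᵐ[volume] a k}
  zero_mem' := ⟨fun _ => ⟨0, fun _ _ _ _ => rfl⟩, 0, contDiffOn_const (c := 0),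
    fun _ _ => Lp.coeFn_zero _ _ _⟩
  add_mem' := by
    rintro a b ⟨ha, A, hA, hA'⟩ ⟨hb, B, hB, hB'⟩
    refine ⟨fun K => ?_, A + B, hA.add hB, fun k hk => ?_⟩
    · obtain ⟨R, hR⟩ := ha K
      obtain ⟨S, hS⟩ := hb K
      refine ⟨max R S, fun k hk l hl => ?_⟩
      simp [hR k hk l ((le_max_left _ _).trans_lt hl), hS k hk l ((le_max_right _ _).trans_lt hl)]
    · exact (Lp.coeFn_add (A k) (B k)).trans ((hA' k hk).add (hB' k hk))
  smul_mem' := by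
    rintro c a ⟨ha, A, hA, hA'⟩
    refine ⟨fun K => ?_, c • A, hA.const_smul c, fun k hk => ?_⟩
    · obtain ⟨R, hR⟩ := ha K
      exact ⟨R, fun k hk l hl => by simp [hR k hk l hl]⟩
    · exact (Lp.coeFn_smul c (A k)).trans ((hA' k hk).const_smul c)

/-- The asymptotic symbols of order `r`: the sums `a₁ + a₂` of a symbol `a₁` of order `r` and a
function `a₂` of compact support in `l` that depends smoothly on `k` as an element of `L^∞`. -/
def asymptoticSymbolsOfOrder {d : ℕ} (Ω : Opens (EuclideanSpace ℝ (Fin d))) (t : ℕ) (r : ℝ) :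
    Submodule ℂ (EuclideanSpace ℝ (Fin d) → EuclideanSpace ℝ (Fin t) → ℂ) :=
  symSubmodule Ω t r ⊔ smoothLinftySubmodule Ω t

/-- The space of all asymptotic symbols (of any order). -/
def asymptoticSymbols {d : ℕ} (Ω : Opens (EuclideanSpace ℝ (Fin d))) (t : ℕ) :
    Submodule ℂ (EuclideanSpace ℝ (Fin d) → EuclideanSpace ℝ (Fin t) → ℂ) :=
  ⨆ r : ℝ, asymptoticSymbolsOfOrder Ω t r

theorem asymptoticSymbolsOfOrder_le {d : ℕ} (Ω : Opens (EuclideanSpace ℝ (Fin d))) (t : ℕ)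
    (r : ℝ) : asymptoticSymbolsOfOrder Ω t r ≤ asymptoticSymbols Ω t :=
  le_iSup (asymptoticSymbolsOfOrder Ω t) r

/-- A symbol of order `r`, regarded as an asymptotic symbol. -/
def SymbolSpace.toAsymptotic {d t : ℕ} {Ω : Opens (EuclideanSpace ℝ (Fin d))} {r : ℝ} (a : SymbolSpace Ω t r) :
    asymptoticSymbols Ω t :=
  ⟨a.1, asymptoticSymbolsOfOrder_le Ω t r (Submodule.mem_sup_left a.2)⟩

/-- Phase functions on `Ω × ℝᵗ`. -/
structure IsPhaseFunction {d t : ℕ} (Ω : Opens (EuclideanSpace ℝ (Fin d)))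
    (φ : EuclideanSpace ℝ (Fin d) → EuclideanSpace ℝ (Fin t) → ℝ) : Prop where
  continuousOn : ContinuousOn (Function.uncurry φ)
    ((Ω : Set (EuclideanSpace ℝ (Fin d))) ×ˢ univ)
  homogeneous : ∀ c : ℝ, 0 ≤ c → ∀ k ∈ Ω, ∀ l, φ k (c • l) = c * φ k l
  smooth : ContDiffOn ℝ ∞ (Function.uncurry φ)
    ((Ω : Set (EuclideanSpace ℝ (Fin d))) ×ˢ {0}ᶜ)
  gradient_ne_zero : ∀ k ∈ Ω, ∀ l, l ≠ 0 → fderiv ℝ (Function.uncurry φ) (k, l) ≠ 0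

/-- `∫ dᵗl a(k, l) e^{i φ(k, l)}`. -/
def phaseIntegral {d t : ℕ} (φ : EuclideanSpace ℝ (Fin d) → EuclideanSpace ℝ (Fin t) → ℝ)
    (a : EuclideanSpace ℝ (Fin d) → EuclideanSpace ℝ (Fin t) → ℂ)
    (k : EuclideanSpace ℝ (Fin d)) : ℂ :=
  ∫ l : EuclideanSpace ℝ (Fin t), a k l * Complex.exp (Complex.I * (φ k l : ℂ))

/-- The distribution `u` on `Ω` is the function `h`, that is `u(f) = ∫ f(k) h(k) dk` for all test
functions `f`. -/
def IsGivenBy {d : ℕ} {Ω : Opens (EuclideanSpace ℝ (Fin d))} (u : 𝓓'(Ω, ℂ))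
    (h : EuclideanSpace ℝ (Fin d) → ℂ) : Prop :=
  ∀ f : 𝓓(Ω, ℝ), u f = ∫ k, (f k : ℂ) * h k

/-- `T` is the oscillatory integral `a ↦ T_φ(a)`: a linear map from the asymptotic symbols to the
distributions on `Ω` such that

* if `a` has compact support in `l` then `T_φ(a)` is the smooth function
  `k ↦ ∫ dᵗl a(k, l) e^{i φ(k, l)}`;
* the restriction of `T_φ` to each `Sym(Ω, t, r)` is continuous, where the distributions carry the
  topology of pointwise convergence on test functions. -/
structure IsOscillatoryIntegral {d t : ℕ} (Ω : Opens (EuclideanSpace ℝ (Fin d)))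
    (φ : EuclideanSpace ℝ (Fin d) → EuclideanSpace ℝ (Fin t) → ℝ)
    (T : asymptoticSymbols Ω t →ₗ[ℂ] 𝓓'(Ω, ℂ)) : Prop where
  isGivenBy_of_compactSupport : ∀ a : asymptoticSymbols Ω t, HasCompactSupportInL Ω a.1 →
    ContDiffOn ℝ ∞ (phaseIntegral φ a.1) Ω ∧ IsGivenBy (T a) (phaseIntegral φ a.1)
  continuous_on_sym : ∀ (r : ℝ) (f : 𝓓(Ω, ℝ)),
    Continuous fun a : SymbolSpace Ω t r => T a.toAsymptotic f

/-! ### The nonplanar self-energy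

Four-vectors are elements of `ℝ⁴`, the coordinate `0` being time; the metric is `(+,-,-,-)`. -/

/-- The Minkowski square `k² = k₀² - |𝐤|²`; also used for covectors. -/
def minkowskiSq (k : EuclideanSpace ℝ (Fin 4)) : ℝ := k 0 ^ 2 - ∑ i : Fin 3, k i.succ ^ 2

/-- The four-vector with time component `x` and spatial part `l`. -/
def fourVector (x : ℝ) (l : EuclideanSpace ℝ (Fin 3)) : EuclideanSpace ℝ (Fin 4) :=
  WithLp.toLp 2 (Fin.cons x fun i => l i)

/-- The spatial part of a four-vector. -/
def spatialPart (p : EuclideanSpace ℝ (Fin 4)) : EuclideanSpace ℝ (Fin 3) :=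
  WithLp.toLp 2 fun i => p i.succ

/-- `ω = √(x² + m²)`; with `x = |l|` this is the energy `ω_l`. -/
def energy (m x : ℝ) : ℝ := √(x ^ 2 + m ^ 2)

/-- The on-shell vector `l₊ = (ω_l, l)`. -/
def onShell (m : ℝ) (l : EuclideanSpace ℝ (Fin 3)) : EuclideanSpace ℝ (Fin 4) :=
  fourVector (energy m ‖l‖) l

/-- The covector `(kσ)_ν = k^μ σ_{μν}`. -/
def twist (σ : Matrix (Fin 4) (Fin 4) ℝ) (k : EuclideanSpace ℝ (Fin 4)) :
    EuclideanSpace ℝ (Fin 4) :=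
  WithLp.toLp 2 fun ν => ∑ μ, k μ * σ μ ν

/-- `kσl = k^μ σ_{μν} l^ν`. -/
def twistPairing (σ : Matrix (Fin 4) (Fin 4) ℝ) (k l : EuclideanSpace ℝ (Fin 4)) : ℝ :=
  ∑ ν, twist σ k ν * l ν

/-- `Ω = {k : m/2 < √(k²) < 3m/2}`. Since `√` vanishes on negative numbers, for `m > 0` all
elements of `Ω` are timelike. -/
def shellRegion (m : ℝ) : Opens (EuclideanSpace ℝ (Fin 4)) where
  carrier := {k | m / 2 < √(minkowskiSq k) ∧ √(minkowskiSq k) < 3 * m / 2}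
  is_open' := by
    have h : Continuous fun k : EuclideanSpace ℝ (Fin 4) => √(minkowskiSq k) := by
      unfold minkowskiSq; fun_prop
    exact (isOpen_lt continuous_const h).inter (isOpen_lt h continuous_const)

/-- `Δ̂_R(p) = (2π)⁻² (-1) / (p² - m²)`: the retarded propagator at momenta off the mass shell. -/
def retardedPropagator (m : ℝ) (p : EuclideanSpace ℝ (Fin 4)) : ℝ :=
  ((2 * Real.pi) ^ 2)⁻¹ * (-1 / (minkowskiSq p - m ^ 2))

/-- `Δ̂₊(l) = (2π)⁻¹ θ(l⁰) δ(l² - m²)`, a measure on `ℝ⁴`: the image of `(2π)⁻¹ d³l / (2ω_l)`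
under `l ↦ l₊`. -/
def positiveFrequencyMeasure (m : ℝ) : Measure (EuclideanSpace ℝ (Fin 4)) :=
  ((volume : Measure (EuclideanSpace ℝ (Fin 3))).withDensity
    fun l => ENNReal.ofReal ((2 * Real.pi)⁻¹ * (1 / (2 * energy m ‖l‖)))).map (onShell m)

/-- The phase `ε kσ(|l|, l)`. -/
def twistPhase (σ : Matrix (Fin 4) (Fin 4) ℝ) (ε : ℝ) (k : EuclideanSpace ℝ (Fin 4))
    (l : EuclideanSpace ℝ (Fin 3)) : ℝ :=
  ε * twistPairing σ k (fourVector ‖l‖ l)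

/-- The amplitude
`(2π)⁻³ (1/(2ω_l)) (-1/((k - l₊)² - m²) + -1/((k + l₊)² - m²)) e^{iε(kσ)₀(ω_l - |l|)}`. -/
def amplitude (m : ℝ) (σ : Matrix (Fin 4) (Fin 4) ℝ) (ε : ℝ) (k : EuclideanSpace ℝ (Fin 4))
    (l : EuclideanSpace ℝ (Fin 3)) : ℂ :=
  ((((2 * Real.pi) ^ 3)⁻¹ * (1 / (2 * energy m ‖l‖)) *
    (-1 / (minkowskiSq (k - onShell m l) - m ^ 2)
      + -1 / (minkowskiSq (k + onShell m l) - m ^ 2)) : ℝ) : ℂ) *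
    Complex.exp (Complex.I * ((ε * twist σ k 0 * (energy m ‖l‖ - ‖l‖) : ℝ) : ℂ))

/-- The integrand `e^{iε kσl} (Δ̂_R(k - l) + Δ̂_R(k + l))` of the nonplanar self-energy, to be
integrated over `l ∈ ℝ⁴` against `Δ̂₊`. -/
def selfEnergyIntegrand (m : ℝ) (σ : Matrix (Fin 4) (Fin 4) ℝ) (ε : ℝ)
    (k l : EuclideanSpace ℝ (Fin 4)) : ℂ :=
  Complex.exp (Complex.I * ((ε * twistPairing σ k l : ℝ) : ℂ)) *
    ((retardedPropagator m (k - l) + retardedPropagator m (k + l) : ℝ) : ℂ)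

/-- `√(-(kσ)²)`. -/
def twistLength (σ : Matrix (Fin 4) (Fin 4) ℝ) (k : EuclideanSpace ℝ (Fin 4)) : ℝ :=
  √(-minkowskiSq (twist σ k))

/-- `l² / (ω_l (k² - 4ω_l²)) · sin(l √(-(kσ)²)) / (l √(-(kσ)²))`, for `l > 0`. -/
def radialIntegrand (m : ℝ) (σ : Matrix (Fin 4) (Fin 4) ℝ) (k : EuclideanSpace ℝ (Fin 4))
    (x : ℝ) : ℝ :=
  x ^ 2 / (energy m x * (minkowskiSq k - 4 * energy m x ^ 2)) *
    (Real.sin (x * twistLength σ k) / (x * twistLength σ k))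

/-- `-2 (2π)⁻² ∫₀^∞ dl l² / (ω_l (k² - 4ω_l²)) · sin(l √(-(kσ)²)) / (l √(-(kσ)²))`. -/
def nonplanarSelfEnergy (m : ℝ) (σ : Matrix (Fin 4) (Fin 4) ℝ)
    (k : EuclideanSpace ℝ (Fin 4)) : ℝ :=
  -2 * ((2 * Real.pi) ^ 2)⁻¹ * ∫ x in Ioi (0 : ℝ), radialIntegrand m σ k x

/-- The Lorentz factor `γ = 1/√(1 - |v|²)`. -/
def lorentzFactor (v : EuclideanSpace ℝ (Fin 3)) : ℝ := 1 / √(1 - ‖v‖ ^ 2)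

/-- The pure boost with velocity `v`, `|v| < 1`, on four-vectors:
`(p₀, 𝐩) ↦ (γ (p₀ - v·𝐩), 𝐩 + (γ²/(1+γ) (v·𝐩) - γ p₀) v)`. -/
def pureBoost (v : EuclideanSpace ℝ (Fin 3)) (p : EuclideanSpace ℝ (Fin 4)) :
    EuclideanSpace ℝ (Fin 4) :=
  fourVector (lorentzFactor v * (p 0 - inner ℝ v (spatialPart p)))
    (spatialPart p + (lorentzFactor v ^ 2 / (1 + lorentzFactor v) * inner ℝ v (spatialPart p)
      - lorentzFactor v * p 0) • v)

/-- `Λ_k`: the pure boost with velocity `𝐤/k₀`, which takes a timelike `k` to rest. -/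
def restBoost (k p : EuclideanSpace ℝ (Fin 4)) : EuclideanSpace ℝ (Fin 4) :=
  pureBoost ((k 0)⁻¹ • spatialPart k) p

/-- `g((Λ_k l / n)²)` for a four-vector `l`, where only the vector part of `Λ_k l` enters. -/
def boostCutoff (g : ℝ → ℂ) (n : ℕ) (k l : EuclideanSpace ℝ (Fin 4)) : ℂ :=
  g ((‖spatialPart (restBoost k l)‖ / n) ^ 2)

/-- `G_n(k, l) = g((Λ_k l₊ / n)²)`. -/
def boostCutoffOnShell (m : ℝ) (g : ℝ → ℂ) (n : ℕ) (k : EuclideanSpace ℝ (Fin 4))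
    (l : EuclideanSpace ℝ (Fin 3)) : ℂ :=
  boostCutoff g n k (onShell m l)

end

/-! The phase is linear in `k`: `φ(k, l) = k · w(l)` with `w(l) = ε σ(|l|, l)`, and nondegeneracy of
`σ` gives `|w(l)| ≥ c |l|` with `c > 0`. For a test function `f` and a symbol `a` of order `r`, the
inner integral `∫ dk f(k) a(k, l) e^{i k·w(l)}` is therefore a Fourier transform in `k`, evaluated
at `w(l)`. The `k`-derivatives of `f a` are `O((1 + |l|)^r)`, so integrating by parts sufficiently
often makes the inner integral `O((1 + |l|)^(-t-1))`, with a constant controlled by finitely many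
seminorms of `f` and of `a` (`exists_norm_phaseTransform_le`). Hence the integrals of `a e^{iφ}`
over balls converge as distributions. This limit is taken as the definition of `T_φ(a)`; it does not
refer to a decomposition `a = a₁ + a₂`, so it is automatically well defined and linear.

Uniqueness rests on cutoffs `G_n` of compact support in `l` with `G_n → 1` in `Sym(Ω, t, 1)`. Then
`G_n a → a` in `Sym(Ω, t, r + 1)`, property (i) determines `T_φ(G_n a)`, and property (ii)
determines the limit. The `L^∞` part of an asymptotic symbol is covered by (i) alone. The
boost-adapted cutoffs are such a sequence.

Symbol estimates come from scaling. On the scale `R = 1 + |l|` the weighted mixed derivatives are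
ordinary derivatives of `(k, l') ↦ a(k, R l')` (`symWeight_eq`). Rescaling momenta by `R` is the
same as replacing the mass `m` by `u m`, `u = 1/R`; for large `l` the amplitude becomes `R^(-3) H(k,
l', u)`, with `H` smooth up to the massless limit `u = 0`, so compactness gives all bounds. Near `l
= 0` the amplitude is a smooth function of `(k, |l|, l)`, which is enough for smooth dependence on
`k` in `L^∞`.

The value is computed in the rest frame of `k`. The measure `d³l/ω_l` is Lorentz invariant. Since
`σ` is antisymmetric, `kσ` is orthogonal to `k`, so it becomes purely spatial there, of length
`√(-(kσ)²)`. The two propagators add up to a multiple of `1/(k² - 4ω²)`, which is never singular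
because `k² < 9m²/4`. With the boost-adapted cutoff everything but the phase is radial, and the
Fourier transform of a radial function in three dimensions produces `sin(lL)/(lL)`. Dominated
convergence removes the cutoff, locally uniformly bounded in `k`, and identifies `T_φ(a)` with `F`.

Smoothness of `F` is not visible under the integral sign, since each `k`-derivative of `sin(l L(k))`
costs a power of `l`. The substitution `t = l L(k)` removes `k` from the oscillating factor; what
remains is a smooth function of `k` and `u = 1/(1 + t²) ∈ [0, 1]`. So `F` is a fixed continuous
linear functional on `C([0, 1])` applied to a smooth `C([0, 1])`-valued function of `k`. -/

noncomputable section

/-! ### Families of smooth functions -/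

section Curry

universe u

variable {X : Type*} [TopologicalSpace X] {E : Type u} [NormedAddCommGroup E]
  [NormedSpace ℝ E] {G : Type*} [NormedAddCommGroup G] [NormedSpace ℝ G]

open Classical in
/-- The map `k ↦ Φ (k, s ·)` with values in the continuous functions on `X`
(`0` where `Φ (k, s ·)` is not continuous). -/
def curryOn {F : Type*} [NormedAddCommGroup F] (Φ : E × G → F) (s : C(X, G)) (k : E) : C(X, F) :=
  if h : Continuous fun x => Φ (k, s x) then ⟨_, h⟩ else 0

theorem curryOn_apply {F : Type*} [NormedAddCommGroup F] [NormedSpace ℝ F] {Φ : E × G → F}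
    {s : C(X, G)} {k : E} (hΦ : ∀ x, ContDiffAt ℝ ∞ Φ (k, s x)) (x : X) :
    curryOn Φ s k x = Φ (k, s x) := by
  have h : Continuous fun x => Φ (k, s x) := by
    refine continuous_iff_continuousAt.2 fun x => ?_
    exact (hΦ x).continuousAt.comp
      (f := fun x => (k, s x)) (continuous_const.prodMk s.continuous).continuousAt
  simp [curryOn, h]

/-- Joint continuity curries to continuity for the compact-open topology; compactness of `X` is
needed only once norms on `C(X, F)` appear. -/
theorem continuousOn_curryOn {F : Type*} [NormedAddCommGroup F] [NormedSpace ℝ F]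
    {Φ : E × G → F} {s : C(X, G)} {Ω : Set E}
    (hΦ : ∀ k ∈ Ω, ∀ x, ContDiffAt ℝ ∞ Φ (k, s x)) : ContinuousOn (curryOn Φ s) Ω := by
  rw [continuousOn_iff_continuous_domRestrict]
  refine ContinuousMap.continuous_of_continuous_uncurry _ ?_
  have : (Function.uncurry fun (k : Ω) (x : X) => Ω.domRestrict (curryOn Φ s) k x) =
      fun p : Ω × X => Φ (p.1.1, s p.2) := by
    ext p
    exact curryOn_apply (hΦ p.1.1 p.1.2) p.2
  have h2 : Continuous fun p : Ω × X => Φ (p.1.1, s p.2) := by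
    refine continuous_iff_continuousAt.2 fun p => ?_
    exact (hΦ p.1.1 p.1.2 p.2).continuousAt.comp (f := fun p : Ω × X => (p.1.1, s p.2))
      (by fun_prop)
  exact this ▸ h2

variable [CompactSpace X]

/-- A continuous function with values in the linear maps is a linear map with values in the
continuous functions. -/
def flipContinuousMap (X : Type*) [TopologicalSpace X] [CompactSpace X] (E F : Type*)
    [NormedAddCommGroup E] [NormedSpace ℝ E] [NormedAddCommGroup F] [NormedSpace ℝ F] :
    C(X, E →L[ℝ] F) →L[ℝ] (E →L[ℝ] C(X, F)) :=
  LinearMap.mkContinuous₂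
    (LinearMap.mk₂ ℝ (fun (T : C(X, E →L[ℝ] F)) (v : E) =>
      (⟨fun x => T x v, by fun_prop⟩ : C(X, F)))
      (fun _ _ _ => by ext; simp) (fun _ _ _ => by ext; simp)
      (fun _ _ _ => by ext; simp) (fun _ _ _ => by ext; simp)) 1
    (fun T v => by
      rw [one_mul, ContinuousMap.norm_le _ (by positivity)]
      intro x
      exact ((T x).le_opNorm v).trans
        (mul_le_mul_of_nonneg_right (T.norm_coe_le_norm x) (norm_nonneg v)))

theorem flipContinuousMap_apply {F : Type*} [NormedAddCommGroup F] [NormedSpace ℝ F]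
    (T : C(X, E →L[ℝ] F)) (v : E) (x : X) : flipContinuousMap X E F T v x = T x v := rfl

/-- The partial derivative with respect to the first variable. -/
def fderivFst {F : Type*} [NormedAddCommGroup F] [NormedSpace ℝ F] (Φ : E × G → F)
    (z : E × G) : E →L[ℝ] F :=
  (fderiv ℝ Φ z).comp (ContinuousLinearMap.inl ℝ E G)

theorem contDiffAt_fderivFst {F : Type*} [NormedAddCommGroup F] [NormedSpace ℝ F]
    {Φ : E × G → F} {z : E × G} (h : ContDiffAt ℝ ∞ Φ z) : ContDiffAt ℝ ∞ (fderivFst Φ) z := by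
  unfold fderivFst
  exact (h.fderiv_right (m := ∞) (by simp)).clm_comp contDiffAt_const

/-- The partial derivative is continuous in `k` in the sup norm, so on a small ball around `k` it
differs from its value at `k` by less than `c` for all `x` at once. The mean value inequality for
each `x` then gives a remainder that is uniform in `x`. -/
theorem hasFDerivAt_curryOn {F : Type*} [NormedAddCommGroup F] [NormedSpace ℝ F]
    {Φ : E × G → F} {s : C(X, G)} {Ω : Set E} (hΩ : IsOpen Ω)
    (hΦ : ∀ k ∈ Ω, ∀ x, ContDiffAt ℝ ∞ Φ (k, s x)) {k : E} (hk : k ∈ Ω) :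
    HasFDerivAt (curryOn Φ s) (flipContinuousMap X E F (curryOn (fderivFst Φ) s k)) k := by
  have hD : ∀ k ∈ Ω, ∀ x, ContDiffAt ℝ ∞ (fderivFst Φ) (k, s x) :=
    fun k hk x => contDiffAt_fderivFst (hΦ k hk x)
  have hc : ContinuousAt (curryOn (fderivFst Φ) s) k :=
    (continuousOn_curryOn hD).continuousAt (hΩ.mem_nhds hk)
  rw [hasFDerivAt_iff_isLittleO_nhds_zero, Asymptotics.isLittleO_iff]
  intro c hc0
  have h1 : ∀ᶠ k' in 𝓝 k, dist (curryOn (fderivFst Φ) s k') (curryOn (fderivFst Φ) s k) < c :=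
    Metric.tendsto_nhds.1 hc c hc0
  obtain ⟨δ, hδ, hball⟩ := Metric.eventually_nhds_iff_ball.1 (h1.and (hΩ.mem_nhds hk))
  have h2 : ∀ᶠ v : E in 𝓝 0, v ∈ Metric.ball (0 : E) δ := Metric.ball_mem_nhds _ hδ
  filter_upwards [h2] with v hv
  have hkv : k + v ∈ Metric.ball k δ := by simpa [dist_eq_norm] using hv
  rw [ContinuousMap.norm_le _ (by positivity)]
  intro x
  have key := (convex_ball k δ).norm_image_sub_le_of_norm_hasFDerivWithin_le'
    (f := fun k' => Φ (k', s x)) (f' := fun k' => fderivFst Φ (k', s x))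
    (φ := fderivFst Φ (k, s x)) (C := c) (x := k) (y := k + v)
    (fun k' hk' => by
      have hd := ((hΦ k' (hball k' hk').2 x).differentiableAt (by simp)).hasFDerivAt
      exact (hd.comp k' (hasFDerivAt_prodMk_left k' (s x))).hasFDerivWithinAt)
    (fun k' hk' => by
      have h3 := (hball k' hk').1
      rw [dist_eq_norm] at h3
      have h4 := (ContinuousMap.norm_coe_le_norm _ x).trans h3.le
      rwa [ContinuousMap.sub_apply, curryOn_apply (hD k' (hball k' hk').2),
        curryOn_apply (hD k hk)] at h4)
    (Metric.mem_ball_self hδ) hkv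
  rw [ContinuousMap.sub_apply, ContinuousMap.sub_apply, flipContinuousMap_apply,
    curryOn_apply (hΦ _ (hball _ hkv).2), curryOn_apply (hΦ k hk), curryOn_apply (hD k hk)]
  simpa using key

/-- Induction on the order: the derivative of a curried map is again a curried map, that of the
partial derivative, up to the continuous linear flip. The target `F` is generalized, and lives in
the universe of `E`, so that the induction hypothesis applies to `E →L[ℝ] F`. -/
theorem contDiffOn_curryOn {F : Type u} [NormedAddCommGroup F] [NormedSpace ℝ F]
    {Φ : E × G → F} {s : C(X, G)} {Ω : Set E} (hΩ : IsOpen Ω)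
    (hΦ : ∀ k ∈ Ω, ∀ x, ContDiffAt ℝ ∞ Φ (k, s x)) : ContDiffOn ℝ ∞ (curryOn Φ s) Ω := by
  rw [contDiffOn_infty]
  intro n
  induction n generalizing F with
  | zero => exact contDiffOn_zero.2 (continuousOn_curryOn hΦ)
  | succ n ih =>
    have hD : ∀ k ∈ Ω, ∀ x, ContDiffAt ℝ ∞ (fderivFst Φ) (k, s x) :=
      fun k hk x => contDiffAt_fderivFst (hΦ k hk x)
    push_cast
    rw [contDiffOn_succ_iff_hasFDerivWithinAt_of_uniqueDiffOn hΩ.uniqueDiffOn]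
    refine ⟨fun h => by simp at h, fun k => flipContinuousMap X E F (curryOn (fderivFst Φ) s k),
      ?_, fun k hk => ?_⟩
    · have h1 : ContDiff ℝ n (flipContinuousMap X E F) := ContinuousLinearMap.contDiff _
      exact h1.comp_contDiffOn (ih hD)
    · exact (hasFDerivAt_curryOn hΩ hΦ hk).hasFDerivWithinAt

end Curry

/-! ### Iterated derivatives at a point: partial derivatives, Leibniz rule, symmetry. -/

section Partial

variable {E : Type*} [NormedAddCommGroup E] [NormedSpace ℝ E]
  {G : Type*} [NormedAddCommGroup G] [NormedSpace ℝ G]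
  {F : Type*} [NormedAddCommGroup F] [NormedSpace ℝ F]

/-- Smoothness is assumed at one point only. It persists, to finite order, on an open neighbourhood,
where derivatives within the set are the ordinary ones. The Leibniz bound below is obtained in the
same way. -/
theorem iteratedFDeriv_comp_clm_of_contDiffAt {f : E → F} (g : G →L[ℝ] E) {x : G} {i : ℕ}
    (hf : ContDiffAt ℝ i f (g x)) :
    iteratedFDeriv ℝ i (f ∘ g) x =
      (iteratedFDeriv ℝ i f (g x)).compContinuousLinearMap fun _ => g := by
  obtain ⟨u, hu, hfu⟩ := hf.contDiffOn (m := i) le_rfl (by simp)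
  obtain ⟨v, hvu, hv, hxv⟩ := mem_nhds_iff.1 hu
  have hgv : IsOpen (g ⁻¹' v) := hv.preimage g.continuous
  have h := g.iteratedFDerivWithin_comp_right (hfu.mono hvu) hv.uniqueDiffOn hgv.uniqueDiffOn hxv
    le_rfl
  rwa [iteratedFDerivWithin_of_isOpen i hv hxv,
    iteratedFDerivWithin_of_isOpen i hgv hxv] at h

theorem norm_iteratedFDeriv_mul_le_of_contDiffAt {A : Type*} [NormedRing A] [NormedAlgebra ℝ A]
    {f g : E → A} {x : E} {n : ℕ} (hf : ContDiffAt ℝ n f x) (hg : ContDiffAt ℝ n g x) :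
    ‖iteratedFDeriv ℝ n (fun y => f y * g y) x‖ ≤ ∑ i ∈ Finset.range (n + 1),
      (n.choose i : ℝ) * ‖iteratedFDeriv ℝ i f x‖ * ‖iteratedFDeriv ℝ (n - i) g x‖ := by
  obtain ⟨u, hu, hfu⟩ := hf.contDiffOn (m := n) le_rfl (by simp)
  obtain ⟨u', hu', hgu⟩ := hg.contDiffOn (m := n) le_rfl (by simp)
  obtain ⟨v, hv, hvo, hx⟩ := mem_nhds_iff.1 (inter_mem hu hu')
  have h := norm_iteratedFDerivWithin_mul_le (hfu.mono (hv.trans inter_subset_left))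
    (hgu.mono (hv.trans inter_subset_right)) hvo.uniqueDiffOn hx (n := n) le_rfl
  simpa only [iteratedFDerivWithin_of_isOpen _ hvo hx] using h

/-- Freezing the second variable at `p` means composing the translate of `H` by `(0, p)` with the
linear inclusion `e ↦ (e, 0)`. -/
theorem iteratedFDeriv_partial {H : E × G → F} {e : E} {p : G} {i : ℕ}
    (hH : ContDiffAt ℝ i H (e, p)) :
    iteratedFDeriv ℝ i (fun e => H (e, p)) e =
      (iteratedFDeriv ℝ i H (e, p)).compContinuousLinearMap
        fun _ => ContinuousLinearMap.inl ℝ E G := by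
  have h1 : (fun e => H (e, p)) =
      (fun z => H (z + (0, p))) ∘ ContinuousLinearMap.inl ℝ E G := by
    ext e; simp
  have h2 : ContDiffAt ℝ i (fun z => H (z + (0, p))) (ContinuousLinearMap.inl ℝ E G e) := by
    refine ContDiffAt.comp _ ?_ (by fun_prop)
    simpa using hH
  rw [h1, iteratedFDeriv_comp_clm_of_contDiffAt _ h2, iteratedFDeriv_comp_add_right]
  simp

theorem norm_iteratedFDeriv_partial_le {H : E × G → F} {e : E} {p : G} {i : ℕ}
    (hH : ContDiffAt ℝ i H (e, p)) :
    ‖iteratedFDeriv ℝ i (fun e => H (e, p)) e‖ ≤ ‖iteratedFDeriv ℝ i H (e, p)‖ := by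
  rw [iteratedFDeriv_partial hH]
  refine (ContinuousMultilinearMap.norm_compContinuousLinearMap_le _ _).trans ?_
  refine mul_le_of_le_one_right (norm_nonneg _) (Finset.prod_le_one (fun _ _ => norm_nonneg _)
    fun _ _ => ContinuousLinearMap.norm_inl_le_one ℝ E G)

/-- The second variable is a parameter that is not differentiated; joint smoothness on a compact set
makes the bound uniform in it. The symbol estimates by scaling rest on this. -/
theorem exists_bound_iteratedFDeriv_partial {H : E × G → F} {Z : Set (E × G)} (hZ : IsCompact Z)
    (hH : ∀ z ∈ Z, ContDiffAt ℝ ∞ H z) (i : ℕ) :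
    ∃ C, 0 ≤ C ∧ ∀ z ∈ Z, ‖iteratedFDeriv ℝ i (fun e => H (e, z.2)) z.1‖ ≤ C := by
  have hc : ContinuousOn (iteratedFDeriv ℝ i H) Z := fun z hz =>
    ((hH z hz).continuousAt_iteratedFDeriv (by exact_mod_cast le_top)).continuousWithinAt
  obtain ⟨C, hC⟩ := hZ.exists_bound_of_continuousOn hc
  refine ⟨max C 0, le_max_right _ _, fun z hz => ?_⟩
  refine (norm_iteratedFDeriv_partial_le (e := z.1) (p := z.2) ?_).trans
    ((hC z hz).trans (le_max_left _ _))
  exact (hH z hz).of_le (by exact_mod_cast le_top)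

theorem fin_tail_comp_swap {α : Type*} {n : ℕ} (j : Fin n) (v : Fin (n + 2) → α) :
    Fin.tail (v ∘ Equiv.swap j.succ.castSucc j.succ.succ) =
      Fin.tail v ∘ Equiv.swap j.castSucc j.succ := by
  ext k
  simp only [Fin.tail, Function.comp, ← Fin.succ_castSucc, Equiv.swap_apply_def, Fin.succ_inj]
  split_ifs <;> rfl

/-- Exchanging the first two slots is the symmetry of the second derivative of the derivative of
order two less. An exchange further to the right leaves the outermost differentiation alone and is
handled by induction on the inner derivative. -/
theorem iteratedFDeriv_comp_swap {f : E → F} {x : E} {n : ℕ} (hf : ContDiffAt ℝ (n + 1 : ℕ) f x)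
    (i : Fin n) (v : Fin (n + 1) → E) :
    iteratedFDeriv ℝ (n + 1) f x (v ∘ Equiv.swap i.castSucc i.succ) =
      iteratedFDeriv ℝ (n + 1) f x v := by
  induction n generalizing x with
  | zero => exact i.elim0
  | succ n ih =>
    refine Fin.cases ?_ (fun j => ?_) i
    · have hs : IsSymmSndFDerivAt ℝ (iteratedFDeriv ℝ n f) x := by
        refine ContDiffAt.isSymmSndFDerivAt (n := 2)
          (hf.iteratedFDeriv_right (i := n) (m := 2) ?_) (by simp)
        norm_cast; omega
      have key : ∀ w : Fin (n + 2) → E, iteratedFDeriv ℝ (n + 2) f x w =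
          fderiv ℝ (fderiv ℝ (iteratedFDeriv ℝ n f)) x (w 0) (w 1) (Fin.tail (Fin.tail w)) := by
        intro w
        rw [iteratedFDeriv_succ_apply_left]
        have h1 : iteratedFDeriv ℝ (n + 1) f =
            (continuousMultilinearCurryLeftEquiv ℝ (fun _ : Fin (n + 1) => E) F).symm ∘
              fderiv ℝ (iteratedFDeriv ℝ n f) := iteratedFDeriv_succ_eq_comp_left
        have h2 := LinearIsometryEquiv.comp_fderiv (𝕜 := ℝ) (x := x)
          (continuousMultilinearCurryLeftEquiv ℝ (fun _ : Fin (n + 1) => E) F).symm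
          (f := fderiv ℝ (iteratedFDeriv ℝ n f))
        rw [← h1] at h2
        rw [h2]
        rfl
      rw [key, key]
      have e1 : (v ∘ Equiv.swap (Fin.castSucc (0 : Fin (n + 1))) (Fin.succ 0)) 0 = v 1 := by
        simp
      have e2 : (v ∘ Equiv.swap (Fin.castSucc (0 : Fin (n + 1))) (Fin.succ 0)) 1 = v 0 := by
        simp
      have e3 : Fin.tail (Fin.tail
          (v ∘ Equiv.swap (Fin.castSucc (0 : Fin (n + 1))) (Fin.succ 0))) =
          Fin.tail (Fin.tail v) := by
        ext k
        simp only [Fin.tail, Function.comp]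
        rw [Equiv.swap_apply_of_ne_of_ne]
        · simp [Fin.ext_iff]
        · simp [Fin.ext_iff]
      rw [e1, e2, e3, hs (v 1) (v 0)]
    · rw [iteratedFDeriv_succ_apply_left, iteratedFDeriv_succ_apply_left, fin_tail_comp_swap]
      have e1 : (v ∘ Equiv.swap (j.succ).castSucc (j.succ).succ) 0 = v 0 := by
        simp only [Function.comp]
        rw [Equiv.swap_apply_of_ne_of_ne] <;> simp [Fin.ext_iff]
      rw [e1]
      -- The inductive identity is going to be differentiated once more, so it is needed at all
      -- nearby points and not only at `x`.
      have hev : ∀ᶠ y in 𝓝 x, ContDiffAt ℝ (n + 1 + 1 : ℕ) f y := hf.eventually (by simp)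
      have hdiff : DifferentiableAt ℝ (iteratedFDeriv ℝ (n + 1) f) x :=
        (hf.iteratedFDeriv_right (i := n + 1) (m := 1)
          (by norm_cast; omega)).differentiableAt (by simp)
      have h1 : ∀ w : Fin (n + 1) → E, fderiv ℝ (iteratedFDeriv ℝ (n + 1) f) x (v 0) w =
          fderiv ℝ (fun y => iteratedFDeriv ℝ (n + 1) f y w) x (v 0) := by
        intro w
        rw [fderiv_continuousMultilinear_apply_const_apply hdiff]
      rw [h1, h1]
      congr 1
      refine Filter.EventuallyEq.fderiv_eq ?_
      filter_upwards [hev] with y hy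
      exact ih (hy.of_le (by norm_cast; omega)) j (Fin.tail v)

/-- Adjacent transpositions generate all permutations. -/
theorem iteratedFDeriv_comp_perm_of_contDiffAt {f : E → F} {x : E} {n : ℕ}
    (hf : ContDiffAt ℝ n f x) (π : Equiv.Perm (Fin n)) (v : Fin n → E) :
    iteratedFDeriv ℝ n f x (v ∘ π) = iteratedFDeriv ℝ n f x v := by
  cases n with
  | zero => congr 1; ext i; exact i.elim0
  | succ n =>
    have h := Equiv.Perm.mclosure_swap_castSucc_succ n
    have hπ : π ∈ Submonoid.closure (Set.range fun i : Fin n ↦ Equiv.swap i.castSucc i.succ) := by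
      rw [h]; trivial
    induction hπ using Submonoid.closure_induction generalizing v with
    | mem π hπ =>
      obtain ⟨i, rfl⟩ := hπ
      exact iteratedFDeriv_comp_swap hf i v
    | one => rfl
    | mul a b _ _ iha ihb =>
      rw [Equiv.Perm.coe_mul, ← Function.comp_assoc, ihb, iha]

end Partial

/-! ### Symbols and rescaling -/

section Rescale

variable {d t : ℕ}

/-- The function `(k, l) ↦ b (k, R l)`. -/
def rescale (R : ℝ) (b : EuclideanSpace ℝ (Fin d) → EuclideanSpace ℝ (Fin t) → ℂ)
    (z : EuclideanSpace ℝ (Fin d) × EuclideanSpace ℝ (Fin t)) : ℂ := b z.1 (R • z.2)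

/-- The linear equivalence `(k, l) ↦ (k, R l)`. -/
def rescaleEquiv (d t : ℕ) {R : ℝ} (hR : R ≠ 0) :
    (EuclideanSpace ℝ (Fin d) × EuclideanSpace ℝ (Fin t)) ≃L[ℝ]
      (EuclideanSpace ℝ (Fin d) × EuclideanSpace ℝ (Fin t)) :=
  (ContinuousLinearEquiv.refl ℝ _).prodCongr (ContinuousLinearEquiv.smulLeft (Units.mk0 R hR))

theorem rescaleEquiv_apply {R : ℝ} (hR : R ≠ 0)
    (z : EuclideanSpace ℝ (Fin d) × EuclideanSpace ℝ (Fin t)) :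
    rescaleEquiv d t hR z = (z.1, R • z.2) := rfl

theorem iteratedFDeriv_rescale {R : ℝ} (hR : R ≠ 0)
    (b : EuclideanSpace ℝ (Fin d) → EuclideanSpace ℝ (Fin t) → ℂ) (N : ℕ)
    (z : EuclideanSpace ℝ (Fin d) × EuclideanSpace ℝ (Fin t)) :
    iteratedFDeriv ℝ N (rescale R b) z =
      (iteratedFDeriv ℝ N (Function.uncurry b) (z.1, R • z.2)).compContinuousLinearMap
        fun _ => (rescaleEquiv d t hR : _ →L[ℝ] _) := by
  have h := (rescaleEquiv d t hR).iteratedFDerivWithin_comp_right (Function.uncurry b)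
    uniqueDiffOn_univ (x := z) (mem_univ _) N
  rw [preimage_univ, iteratedFDerivWithin_univ, iteratedFDerivWithin_univ] at h
  exact h

/-- The vectors along which `mixedPartial` differentiates. -/
def partialDirections (d t : ℕ) {a b : ℕ} (α : Fin a → Fin d) (β : Fin b → Fin t) :
    Fin (a + b) → EuclideanSpace ℝ (Fin d) × EuclideanSpace ℝ (Fin t) :=
  Fin.append (fun i => (EuclideanSpace.single (α i) (1 : ℝ), 0))
    (fun j => (0, EuclideanSpace.single (β j) (1 : ℝ)))

theorem norm_partialDirections {a b : ℕ} (α : Fin a → Fin d) (β : Fin b → Fin t)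
    (i : Fin (a + b)) : ‖partialDirections d t α β i‖ = 1 := by
  unfold partialDirections
  refine Fin.addCases (fun j => ?_) (fun j => ?_) i <;>
    simp [Prod.norm_def]

/-- The `k`-directions are fixed by the rescaling and each of the `b` directions in `l` is stretched
by `R`; multilinearity collects `R ^ b`. -/
theorem iteratedFDeriv_rescale_partialDirections {R : ℝ} (hR : R ≠ 0)
    (f : EuclideanSpace ℝ (Fin d) → EuclideanSpace ℝ (Fin t) → ℂ) {a b : ℕ}
    (α : Fin a → Fin d) (β : Fin b → Fin t) (k : EuclideanSpace ℝ (Fin d))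
    (l : EuclideanSpace ℝ (Fin t)) :
    iteratedFDeriv ℝ (a + b) (rescale R f) (k, R⁻¹ • l) (partialDirections d t α β) =
      (R ^ b) • iteratedFDeriv ℝ (a + b) (Function.uncurry f) (k, l)
        (partialDirections d t α β) := by
  rw [iteratedFDeriv_rescale hR, ContinuousMultilinearMap.compContinuousLinearMap_apply]
  have h1 : (fun i => (rescaleEquiv d t hR : _ →L[ℝ] _) (partialDirections d t α β i)) =
      fun i => (Fin.append (fun _ : Fin a => (1 : ℝ)) (fun _ : Fin b => R) i) •
        partialDirections d t α β i := by
    ext1 i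
    unfold partialDirections
    refine Fin.addCases (fun j => ?_) (fun j => ?_) i <;>
      simp [rescaleEquiv_apply]
  have h2 : ∏ i, Fin.append (fun _ : Fin a => (1 : ℝ)) (fun _ : Fin b => R) i = R ^ b := by
    simp [Fin.prod_univ_add]
  rw [h1, ContinuousMultilinearMap.map_smul_univ, h2]
  simp [smul_smul, mul_inv_cancel₀ hR]

/-- The norm of the derivative of order `N` at `(k, l)`, measured on the scale `1 + |l|` and
relative to the growth `(1 + |l|)^r`. -/
def symNorm (r : ℝ) (N : ℕ) (b : EuclideanSpace ℝ (Fin d) → EuclideanSpace ℝ (Fin t) → ℂ)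
    (k : EuclideanSpace ℝ (Fin d)) (l : EuclideanSpace ℝ (Fin t)) : ℝ :=
  (1 + ‖l‖) ^ (-r) * ‖iteratedFDeriv ℝ N (rescale (1 + ‖l‖) b) (k, (1 + ‖l‖)⁻¹ • l)‖

theorem symNorm_nonneg (r : ℝ) (N : ℕ)
    (b : EuclideanSpace ℝ (Fin d) → EuclideanSpace ℝ (Fin t) → ℂ)
    (k : EuclideanSpace ℝ (Fin d)) (l : EuclideanSpace ℝ (Fin t)) : 0 ≤ symNorm r N b k l := by
  unfold symNorm; positivity

/-- With `R = 1 + |l|` the factor `R^|β|` of the seminorm is exactly what the chain rule for `l ↦ R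
l` produces. The weights thus become ordinary derivatives of a rescaled function, for which Leibniz
and compactness arguments need no bookkeeping of `β`. -/
theorem symWeight_eq (r : ℝ) (α : List (Fin d)) (β : List (Fin t))
    (b : EuclideanSpace ℝ (Fin d) → EuclideanSpace ℝ (Fin t) → ℂ)
    (k : EuclideanSpace ℝ (Fin d)) (l : EuclideanSpace ℝ (Fin t)) :
    symWeight r α β b k l = (1 + ‖l‖) ^ (-r) *
      ‖iteratedFDeriv ℝ (α.length + β.length) (rescale (1 + ‖l‖) b) (k, (1 + ‖l‖)⁻¹ • l)
        (partialDirections d t α.get β.get)‖ := by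
  have hR : 0 < 1 + ‖l‖ := by positivity
  rw [iteratedFDeriv_rescale_partialDirections hR.ne', norm_smul, ← mul_assoc, norm_pow,
    Real.norm_of_nonneg hR.le, ← Real.rpow_natCast, ← Real.rpow_add hR, neg_add_eq_sub]
  rfl

theorem symWeight_le_symNorm (r : ℝ) (α : List (Fin d)) (β : List (Fin t))
    (b : EuclideanSpace ℝ (Fin d) → EuclideanSpace ℝ (Fin t) → ℂ)
    (k : EuclideanSpace ℝ (Fin d)) (l : EuclideanSpace ℝ (Fin t)) :
    symWeight r α β b k l ≤ symNorm r (α.length + β.length) b k l := by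
  rw [symWeight_eq, symNorm]
  refine mul_le_mul_of_nonneg_left ?_ (by positivity)
  refine (ContinuousMultilinearMap.le_opNorm _ _).trans ?_
  simp [norm_partialDirections]

/-- The standard basis of `ℝᵈ × ℝᵗ`. -/
def prodBasisVec (d t : ℕ) :
    Fin d ⊕ Fin t → EuclideanSpace ℝ (Fin d) × EuclideanSpace ℝ (Fin t) :=
  Sum.elim (fun i => (EuclideanSpace.single i (1 : ℝ), 0))
    (fun j => (0, EuclideanSpace.single j (1 : ℝ)))

/-- The coordinates with respect to `prodBasisVec`. -/
def prodCoord (w : EuclideanSpace ℝ (Fin d) × EuclideanSpace ℝ (Fin t)) : Fin d ⊕ Fin t → ℝ :=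
  Sum.elim (fun i => w.1 i) (fun j => w.2 j)

theorem sum_prodCoord_smul (w : EuclideanSpace ℝ (Fin d) × EuclideanSpace ℝ (Fin t)) :
    ∑ j, prodCoord w j • prodBasisVec d t j = w := by
  rw [Fintype.sum_sum_type]
  ext i
  · simp [prodCoord, prodBasisVec, Prod.fst_sum, Pi.single_apply]
  · simp [prodCoord, prodBasisVec, Prod.snd_sum, Pi.single_apply]

theorem abs_prodCoord_le (w : EuclideanSpace ℝ (Fin d) × EuclideanSpace ℝ (Fin t))
    (j : Fin d ⊕ Fin t) : ‖prodCoord w j‖ ≤ ‖w‖ := by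
  cases j with
  | inl i => exact (PiLp.norm_apply_le w.1 i).trans (norm_fst_le w)
  | inr i => exact (PiLp.norm_apply_le w.2 i).trans (norm_snd_le w)

/-- Expand every argument in the standard basis; each coordinate is bounded by the norm of the
vector. -/
theorem norm_multilinear_le_sum {N : ℕ}
    (M : (EuclideanSpace ℝ (Fin d) × EuclideanSpace ℝ (Fin t)) [×N]→L[ℝ] ℂ) :
    ‖M‖ ≤ ∑ v : Fin N → Fin d ⊕ Fin t, ‖M (prodBasisVec d t ∘ v)‖ := by
  refine M.opNorm_le_bound (by positivity) fun w => ?_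
  have h : M w = ∑ v : Fin N → Fin d ⊕ Fin t,
      (∏ i, prodCoord (w i) (v i)) • M (prodBasisVec d t ∘ v) := by
    conv_lhs => rw [show w = fun i => ∑ j, prodCoord (w i) j • prodBasisVec d t j from
      funext fun i => (sum_prodCoord_smul (w i)).symm]
    rw [ContinuousMultilinearMap.map_sum]
    refine Finset.sum_congr rfl fun v _ => ?_
    rw [ContinuousMultilinearMap.map_smul_univ]
    rfl
  rw [h, Finset.sum_mul]
  refine (norm_sum_le _ _).trans (Finset.sum_le_sum fun v _ => ?_)
  rw [norm_smul, mul_comm, norm_prod]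
  refine mul_le_mul_of_nonneg_left ?_ (norm_nonneg _)
  exact Finset.prod_le_prod (fun _ _ => norm_nonneg _) fun i _ => abs_prodCoord_le _ _

/-- Every word in the basis vectors is a permutation of one whose letters are sorted. -/
theorem exists_perm_partialDirections {N : ℕ} (v : Fin N → Fin d ⊕ Fin t) :
    ∃ (α : List (Fin d)) (β : List (Fin t)) (e : Fin (α.length + β.length) ≃ Fin N),
      (prodBasisVec d t ∘ v) ∘ e = partialDirections d t α.get β.get := by
  classical
  let A := {i // (v i).isLeft = true}
  let B := {i // ¬ (v i).isLeft = true}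
  let α' : Fin (Fintype.card A) → Fin d := fun i =>
    (v ((Fintype.equivFin A).symm i).1).getLeft ((Fintype.equivFin A).symm i).2
  let β' : Fin (Fintype.card B) → Fin t := fun i =>
    (v ((Fintype.equivFin B).symm i).1).getRight
      (by simpa using ((Fintype.equivFin B).symm i).2)
  let e' : Fin (Fintype.card A + Fintype.card B) ≃ Fin N :=
    finSumFinEquiv.symm.trans
      ((Equiv.sumCongr (Fintype.equivFin A).symm (Fintype.equivFin B).symm).trans
        (Equiv.sumCompl fun i => (v i).isLeft = true))
  have key : (prodBasisVec d t ∘ v) ∘ e' = partialDirections d t α' β' := by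
    ext1 i
    refine Fin.addCases (fun j => ?_) (fun j => ?_) i
    · have h : v (e' (Fin.castAdd _ j)) = Sum.inl (α' j) := by
        simp [e', α']
        rfl
      simp [h, prodBasisVec, partialDirections]
    · have h : v (e' (Fin.natAdd _ j)) = Sum.inr (β' j) := by
        simp [e', β']
        rfl
      simp [h, prodBasisVec, partialDirections]
  -- Passes from functions on `Fin n` to lists, the form in which multi-indices enter `symWeight`.
  have hl : ∀ (X : Type) (n : ℕ) (f : Fin n → X), ∃ (L : List X) (h : L.length = n),
      f = L.get ∘ Fin.cast h.symm := fun X n f =>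
    ⟨List.ofFn f, List.length_ofFn, by ext i; simp⟩
  clear_value e' α' β'
  obtain ⟨L, hL, hL'⟩ := hl _ _ α'
  obtain ⟨L', hM, hM'⟩ := hl _ _ β'
  generalize Fintype.card A = a at *
  generalize Fintype.card B = b at *
  subst hL hM
  subst hL' hM'
  exact ⟨L, L', e', key⟩

/-- Converse of `symWeight_le_symNorm`: the norm of the derivative is controlled by its values on
words in the basis vectors, and by symmetry the letters may be sorted into `k`-directions followed
by `l`-directions. The choice of multi-indices is uniform in `r`, `b` and the point, so it yields a
bound by finitely many seminorms. -/
theorem exists_symNorm_le (d t N : ℕ) :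
    ∃ w : (Fin N → Fin d ⊕ Fin t) → List (Fin d) × List (Fin t),
      ∀ (r : ℝ) (b : EuclideanSpace ℝ (Fin d) → EuclideanSpace ℝ (Fin t) → ℂ)
        (k : EuclideanSpace ℝ (Fin d)) (l : EuclideanSpace ℝ (Fin t)),
        ContDiffAt ℝ N (Function.uncurry b) (k, l) →
        symNorm r N b k l ≤ ∑ v, symWeight r (w v).1 (w v).2 b k l := by
  choose α β e he using fun v : Fin N → Fin d ⊕ Fin t => exists_perm_partialDirections v
  refine ⟨fun v => (α v, β v), fun r b k l hb => ?_⟩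
  have hR : (0 : ℝ) < 1 + ‖l‖ := by positivity
  rw [symNorm]
  have hb' : ContDiffAt ℝ N (rescale (1 + ‖l‖) b) (k, (1 + ‖l‖)⁻¹ • l) := by
    refine ContDiffAt.comp (g := Function.uncurry b)
      (f := fun z : EuclideanSpace ℝ (Fin d) × EuclideanSpace ℝ (Fin t) =>
        (z.1, (1 + ‖l‖) • z.2)) _ ?_ (by fun_prop)
    simpa [smul_smul, mul_inv_cancel₀ hR.ne'] using hb
  refine (mul_le_mul_of_nonneg_left (norm_multilinear_le_sum _) (by positivity)).trans ?_
  rw [Finset.mul_sum]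
  refine Finset.sum_le_sum fun v _ => le_of_eq ?_
  rw [symWeight_eq, ← he v]
  have hN : (α v).length + (β v).length = N := by simpa using Fintype.card_congr (e v)
  generalize e v = e at *
  generalize (α v).length + (β v).length = N' at *
  subst hN
  rw [iteratedFDeriv_comp_perm_of_contDiffAt hb']

/-- At a fixed point `(k, l)` the scale `1 + |l|` is a constant and rescaling commutes with
products, so this is the ordinary Leibniz rule with the weight split as `(1 + |l|)^(-r) (1 +
|l|)^(-r')`. -/
theorem symNorm_mul_le (r r' : ℝ) (N : ℕ)
    {a b : EuclideanSpace ℝ (Fin d) → EuclideanSpace ℝ (Fin t) → ℂ}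
    {k : EuclideanSpace ℝ (Fin d)} {l : EuclideanSpace ℝ (Fin t)}
    (ha : ContDiffAt ℝ N (Function.uncurry a) (k, l))
    (hb : ContDiffAt ℝ N (Function.uncurry b) (k, l)) :
    symNorm (r + r') N (a * b) k l ≤
      ∑ i ∈ Finset.range (N + 1), (N.choose i : ℝ) * symNorm r i a k l *
        symNorm r' (N - i) b k l := by
  have hR : (0 : ℝ) < 1 + ‖l‖ := by positivity
  have hres : ∀ {c : EuclideanSpace ℝ (Fin d) → EuclideanSpace ℝ (Fin t) → ℂ},
      ContDiffAt ℝ N (Function.uncurry c) (k, l) →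
        ContDiffAt ℝ N (rescale (1 + ‖l‖) c) (k, (1 + ‖l‖)⁻¹ • l) := by
    intro c hc
    refine ContDiffAt.comp (g := Function.uncurry c)
      (f := fun z : EuclideanSpace ℝ (Fin d) × EuclideanSpace ℝ (Fin t) =>
        (z.1, (1 + ‖l‖) • z.2)) _ ?_ (by fun_prop)
    simpa [smul_smul, mul_inv_cancel₀ hR.ne'] using hc
  have h := norm_iteratedFDeriv_mul_le_of_contDiffAt (hres ha) (hres hb)
  have hmul : rescale (1 + ‖l‖) (a * b) =
      fun z => rescale (1 + ‖l‖) a z * rescale (1 + ‖l‖) b z := rfl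
  rw [symNorm, hmul]
  refine (mul_le_mul_of_nonneg_left h (by positivity)).trans (le_of_eq ?_)
  rw [Finset.mul_sum]
  refine Finset.sum_congr rfl fun i _ => ?_
  rw [symNorm, symNorm, neg_add, Real.rpow_add hR]
  ring

end Rescale

/-! ### Symbol estimates, products and convergence in the symbol spaces. -/

section SymbolSpace

variable {d t : ℕ} {Ω : Opens (EuclideanSpace ℝ (Fin d))}

theorem symWeight_le_symSeminorm {r : ℝ} (a : SymbolSpace Ω t r) (K : CompactsIn Ω)
    (α : List (Fin d)) (β : List (Fin t)) {k : EuclideanSpace ℝ (Fin d)} (hk : k ∈ K.1)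
    (l : EuclideanSpace ℝ (Fin t)) :
    symWeight r α β a.1 k l ≤ symSeminorm Ω t r (K, α, β) a :=
  le_ciSup (a.2.2 K α β) (⟨⟨k, hk⟩, l⟩ : K.1 × EuclideanSpace ℝ (Fin t))

theorem symSeminorm_le {r : ℝ} (a : SymbolSpace Ω t r) (K : CompactsIn Ω)
    (α : List (Fin d)) (β : List (Fin t)) {C : ℝ} (hC : 0 ≤ C)
    (h : ∀ k ∈ K.1, ∀ l, symWeight r α β a.1 k l ≤ C) : symSeminorm Ω t r (K, α, β) a ≤ C :=
  Real.iSup_le (fun z => h _ z.1.2 _) hC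

/-- The bound on `symNorm` given by finitely many of the defining seminorms. -/
theorem exists_symNorm_le_seminorm (Ω : Opens (EuclideanSpace ℝ (Fin d))) (t N : ℕ) :
    ∃ w : (Fin N → Fin d ⊕ Fin t) → List (Fin d) × List (Fin t),
      ∀ (r : ℝ) (a : SymbolSpace Ω t r) (K : CompactsIn Ω), ∀ k ∈ K.1, ∀ l,
        symNorm r N a.1 k l ≤ ∑ v, symSeminorm Ω t r (K, w v) a := by
  obtain ⟨w, hw⟩ := exists_symNorm_le d t N
  refine ⟨w, fun r a K k hk l => (hw r a.1 k l (a.2.1.contDiffAt_prod (K.2.2 hk) l N)).trans ?_⟩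
  exact Finset.sum_le_sum fun v _ => symWeight_le_symSeminorm a K _ _ hk l

theorem exists_symNorm_bound {r : ℝ}
    {a : EuclideanSpace ℝ (Fin d) → EuclideanSpace ℝ (Fin t) → ℂ} (ha : a ∈ symSubmodule Ω t r)
    (K : CompactsIn Ω) (N : ℕ) : ∃ C, 0 ≤ C ∧ ∀ k ∈ K.1, ∀ l, symNorm r N a k l ≤ C := by
  obtain ⟨w, hw⟩ := exists_symNorm_le_seminorm Ω t N
  exact ⟨∑ v, symSeminorm Ω t r (K, w v) ⟨a, ha⟩,
    Finset.sum_nonneg fun v _ => apply_nonneg _ _, fun k hk l => hw r ⟨a, ha⟩ K k hk l⟩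

theorem mem_symSubmodule_of_symNorm {r : ℝ}
    {a : EuclideanSpace ℝ (Fin d) → EuclideanSpace ℝ (Fin t) → ℂ} (ha : SmoothOnProd Ω a)
    (h : ∀ (K : CompactsIn Ω) (N : ℕ), ∃ C, ∀ k ∈ K.1, ∀ l, symNorm r N a k l ≤ C) :
    a ∈ symSubmodule Ω t r := by
  refine ⟨ha, fun K α β => ?_⟩
  obtain ⟨C, hC⟩ := h K (α.length + β.length)
  refine ⟨C, ?_⟩
  rintro _ ⟨z, rfl⟩
  exact (symWeight_le_symNorm _ _ _ _ _ _).trans (hC _ z.1.2 _)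

theorem exists_symWeight_bound_of_norm_le {r : ℝ}
    {a : EuclideanSpace ℝ (Fin d) → EuclideanSpace ℝ (Fin t) → ℂ} (ha : SmoothOnProd Ω a)
    (K : CompactsIn Ω) (α : List (Fin d)) (β : List (Fin t)) (ρ : ℝ) :
    ∃ C, ∀ k ∈ K.1, ∀ l, ‖l‖ ≤ ρ → symWeight r α β a k l ≤ C := by
  have hZ : IsCompact (K.1 ×ˢ Metric.closedBall (0 : EuclideanSpace ℝ (Fin t)) ρ) :=
    K.2.1.prod (isCompact_closedBall _ _)
  have hc : ContinuousOn (fun z : EuclideanSpace ℝ (Fin d) × EuclideanSpace ℝ (Fin t) =>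
      symWeight r α β a z.1 z.2) (K.1 ×ˢ Metric.closedBall 0 ρ) := by
    have h1 : ContinuousOn (iteratedFDeriv ℝ (α.length + β.length) (Function.uncurry a))
        (K.1 ×ˢ Metric.closedBall 0 ρ) := fun z hz =>
      ((ha.contDiffAt_prod (K.2.2 hz.1) z.2 (α.length + β.length)).continuousAt_iteratedFDeriv
        le_rfl).continuousWithinAt
    unfold symWeight mixedPartial
    refine ContinuousOn.mul ?_ ?_
    · refine Continuous.continuousOn ?_
      refine Continuous.rpow_const (by fun_prop) fun z => Or.inl (by positivity)
    · refine ContinuousOn.norm ?_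
      exact (ContinuousMultilinearMap.apply ℝ _ ℂ _).continuous.comp_continuousOn h1
  obtain ⟨C, hC⟩ := hZ.exists_bound_of_continuousOn hc
  refine ⟨C, fun k hk l hl => (le_abs_self _).trans (hC (k, l) ⟨hk, by simpa using hl⟩)⟩

/-- The region `k ∈ K`, `|l| ≤ ρ` is compact, where smoothness alone gives a bound. -/
theorem mem_symSubmodule_of_large {r : ℝ}
    {a : EuclideanSpace ℝ (Fin d) → EuclideanSpace ℝ (Fin t) → ℂ} (ha : SmoothOnProd Ω a) (ρ : ℝ)
    (h : ∀ (K : CompactsIn Ω) (N : ℕ), ∃ C, ∀ k ∈ K.1, ∀ l, ρ ≤ ‖l‖ → symNorm r N a k l ≤ C) :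
    a ∈ symSubmodule Ω t r := by
  refine ⟨ha, fun K α β => ?_⟩
  obtain ⟨C, hC⟩ := h K (α.length + β.length)
  obtain ⟨C', hC'⟩ := exists_symWeight_bound_of_norm_le (r := r) ha K α β ρ
  refine ⟨max C C', ?_⟩
  rintro _ ⟨z, rfl⟩
  rcases le_total ρ ‖z.2‖ with hz | hz
  · exact ((symWeight_le_symNorm _ _ _ _ _ _).trans (hC _ z.1.2 _ hz)).trans (le_max_left _ _)
  · exact (hC' _ z.1.2 _ hz).trans (le_max_right _ _)

/-- Functions which on every scale `R = 1 + |l|` look like `R^r H (·, p)`, where `p` runs through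
a compact set of parameters, satisfy symbol bounds of order `r` uniformly. -/
theorem exists_symNorm_bound_of_scaling {P : Type*} [NormedAddCommGroup P] [NormedSpace ℝ P]
    {H : (EuclideanSpace ℝ (Fin d) × EuclideanSpace ℝ (Fin t)) × P → ℂ}
    {K : Set (EuclideanSpace ℝ (Fin d))} (hK : IsCompact K) {Q : Set P} (hQ : IsCompact Q)
    (hH : ∀ k ∈ K, ∀ l, 1 / 2 ≤ ‖l‖ → ‖l‖ ≤ 1 → ∀ p ∈ Q, ContDiffAt ℝ ∞ H ((k, l), p)) (N : ℕ) :
    ∃ C, 0 ≤ C ∧ ∀ (r : ℝ) (b : EuclideanSpace ℝ (Fin d) → EuclideanSpace ℝ (Fin t) → ℂ),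
      ∀ k ∈ K, ∀ l, 1 ≤ ‖l‖ → ∀ p ∈ Q,
        (∀ᶠ z in 𝓝 (k, (1 + ‖l‖)⁻¹ • l), rescale (1 + ‖l‖) b z =
          ((1 + ‖l‖) ^ r : ℝ) • H (z, p)) → symNorm r N b k l ≤ C := by
  have hA : IsCompact {l : EuclideanSpace ℝ (Fin t) | 1 / 2 ≤ ‖l‖ ∧ ‖l‖ ≤ 1} := by
    have : {l : EuclideanSpace ℝ (Fin t) | 1 / 2 ≤ ‖l‖ ∧ ‖l‖ ≤ 1} =
        Metric.closedBall 0 1 ∩ {l | 1 / 2 ≤ ‖l‖} := by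
      ext l; simp [and_comm]
    rw [this]
    exact (isCompact_closedBall _ _).inter_right (isClosed_le continuous_const continuous_norm)
  obtain ⟨C, hC0, hC⟩ := exists_bound_iteratedFDeriv_partial (H := H) ((hK.prod hA).prod hQ)
    (by rintro ⟨⟨k, l⟩, p⟩ ⟨⟨hk, hl⟩, hp⟩; exact hH k hk l hl.1 hl.2 p hp) N
  refine ⟨C, hC0, fun r b k hk l hl p hp hev => ?_⟩
  have hR : (0 : ℝ) < 1 + ‖l‖ := by positivity
  -- Since `|l| ≥ 1`, the rescaled point `l / (1 + |l|)` lies in the compact shell `1/2 ≤ |l'| ≤ 1`,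
  -- away from the origin.
  have hl' : (1 + ‖l‖)⁻¹ • l ∈ {l : EuclideanSpace ℝ (Fin t) | 1 / 2 ≤ ‖l‖ ∧ ‖l‖ ≤ 1} := by
    rw [mem_ofPred_eq, norm_smul, norm_inv, Real.norm_of_nonneg hR.le, ← div_eq_inv_mul]
    constructor
    · rw [div_le_div_iff₀ (by norm_num) hR]; linarith
    · rw [div_le_one hR]; linarith
  have hcd : ContDiffAt ℝ N (fun z => H (z, p)) (k, (1 + ‖l‖)⁻¹ • l) := by
    have h1 := hH k hk _ hl'.1 hl'.2 p hp
    have h2 : ContDiffAt ℝ ∞ (fun z => H (z, p)) (k, (1 + ‖l‖)⁻¹ • l) :=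
      ContDiffAt.comp (g := H) (f := fun z => (z, p)) _ h1 (by fun_prop)
    exact h2.of_le (by exact_mod_cast le_top)
  have hev' : rescale (1 + ‖l‖) b =ᶠ[𝓝 (k, (1 + ‖l‖)⁻¹ • l)]
      fun z => ((1 + ‖l‖) ^ r : ℝ) • H (z, p) := hev
  have hsm : iteratedFDeriv ℝ N (fun z => ((1 + ‖l‖) ^ r : ℝ) • H (z, p))
      (k, (1 + ‖l‖)⁻¹ • l) = ((1 + ‖l‖) ^ r : ℝ) •
        iteratedFDeriv ℝ N (fun z => H (z, p)) (k, (1 + ‖l‖)⁻¹ • l) :=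
    iteratedFDeriv_const_smul_apply (a := ((1 + ‖l‖) ^ r : ℝ)) hcd
  rw [symNorm, (hev'.iteratedFDeriv ℝ N).self_of_nhds, hsm, norm_smul,
    Real.norm_of_nonneg (by positivity), ← mul_assoc, ← Real.rpow_add hR, neg_add_cancel,
    Real.rpow_zero, one_mul]
  exact hC ((k, (1 + ‖l‖)⁻¹ • l), p) ⟨⟨hk, hl'⟩, hp⟩

theorem mul_mem_symSubmodule {r r' : ℝ}
    {a b : EuclideanSpace ℝ (Fin d) → EuclideanSpace ℝ (Fin t) → ℂ}
    (ha : a ∈ symSubmodule Ω t r) (hb : b ∈ symSubmodule Ω t r') :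
    a * b ∈ symSubmodule Ω t (r + r') := by
  refine mem_symSubmodule_of_symNorm (ContDiffOn.mul ha.1 hb.1) fun K N => ?_
  choose A hA0 hA using exists_symNorm_bound ha K
  choose B hB0 hB using exists_symNorm_bound hb K
  refine ⟨∑ i ∈ Finset.range (N + 1), (N.choose i : ℝ) * A i * B (N - i), fun k hk l => ?_⟩
  refine (symNorm_mul_le r r' N (ha.1.contDiffAt_prod (K.2.2 hk) l N)
    (hb.1.contDiffAt_prod (K.2.2 hk) l N)).trans (Finset.sum_le_sum fun i _ => ?_)
  exact mul_le_mul (mul_le_mul_of_nonneg_left (hA i k hk l) (by positivity)) (hB _ k hk l)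
    (symNorm_nonneg _ _ _ _ _) (mul_nonneg (by positivity) (hA0 i))

/-- The product of two symbols. -/
def SymbolSpace.mul {r r' : ℝ} (a : SymbolSpace Ω t r) (b : SymbolSpace Ω t r') :
    SymbolSpace Ω t (r + r') :=
  ⟨a.1 * b.1, mul_mem_symSubmodule a.2 b.2⟩

theorem tendsto_symbolSpace_iff {r : ℝ} {ι : Type*} {F : Filter ι} {u : ι → SymbolSpace Ω t r}
    {a : SymbolSpace Ω t r} :
    Tendsto u F (𝓝 a) ↔ ∀ p, Tendsto (fun n => symSeminorm Ω t r p (u n - a)) F (𝓝 0) := by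
  rw [(SymbolSpace.withSeminorms Ω t r).tendsto_nhds]
  refine forall_congr' fun p => ?_
  rw [Metric.tendsto_nhds]
  refine forall_congr' fun ε => ?_
  refine forall_congr' fun _ => ?_
  simp [abs_of_nonneg (apply_nonneg (symSeminorm Ω t r p) _)]

/-- By the Leibniz bound, a seminorm of `(u n - a) b` is at most a finite combination of seminorms
of `u n - a` with constants depending on `b`. -/
theorem SymbolSpace.tendsto_mul_right {r r' : ℝ} {ι : Type*} {F : Filter ι}
    {u : ι → SymbolSpace Ω t r} {a : SymbolSpace Ω t r} (h : Tendsto u F (𝓝 a))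
    (b : SymbolSpace Ω t r') : Tendsto (fun n => (u n).mul b) F (𝓝 (a.mul b)) := by
  rw [tendsto_symbolSpace_iff] at h ⊢
  rintro ⟨K, α, β⟩
  choose w hw using fun N => exists_symNorm_le_seminorm Ω t N
  choose B hB0 hB using exists_symNorm_bound b.2 K
  set N := α.length + β.length with hN
  have hlim : Tendsto (fun n => ∑ i ∈ Finset.range (N + 1), (N.choose i : ℝ) *
      (∑ v, symSeminorm Ω t r (K, w i v) (u n - a)) * B (N - i)) F (𝓝 0) := by
    have : (0 : ℝ) = ∑ i ∈ Finset.range (N + 1), (N.choose i : ℝ) *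
      (∑ _v : Fin i → Fin d ⊕ Fin t, (0 : ℝ)) * B (N - i) := by simp
    rw [this]
    exact tendsto_finsetSum _ fun i _ =>
      (tendsto_const_nhds.mul (tendsto_finsetSum _ fun v _ => h (K, w i v))).mul_const _
  refine squeeze_zero (fun n => apply_nonneg _ _) (fun n => ?_) hlim
  refine symSeminorm_le _ _ _ _ (Finset.sum_nonneg fun i _ => mul_nonneg (mul_nonneg (by positivity)
    (Finset.sum_nonneg fun v _ => apply_nonneg _ _)) (hB0 _)) fun k hk l => ?_
  have he : ((u n).mul b - a.mul b).1 = (u n - a).1 * b.1 :=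
    (sub_mul (u n).1 a.1 b.1).symm
  rw [he]
  refine (symWeight_le_symNorm _ _ _ _ _ _).trans ?_
  refine (symNorm_mul_le r r' N ((u n - a).2.1.contDiffAt_prod (K.2.2 hk) l N)
    (b.2.1.contDiffAt_prod (K.2.2 hk) l N)).trans (Finset.sum_le_sum fun i _ => ?_)
  exact mul_le_mul (mul_le_mul_of_nonneg_left (hw i r (u n - a) K k hk l) (by positivity))
    (hB _ k hk l) (symNorm_nonneg _ _ _ _ _)
    (mul_nonneg (by positivity) (Finset.sum_nonneg fun v _ => apply_nonneg _ _))

end SymbolSpace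

/-! ### Functions on a closed ball, extended by zero -/

section BallExtension

variable {t : ℕ}

/-- The closed ball of radius `ρ` in `ℝᵗ`. -/
abbrev ClosedBallType (t : ℕ) (ρ : ℝ) : Type :=
  Metric.closedBall (0 : EuclideanSpace ℝ (Fin t)) ρ

instance {ρ : ℝ} : CompactSpace (ClosedBallType t ρ) :=
  isCompact_iff_compactSpace.1 (isCompact_closedBall _ _)

/-- The extension by zero of a continuous function on a closed ball. -/
def ballExtend {ρ : ℝ} (g : C(ClosedBallType t ρ, ℂ)) (l : EuclideanSpace ℝ (Fin t)) : ℂ :=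
  Function.extend Subtype.val g 0 l

theorem ballExtend_of_mem {ρ : ℝ} (g : C(ClosedBallType t ρ, ℂ)) {l : EuclideanSpace ℝ (Fin t)}
    (hl : l ∈ Metric.closedBall 0 ρ) : ballExtend g l = g ⟨l, hl⟩ :=
  Subtype.val_injective.extend_apply g 0 (⟨l, hl⟩ : ClosedBallType t ρ)

theorem ballExtend_of_notMem {ρ : ℝ} (g : C(ClosedBallType t ρ, ℂ))
    {l : EuclideanSpace ℝ (Fin t)} (hl : l ∉ Metric.closedBall 0 ρ) : ballExtend g l = 0 :=
  Function.extend_apply' _ _ _ (by rintro ⟨x, rfl⟩; exact hl x.2)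

theorem ballExtend_add {ρ : ℝ} (g h : C(ClosedBallType t ρ, ℂ)) :
    ballExtend (g + h) = ballExtend g + ballExtend h := by
  ext l
  by_cases hl : l ∈ Metric.closedBall 0 ρ
  · simp only [Pi.add_apply, ballExtend_of_mem _ hl, ContinuousMap.add_apply]
  · simp only [Pi.add_apply, ballExtend_of_notMem _ hl, add_zero]

theorem ballExtend_smul {ρ : ℝ} (c : ℝ) (g : C(ClosedBallType t ρ, ℂ)) :
    ballExtend (c • g) = c • ballExtend g := by
  ext l
  by_cases hl : l ∈ Metric.closedBall 0 ρ
  · simp only [Pi.smul_apply, ballExtend_of_mem _ hl, ContinuousMap.smul_apply]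
  · simp only [Pi.smul_apply, ballExtend_of_notMem _ hl, smul_zero]

theorem measurable_ballExtend {ρ : ℝ} (g : C(ClosedBallType t ρ, ℂ)) :
    Measurable (ballExtend g) :=
  (MeasurableEmbedding.subtype_coe Metric.isClosed_closedBall.measurableSet).measurable_extend
    g.continuous.measurable measurable_const

theorem norm_ballExtend_le {ρ : ℝ} (g : C(ClosedBallType t ρ, ℂ))
    (l : EuclideanSpace ℝ (Fin t)) : ‖ballExtend g l‖ ≤ ‖g‖ := by
  by_cases hl : l ∈ Metric.closedBall 0 ρ
  · rw [ballExtend_of_mem _ hl]; exact g.norm_coe_le_norm _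
  · rw [ballExtend_of_notMem _ hl, norm_zero]; exact norm_nonneg g

theorem memLp_top_ballExtend {ρ : ℝ} (g : C(ClosedBallType t ρ, ℂ)) :
    MemLp (ballExtend g) ⊤ (volume : Measure (EuclideanSpace ℝ (Fin t))) :=
  memLp_top_of_bound (measurable_ballExtend g).aestronglyMeasurable ‖g‖
    (Eventually.of_forall (norm_ballExtend_le g))

/-- Extension by zero as a continuous linear map from the continuous functions on a ball to
`L^∞`. -/
def ballExtendLinfty (t : ℕ) (ρ : ℝ) :
    C(ClosedBallType t ρ, ℂ) →L[ℝ] Lp ℂ ⊤ (volume : Measure (EuclideanSpace ℝ (Fin t))) :=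
  LinearMap.mkContinuous
    { toFun := fun g => (memLp_top_ballExtend g).toLp _
      map_add' := fun g h => by
        rw [← MemLp.toLp_add]
        exact MemLp.toLp_congr _ _ (by rw [ballExtend_add])
      map_smul' := fun c g => by
        rw [RingHom.id_apply, ← MemLp.toLp_const_smul]
        exact MemLp.toLp_congr _ _ (by rw [ballExtend_smul]) } 1
    (fun g => by
      rw [one_mul]
      rw [LinearMap.coe_mk, AddHom.coe_mk, Lp.norm_toLp, eLpNorm_exponent_top]
      exact ENNReal.toReal_le_of_le_ofReal (norm_nonneg g)
        (eLpNormEssSup_le_of_ae_bound (Eventually.of_forall (norm_ballExtend_le g))))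

theorem ballExtendLinfty_coeFn {ρ : ℝ} (g : C(ClosedBallType t ρ, ℂ)) :
    ballExtendLinfty t ρ g =ᵐ[volume] ballExtend g :=
  (memLp_top_ballExtend g).coeFn_toLp

theorem ae_norm_le_Linfty (f : Lp ℂ ⊤ (volume : Measure (EuclideanSpace ℝ (Fin t)))) :
    ∀ᵐ l, ‖f l‖ ≤ ‖f‖ := by
  have h1 := ae_le_eLpNormEssSup (f := f) (μ := (volume : Measure (EuclideanSpace ℝ (Fin t))))
  filter_upwards [h1] with l hl
  rw [Lp.norm_def, eLpNorm_exponent_top]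
  have hfin : eLpNormEssSup f (volume : Measure (EuclideanSpace ℝ (Fin t))) ≠ ⊤ := by
    rw [← eLpNorm_exponent_top]; exact Lp.eLpNorm_ne_top f
  have := ENNReal.toReal_mono hfin hl
  simpa using this

theorem norm_mul_ballExtend_le {ρ : ℝ}
    (f : Lp ℂ ⊤ (volume : Measure (EuclideanSpace ℝ (Fin t)))) (g : C(ClosedBallType t ρ, ℂ)) :
    ∀ᵐ l, ‖f l * ballExtend g l‖ ≤
      (Metric.closedBall 0 ρ).indicator (fun _ => ‖f‖ * ‖g‖) l := by
  filter_upwards [ae_norm_le_Linfty f] with l hl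
  by_cases h : l ∈ Metric.closedBall 0 ρ
  · rw [indicator_of_mem h, norm_mul]
    exact mul_le_mul hl (norm_ballExtend_le g l) (norm_nonneg _) (norm_nonneg _)
  · rw [indicator_of_notMem h, ballExtend_of_notMem _ h, mul_zero, norm_zero]

theorem integrable_mul_ballExtend {ρ : ℝ}
    (f : Lp ℂ ⊤ (volume : Measure (EuclideanSpace ℝ (Fin t)))) (g : C(ClosedBallType t ρ, ℂ)) :
    Integrable (fun l => f l * ballExtend g l) := by
  refine Integrable.mono' (g := (Metric.closedBall 0 ρ).indicator (fun _ => ‖f‖ * ‖g‖)) ?_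
    ((Lp.aestronglyMeasurable f).mul (measurable_ballExtend g).aestronglyMeasurable)
    (norm_mul_ballExtend_le f g)
  rw [integrable_indicator_iff Metric.isClosed_closedBall.measurableSet]
  exact integrableOn_const measure_closedBall_lt_top.ne

/-- The pairing `(f, g) ↦ ∫ f g` of `L^∞` with the continuous functions on a ball. -/
def ballPairing (t : ℕ) (ρ : ℝ) :
    Lp ℂ ⊤ (volume : Measure (EuclideanSpace ℝ (Fin t))) →L[ℝ]
      C(ClosedBallType t ρ, ℂ) →L[ℝ] ℂ :=
  LinearMap.mkContinuous₂
    (LinearMap.mk₂ ℝ (fun f g => ∫ l, f l * ballExtend g l)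
      (fun f f' g => by
        rw [← integral_add (integrable_mul_ballExtend f g) (integrable_mul_ballExtend f' g)]
        refine integral_congr_ae ?_
        filter_upwards [Lp.coeFn_add f f'] with l hl
        rw [hl, Pi.add_apply, add_mul])
      (fun c f g => by
        rw [← integral_smul]
        refine integral_congr_ae ?_
        filter_upwards [Lp.coeFn_smul c f] with l hl
        rw [hl, Pi.smul_apply, smul_mul_assoc])
      (fun f g g' => by
        rw [← integral_add (integrable_mul_ballExtend f g) (integrable_mul_ballExtend f g')]
        simp only [ballExtend_add, Pi.add_apply, mul_add])
      (fun c f g => by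
        rw [← integral_smul]
        simp only [ballExtend_smul, Pi.smul_apply, mul_smul_comm]))
    (volume.real (Metric.closedBall (0 : EuclideanSpace ℝ (Fin t)) ρ))
    (fun f g => by
      refine (norm_integral_le_of_norm_le ?_ (norm_mul_ballExtend_le f g)).trans ?_
      · rw [integrable_indicator_iff Metric.isClosed_closedBall.measurableSet]
        exact integrableOn_const measure_closedBall_lt_top.ne
      · rw [integral_indicator Metric.isClosed_closedBall.measurableSet, setIntegral_const,
          smul_eq_mul, mul_assoc])

theorem ballPairing_apply {ρ : ℝ}
    (f : Lp ℂ ⊤ (volume : Measure (EuclideanSpace ℝ (Fin t)))) (g : C(ClosedBallType t ρ, ℂ)) :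
    ballPairing t ρ f g = ∫ l, f l * ballExtend g l := rfl

end BallExtension

/-! ### Oscillatory integrals for phases that are linear in `k` -/

section Truncated

variable {d t : ℕ} {Ω : Opens (EuclideanSpace ℝ (Fin d))}

/-- The phase `(k, l) ↦ k · w(l)`. -/
def linearPhase (w : EuclideanSpace ℝ (Fin t) → EuclideanSpace ℝ (Fin d))
    (k : EuclideanSpace ℝ (Fin d)) (l : EuclideanSpace ℝ (Fin t)) : ℝ := inner ℝ k (w l)

/-- `a (k, l) e^{i k·w(l)}`. -/
def phaseIntegrand (w : EuclideanSpace ℝ (Fin t) → EuclideanSpace ℝ (Fin d))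
    (a : EuclideanSpace ℝ (Fin d) → EuclideanSpace ℝ (Fin t) → ℂ)
    (k : EuclideanSpace ℝ (Fin d)) (l : EuclideanSpace ℝ (Fin t)) : ℂ :=
  a k l * Complex.exp (Complex.I * (linearPhase w k l : ℂ))

/-- The integral of `a e^{iφ}` over the ball of radius `ρ`. -/
def truncatedIntegral (w : EuclideanSpace ℝ (Fin t) → EuclideanSpace ℝ (Fin d))
    (a : EuclideanSpace ℝ (Fin d) → EuclideanSpace ℝ (Fin t) → ℂ) (ρ : ℝ)
    (k : EuclideanSpace ℝ (Fin d)) : ℂ :=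
  ∫ l in Metric.closedBall 0 ρ, phaseIntegrand w a k l

/-- On each ball, `a (k, ·)` depends smoothly on `k` as an element of `L^∞`. -/
def IsLocallySmoothLinfty (Ω : Opens (EuclideanSpace ℝ (Fin d)))
    (a : EuclideanSpace ℝ (Fin d) → EuclideanSpace ℝ (Fin t) → ℂ) : Prop :=
  ∀ ρ : ℝ, ∃ A : EuclideanSpace ℝ (Fin d) → Lp ℂ ⊤ (volume : Measure (EuclideanSpace ℝ (Fin t))),
    ContDiffOn ℝ ∞ A Ω ∧
      ∀ k ∈ Ω, A k =ᵐ[volume.restrict (Metric.closedBall 0 ρ)] a k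

theorem IsLocallySmoothLinfty.add
    {a b : EuclideanSpace ℝ (Fin d) → EuclideanSpace ℝ (Fin t) → ℂ}
    (ha : IsLocallySmoothLinfty Ω a) (hb : IsLocallySmoothLinfty Ω b) :
    IsLocallySmoothLinfty Ω (a + b) := by
  intro ρ
  obtain ⟨A, hA, hA'⟩ := ha ρ
  obtain ⟨B, hB, hB'⟩ := hb ρ
  refine ⟨A + B, hA.add hB, fun k hk => ?_⟩
  have h : ((A + B) k : EuclideanSpace ℝ (Fin t) → ℂ)
      =ᵐ[volume.restrict (Metric.closedBall 0 ρ)] A k + B k :=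
    ae_restrict_of_ae (Lp.coeFn_add (A k) (B k))
  exact h.trans ((hA' k hk).add (hB' k hk))

/-- If `a (k, l) = Φ (k, s l)` on a ball with `Φ` smooth and `s` continuous, then `a (k, ·)`
depends smoothly on `k` as an element of `L^∞`. -/
theorem exists_contDiffOn_Linfty {G : Type*} [NormedAddCommGroup G] [NormedSpace ℝ G]
    {Φ : EuclideanSpace ℝ (Fin d) × G → ℂ} {s : EuclideanSpace ℝ (Fin t) → G}
    (hs : Continuous s) (hΦ : ∀ k ∈ Ω, ∀ l, ContDiffAt ℝ ∞ Φ (k, s l)) (ρ : ℝ) :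
    ∃ A : EuclideanSpace ℝ (Fin d) → Lp ℂ ⊤ (volume : Measure (EuclideanSpace ℝ (Fin t))),
      ContDiffOn ℝ ∞ A Ω ∧ ∀ k ∈ Ω, A k =ᵐ[volume]
        (Metric.closedBall 0 ρ).indicator (fun l => Φ (k, s l)) := by
  let s' : C(ClosedBallType t ρ, G) := ⟨fun x => s x, by fun_prop⟩
  have h : ∀ k ∈ (Ω : Set (EuclideanSpace ℝ (Fin d))), ∀ x : ClosedBallType t ρ,
      ContDiffAt ℝ ∞ Φ (k, s' x) := fun k hk x => hΦ k hk x
  refine ⟨fun k => ballExtendLinfty t ρ (curryOn Φ s' k), ?_, fun k hk => ?_⟩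
  · have h1 : ContDiff ℝ ∞ (ballExtendLinfty t ρ) := ContinuousLinearMap.contDiff _
    exact h1.comp_contDiffOn (contDiffOn_curryOn Ω.isOpen h)
  · refine (ballExtendLinfty_coeFn _).trans (Eventually.of_forall fun l => ?_)
    by_cases hl : l ∈ Metric.closedBall 0 ρ
    · rw [ballExtend_of_mem _ hl, indicator_of_mem hl]
      exact curryOn_apply (h k hk) ⟨l, hl⟩
    · rw [ballExtend_of_notMem _ hl, indicator_of_notMem hl]

theorem SmoothOnProd.contDiffAt_top
    {a : EuclideanSpace ℝ (Fin d) → EuclideanSpace ℝ (Fin t) → ℂ} (ha : SmoothOnProd Ω a)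
    {k : EuclideanSpace ℝ (Fin d)} (hk : k ∈ Ω) (l : EuclideanSpace ℝ (Fin t)) :
    ContDiffAt ℝ ∞ (Function.uncurry a) (k, l) :=
  ContDiffOn.contDiffAt ha ((Ω.isOpen.prod isOpen_univ).mem_nhds ⟨hk, mem_univ _⟩)

theorem SmoothOnProd.isLocallySmoothLinfty
    {a : EuclideanSpace ℝ (Fin d) → EuclideanSpace ℝ (Fin t) → ℂ} (ha : SmoothOnProd Ω a) :
    IsLocallySmoothLinfty Ω a := by
  intro ρ
  obtain ⟨A, hA, hA'⟩ := exists_contDiffOn_Linfty (Ω := Ω) (s := id) continuous_id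
    (fun k hk l => ha.contDiffAt_top hk l) ρ
  refine ⟨A, hA, fun k hk => ?_⟩
  have h : A k =ᵐ[volume.restrict (Metric.closedBall 0 ρ)]
      (Metric.closedBall 0 ρ).indicator (fun l => Function.uncurry a (k, id l)) :=
    ae_restrict_of_ae (hA' k hk)
  exact h.trans (indicator_ae_eq_restrict Metric.isClosed_closedBall.measurableSet)

variable {w : EuclideanSpace ℝ (Fin t) → EuclideanSpace ℝ (Fin d)}

/-- On a ball the continuous map `w` takes values in a compact set, so `k ↦ e^{i k·w(·)}` is the
curried form of a smooth function of two vectors, with `w` only inserted as a parameter. No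
smoothness of `w` is needed. -/
theorem exists_smooth_exponential (hw : Continuous w) (ρ : ℝ) :
    ∃ e : EuclideanSpace ℝ (Fin d) → C(ClosedBallType t ρ, ℂ), ContDiff ℝ ∞ e ∧
      ∀ k x, e k x = Complex.exp (Complex.I * (linearPhase w k x : ℂ)) := by
  let s' : C(ClosedBallType t ρ, EuclideanSpace ℝ (Fin d)) := ⟨fun x => w x, by fun_prop⟩
  let Φ : EuclideanSpace ℝ (Fin d) × EuclideanSpace ℝ (Fin d) → ℂ :=
    fun z => Complex.exp (Complex.I * ((inner ℝ z.1 z.2 : ℝ) : ℂ))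
  have hΦ : ContDiff ℝ ∞ Φ := by
    have h1 : ContDiff ℝ ∞ fun z : EuclideanSpace ℝ (Fin d) × EuclideanSpace ℝ (Fin d) =>
        ((inner ℝ z.1 z.2 : ℝ) : ℂ) :=
      Complex.ofRealCLM.contDiff.comp (contDiff_fst.inner ℝ contDiff_snd)
    exact (contDiff_const.mul h1).cexp
  refine ⟨curryOn Φ s', ?_, fun k x => ?_⟩
  · rw [← contDiffOn_univ]
    exact contDiffOn_curryOn isOpen_univ fun k _ x => hΦ.contDiffAt
  · exact curryOn_apply (fun x => hΦ.contDiffAt) x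

theorem IsLocallySmoothLinfty.integrableOn (hw : Continuous w)
    {a : EuclideanSpace ℝ (Fin d) → EuclideanSpace ℝ (Fin t) → ℂ}
    (ha : IsLocallySmoothLinfty Ω a) (ρ : ℝ) {k : EuclideanSpace ℝ (Fin d)} (hk : k ∈ Ω) :
    IntegrableOn (phaseIntegrand w a k) (Metric.closedBall 0 ρ) := by
  obtain ⟨A, hA, hA'⟩ := ha ρ
  obtain ⟨e, he, he'⟩ := exists_smooth_exponential hw ρ
  refine (integrable_mul_ballExtend (A k) (e k)).integrableOn.congr ?_
  filter_upwards [hA' k hk, ae_restrict_mem Metric.isClosed_closedBall.measurableSet] with l hl hm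
  rw [hl, ballExtend_of_mem _ hm, he' k ⟨l, hm⟩, phaseIntegrand]

/-- The integral is the continuous bilinear pairing of two smooth maps of `k`: the amplitude in
`L^∞` and the exponential in the continuous functions on the ball. -/
theorem IsLocallySmoothLinfty.contDiffOn_truncatedIntegral (hw : Continuous w)
    {a : EuclideanSpace ℝ (Fin d) → EuclideanSpace ℝ (Fin t) → ℂ}
    (ha : IsLocallySmoothLinfty Ω a) (ρ : ℝ) : ContDiffOn ℝ ∞ (truncatedIntegral w a ρ) Ω := by
  obtain ⟨A, hA, hA'⟩ := ha ρ
  obtain ⟨e, he, he'⟩ := exists_smooth_exponential hw ρ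
  have h1 : ContDiffOn ℝ ∞ (fun k => ballPairing t ρ (A k) (e k)) Ω := by
    have h2 : ContDiff ℝ ∞ (ballPairing t ρ) := ContinuousLinearMap.contDiff _
    exact ContDiffOn.clm_apply (h2.comp_contDiffOn hA) he.contDiffOn
  refine h1.congr fun k hk => ?_
  rw [ballPairing_apply, truncatedIntegral,
    ← setIntegral_eq_integral_of_forall_compl_eq_zero (s := Metric.closedBall 0 ρ)
      (f := fun l => A k l * ballExtend (e k) l)]
  · refine integral_congr_ae ?_
    filter_upwards [hA' k hk, ae_restrict_mem Metric.isClosed_closedBall.measurableSet]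
      with l hl hm
    rw [hl, ballExtend_of_mem _ hm, he' k ⟨l, hm⟩, phaseIntegrand]
  · intro l hl
    rw [ballExtend_of_notMem _ hl, mul_zero]

theorem truncatedIntegral_add (hw : Continuous w)
    {a b : EuclideanSpace ℝ (Fin d) → EuclideanSpace ℝ (Fin t) → ℂ}
    (ha : IsLocallySmoothLinfty Ω a) (hb : IsLocallySmoothLinfty Ω b) (ρ : ℝ)
    {k : EuclideanSpace ℝ (Fin d)} (hk : k ∈ Ω) :
    truncatedIntegral w (a + b) ρ k = truncatedIntegral w a ρ k + truncatedIntegral w b ρ k := by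
  rw [truncatedIntegral, truncatedIntegral, truncatedIntegral,
    ← integral_add (ha.integrableOn hw ρ hk) (hb.integrableOn hw ρ hk)]
  simp only [phaseIntegrand, Pi.add_apply, add_mul]

theorem truncatedIntegral_smul (c : ℂ)
    (a : EuclideanSpace ℝ (Fin d) → EuclideanSpace ℝ (Fin t) → ℂ) (ρ : ℝ)
    (k : EuclideanSpace ℝ (Fin d)) :
    truncatedIntegral w (c • a) ρ k = c * truncatedIntegral w a ρ k := by
  rw [truncatedIntegral, truncatedIntegral, ← integral_const_mul]
  simp only [phaseIntegrand, Pi.smul_apply, smul_eq_mul, mul_assoc]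

end Truncated
-- Decay of the integral over `k`.
open FourierTransform in
-- Repeated integration by parts, in the form of a bound for the Fourier transform. The kernel there
-- is `e^{-2πi⟨k, ξ⟩}`, so it is evaluated at `ξ = -y/(2π)`, which accounts for the factor `(2π)^N`.
theorem norm_phase_integral_le {d : ℕ} (N : ℕ) {F : EuclideanSpace ℝ (Fin d) → ℂ}
    (hF : ContDiff ℝ ∞ F) (hc : HasCompactSupport F) (y : EuclideanSpace ℝ (Fin d)) :
    ‖y‖ ^ N * ‖∫ k, F k * Complex.exp (Complex.I * ((inner ℝ k y : ℝ) : ℂ))‖ ≤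
      (2 * Real.pi) ^ N * 2 ^ N * ∑ j ∈ Finset.range (N + 1), ∫ k, ‖iteratedFDeriv ℝ j F k‖ := by
  have hint : ∀ n : ℕ, Integrable (iteratedFDeriv ℝ n F) := fun n =>
    (hF.continuous_iteratedFDeriv (by exact_mod_cast le_top)).integrable_of_hasCompactSupport
      (hc.iteratedFDeriv n)
  have h := Real.pow_mul_norm_iteratedFDeriv_fourier_le (K := 0) (N := N) (k := 0) (n := N)
    (f := F) (hF.of_le (by exact_mod_cast le_top)) (fun k n hk hn => by
      obtain rfl : k = 0 := by simpa using hk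
      simpa using (hint n).norm) le_rfl le_rfl (-(2 * Real.pi)⁻¹ • y)
  have hpi : (0 : ℝ) < 2 * Real.pi := by positivity
  have he : 𝓕 F (-(2 * Real.pi)⁻¹ • y) =
      ∫ k, F k * Complex.exp (Complex.I * ((inner ℝ k y : ℝ) : ℂ)) := by
    rw [Real.fourier_eq']
    refine integral_congr_ae (Eventually.of_forall fun k => ?_)
    simp only [inner_smul_right, smul_eq_mul]
    rw [mul_comm]
    congr 2
    push_cast
    have : (Real.pi : ℂ) ≠ 0 := by exact_mod_cast Real.pi_ne_zero
    field_simp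
  rw [norm_iteratedFDeriv_zero, he, norm_smul, norm_neg, norm_inv, Real.norm_of_nonneg hpi.le,
    mul_pow, inv_pow] at h
  simp only [pow_zero, one_mul, Nat.cast_zero, mul_zero, zero_add, Finset.range_one,
    Finset.singleton_product, Finset.sum_map] at h
  have hp : (0 : ℝ) < (2 * Real.pi) ^ N := by positivity
  rw [mul_assoc, inv_mul_le_iff₀ hp] at h
  simpa [mul_assoc] using h

section Decay

variable {d t : ℕ} {Ω : Opens (EuclideanSpace ℝ (Fin d))}

/-- Off the support of `f` the product vanishes in a neighbourhood, so nothing need be known about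
`a` outside `Ω`. -/
theorem contDiff_test_mul (f : 𝓓(Ω, ℝ))
    {a : EuclideanSpace ℝ (Fin d) → EuclideanSpace ℝ (Fin t) → ℂ} (ha : SmoothOnProd Ω a) :
    ContDiff ℝ ∞ fun z : EuclideanSpace ℝ (Fin d) × EuclideanSpace ℝ (Fin t) =>
      (f z.1 : ℂ) * a z.1 z.2 := by
  rw [contDiff_iff_contDiffAt]
  rintro ⟨k, l⟩
  by_cases hk : k ∈ tsupport f
  · have h1 : ContDiff ℝ ∞ fun z : EuclideanSpace ℝ (Fin d) × EuclideanSpace ℝ (Fin t) =>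
        (f z.1 : ℂ) := Complex.ofRealCLM.contDiff.comp (f.contDiff.comp contDiff_fst)
    exact h1.contDiffAt.mul (ha.contDiffAt_top (f.tsupport_subset hk) l)
  · have h1 : ∀ᶠ z : EuclideanSpace ℝ (Fin d) × EuclideanSpace ℝ (Fin t) in 𝓝 (k, l),
        z.1 ∉ tsupport f := by
      have h2 : ∀ᶠ k' in 𝓝 k, k' ∉ tsupport f := (isClosed_tsupport f).isOpen_compl.mem_nhds hk
      exact (continuous_fst.tendsto (k, l)).eventually h2
    refine (contDiffAt_const (c := (0 : ℂ))).congr_of_eventuallyEq ?_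
    filter_upwards [h1] with z hz
    rw [image_eq_zero_of_notMem_tsupport hz, Complex.ofReal_zero, zero_mul]

theorem hasCompactSupport_test_mul (f : 𝓓(Ω, ℝ)) (g : EuclideanSpace ℝ (Fin d) → ℂ) :
    HasCompactSupport fun k => (f k : ℂ) * g k := by
  refine HasCompactSupport.mul_right (f := fun k => (f k : ℂ)) ?_
  exact f.hasCompactSupport.comp_left (g := fun x : ℝ => (x : ℂ)) Complex.ofReal_zero

theorem norm_iteratedFDeriv_ofReal (f : 𝓓(Ω, ℝ)) (i : ℕ) (k : EuclideanSpace ℝ (Fin d)) :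
    ‖iteratedFDeriv ℝ i (fun k => (f k : ℂ)) k‖ = ‖iteratedFDeriv ℝ i f k‖ :=
  Complex.ofRealLI.norm_iteratedFDeriv_comp_left
    (f.contDiff.contDiffAt (x := k)) (by exact_mod_cast le_top)

/-- Rescaling in `l` does not affect derivatives in `k`, so these are among the components that
`symNorm` measures. -/
theorem norm_iteratedFDeriv_left_le {a : EuclideanSpace ℝ (Fin d) → EuclideanSpace ℝ (Fin t) → ℂ}
    (r : ℝ) {i : ℕ} {k : EuclideanSpace ℝ (Fin d)} {l : EuclideanSpace ℝ (Fin t)}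
    (ha : ContDiffAt ℝ i (Function.uncurry a) (k, l)) :
    ‖iteratedFDeriv ℝ i (fun k => a k l) k‖ ≤ (1 + ‖l‖) ^ r * symNorm r i a k l := by
  have hR : (0 : ℝ) < 1 + ‖l‖ := by positivity
  have h1 : (fun k => a k l) = fun k => rescale (1 + ‖l‖) a (k, (1 + ‖l‖)⁻¹ • l) := by
    ext k
    simp [rescale, smul_smul, mul_inv_cancel₀ hR.ne']
  have h2 : ContDiffAt ℝ i (rescale (1 + ‖l‖) a) (k, (1 + ‖l‖)⁻¹ • l) := by
    refine ContDiffAt.comp (g := Function.uncurry a)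
      (f := fun z : EuclideanSpace ℝ (Fin d) × EuclideanSpace ℝ (Fin t) =>
        (z.1, (1 + ‖l‖) • z.2)) _ ?_ (by fun_prop)
    simpa [smul_smul, mul_inv_cancel₀ hR.ne'] using ha
  rw [h1, symNorm, ← mul_assoc, ← Real.rpow_add hR, add_neg_cancel, Real.rpow_zero, one_mul]
  exact norm_iteratedFDeriv_partial_le h2

/-- The sum of products of bounds that occurs in the Leibniz rule up to order `N`. -/
def leibnizSum (N : ℕ) (P S : ℕ → ℝ) : ℝ :=
  ∑ j ∈ Finset.range (N + 1), ∑ i ∈ Finset.range (j + 1), (j.choose i : ℝ) * P i * S (j - i)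

/-- Leibniz rule on the compact set carrying `f`. The bounds `P` for `f` and `S` for `a` stay
explicit because the same estimate later gives continuity in `f` with `a` fixed and continuity in
`a` with `f` fixed. -/
theorem integral_norm_iteratedFDeriv_test_mul_le {r : ℝ} {K : CompactsIn Ω} {f : 𝓓(Ω, ℝ)}
    (hf : tsupport f ⊆ K.1) {a : EuclideanSpace ℝ (Fin d) → EuclideanSpace ℝ (Fin t) → ℂ}
    (ha : SmoothOnProd Ω a) {P S : ℕ → ℝ} (hP : ∀ i k, ‖iteratedFDeriv ℝ i f k‖ ≤ P i)
    (hS : ∀ i, ∀ k ∈ K.1, ∀ l, symNorm r i a k l ≤ S i) (l : EuclideanSpace ℝ (Fin t)) (j : ℕ) :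
    ∫ k, ‖iteratedFDeriv ℝ j (fun k => (f k : ℂ) * a k l) k‖ ≤
      volume.real K.1 * ((1 + ‖l‖) ^ r *
        ∑ i ∈ Finset.range (j + 1), (j.choose i : ℝ) * P i * S (j - i)) := by
  set B := (1 + ‖l‖) ^ r * ∑ i ∈ Finset.range (j + 1), (j.choose i : ℝ) * P i * S (j - i) with hB
  have hsub : tsupport (fun k => (f k : ℂ) * a k l) ⊆ tsupport f := by
    refine closure_mono fun k hk => ?_
    rw [Function.mem_support] at hk ⊢
    intro h; simp [h] at hk
  have hz : ∀ k ∉ K.1, ‖iteratedFDeriv ℝ j (fun k => (f k : ℂ) * a k l) k‖ = 0 := by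
    intro k hk
    rw [norm_eq_zero]
    by_contra hne
    exact hk (hf (hsub (support_iteratedFDeriv_subset j hne)))
  rw [← setIntegral_eq_integral_of_forall_compl_eq_zero hz]
  have hb : ∀ k ∈ K.1, ‖iteratedFDeriv ℝ j (fun k => (f k : ℂ) * a k l) k‖ ≤ B := by
    intro k hk
    have hak := ha.contDiffAt_prod (K.2.2 hk) l
    have h1 : ContDiffAt ℝ j (fun k => (f k : ℂ)) k :=
      (Complex.ofRealCLM.contDiff.comp f.contDiff).contDiffAt.of_le (by exact_mod_cast le_top)
    have h2 : ContDiffAt ℝ j (fun k => a k l) k :=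
      (hak j).comp (f := fun k => (k, l)) k (by fun_prop)
    refine (norm_iteratedFDeriv_mul_le_of_contDiffAt h1 h2).trans ?_
    rw [hB, Finset.mul_sum]
    refine Finset.sum_le_sum fun i _ => ?_
    rw [norm_iteratedFDeriv_ofReal]
    have h3 := (norm_iteratedFDeriv_left_le r (hak (j - i))).trans
      (mul_le_mul_of_nonneg_left (hS (j - i) k hk l) (by positivity))
    have hP0 : 0 ≤ P i := (norm_nonneg _).trans (hP i k)
    calc _ ≤ (j.choose i : ℝ) * P i * ((1 + ‖l‖) ^ r * S (j - i)) := by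
          refine mul_le_mul (mul_le_mul_of_nonneg_left (hP i k) (by positivity)) h3
            (norm_nonneg _) (by positivity)
      _ = _ := by ring
  have h := norm_setIntegral_le_of_norm_le_const (μ := volume) (C := B)
    (f := fun k => ‖iteratedFDeriv ℝ j (fun k => (f k : ℂ) * a k l) k‖)
    K.2.1.measure_lt_top (fun k hk => by simpa using hb k hk)
  rw [mul_comm]
  exact (le_abs_self _).trans h

/-- `∫ dk f(k) a(k, l) e^{i k·w(l)}`. -/
def phaseTransform (w : EuclideanSpace ℝ (Fin t) → EuclideanSpace ℝ (Fin d)) (f : 𝓓(Ω, ℝ))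
    (a : EuclideanSpace ℝ (Fin d) → EuclideanSpace ℝ (Fin t) → ℂ)
    (l : EuclideanSpace ℝ (Fin t)) : ℂ :=
  ∫ k, (f k : ℂ) * phaseIntegrand w a k l

/-- The derivatives in `k` of `f a` grow at most like `(1 + |l|)^r`, while `N` integrations by parts
gain `|w(l)|^(-N)` and `|w(l)| ≥ c |l|`. The constants `N` and `M` are chosen before `f` and `a`. -/
theorem exists_norm_phaseTransform_le {w : EuclideanSpace ℝ (Fin t) → EuclideanSpace ℝ (Fin d)}
    {c : ℝ} (hc : 0 < c) (hw : ∀ l, c * ‖l‖ ≤ ‖w l‖) (K : CompactsIn Ω) (r : ℝ) :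
    ∃ (N : ℕ) (M : ℝ), 0 ≤ M ∧ ∀ (f : 𝓓(Ω, ℝ)), tsupport f ⊆ K.1 →
      ∀ a : EuclideanSpace ℝ (Fin d) → EuclideanSpace ℝ (Fin t) → ℂ, SmoothOnProd Ω a →
      ∀ P S : ℕ → ℝ, (∀ i k, ‖iteratedFDeriv ℝ i f k‖ ≤ P i) →
        (∀ i, ∀ k ∈ K.1, ∀ l, symNorm r i a k l ≤ S i) → (∀ i, 0 ≤ S i) → ∀ l,
        ‖phaseTransform w f a l‖ ≤ M * leibnizSum N P S * (1 + ‖l‖) ^ (-(t + 1 : ℝ)) := by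
  -- `N` beats the growth `r` and leaves the integrable power `-(t + 1)`.
  obtain ⟨N, hN⟩ := exists_nat_ge (r + (t + 1))
  -- With this choice `m (1 + |l|) ≤ 1 + |w(l)|`.
  set m := min 1 c with hm
  have hm0 : 0 < m := lt_min one_pos hc
  set V := volume.real K.1 with hV
  refine ⟨N, 2 ^ N * (m ^ N)⁻¹ * ((2 * Real.pi) ^ N * 2 ^ N + 1) * V, by positivity,
    fun f hf a ha P S hP hS hS0 l => ?_⟩
  have hP0 : ∀ i, 0 ≤ P i := fun i => (norm_nonneg _).trans (hP i 0)
  have hR : (0 : ℝ) < 1 + ‖l‖ := by positivity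
  set F : EuclideanSpace ℝ (Fin d) → ℂ := fun k => (f k : ℂ) * a k l with hFdef
  have hF : ContDiff ℝ ∞ F :=
    (contDiff_test_mul f ha).comp (contDiff_id.prodMk contDiff_const)
  have hFc : HasCompactSupport F := hasCompactSupport_test_mul f _
  have he : phaseTransform w f a l =
      ∫ k, F k * Complex.exp (Complex.I * ((inner ℝ k (w l) : ℝ) : ℂ)) := by
    simp only [phaseTransform, phaseIntegrand, linearPhase, hFdef, mul_assoc]
  set L := leibnizSum N P S with hL
  have hterm : ∀ j, 0 ≤ ∑ i ∈ Finset.range (j + 1), (j.choose i : ℝ) * P i * S (j - i) :=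
    fun j => Finset.sum_nonneg fun i _ => mul_nonneg (mul_nonneg (by positivity) (hP0 i)) (hS0 _)
  have hL0 : 0 ≤ L := Finset.sum_nonneg fun j _ => hterm j
  have hint := integral_norm_iteratedFDeriv_test_mul_le hf ha hP hS l
  have h1 := norm_phase_integral_le N hF hFc (w l)
  -- The trivial bound without integration by parts is added because `|w(l)|^N` gives nothing for
  -- small `l`.
  have h0 := norm_phase_integral_le 0 hF hFc (w l)
  rw [← he] at h0 h1
  have hs1 : ∑ j ∈ Finset.range (N + 1), ∫ k, ‖iteratedFDeriv ℝ j F k‖ ≤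
      V * ((1 + ‖l‖) ^ r * L) := by
    rw [hL, leibnizSum, Finset.mul_sum, Finset.mul_sum]
    exact Finset.sum_le_sum fun j _ => hint j
  have hs0 : ∑ j ∈ Finset.range (0 + 1), ∫ k, ‖iteratedFDeriv ℝ j F k‖ ≤
      V * ((1 + ‖l‖) ^ r * L) := by
    refine le_trans ?_ hs1
    refine Finset.sum_le_sum_of_subset_of_nonneg (by simp) fun j _ _ =>
      integral_nonneg fun k => norm_nonneg _
  have h2 : ‖w l‖ ^ N * ‖phaseTransform w f a l‖ ≤
      (2 * Real.pi) ^ N * 2 ^ N * (V * ((1 + ‖l‖) ^ r * L)) :=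
    h1.trans (mul_le_mul_of_nonneg_left hs1 (by positivity))
  have h3 : ‖phaseTransform w f a l‖ ≤ V * ((1 + ‖l‖) ^ r * L) := by
    simpa using h0.trans (mul_le_mul_of_nonneg_left hs0 (by positivity))
  -- Uses `(1 + x)^N ≤ 2^(N-1) (1 + x^N)` to combine the bounds with weights `1` and `|w(l)|^N`.
  have h4 : m ^ N * (1 + ‖l‖) ^ N ≤ 2 ^ N * (1 + ‖w l‖ ^ N) := by
    have h5 : m * (1 + ‖l‖) ≤ 1 + ‖w l‖ := by
      have h6 : m * ‖l‖ ≤ ‖w l‖ :=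
        (mul_le_mul_of_nonneg_right (min_le_right 1 c) (norm_nonneg l)).trans (hw l)
      have h7 : m ≤ 1 := min_le_left 1 c
      linarith
    rw [← mul_pow]
    refine (pow_le_pow_left₀ (by positivity) h5 N).trans ?_
    refine (add_pow_le (by norm_num) (norm_nonneg _) N).trans ?_
    rw [one_pow]
    refine mul_le_mul_of_nonneg_right (pow_le_pow_right₀ (by norm_num) (by omega)) (by positivity)
  have h5 : m ^ N * (1 + ‖l‖) ^ N * ‖phaseTransform w f a l‖ ≤
      2 ^ N * (((2 * Real.pi) ^ N * 2 ^ N + 1) * (V * ((1 + ‖l‖) ^ r * L))) := by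
    refine (mul_le_mul_of_nonneg_right h4 (norm_nonneg _)).trans ?_
    rw [mul_assoc]
    refine mul_le_mul_of_nonneg_left ?_ (by positivity)
    linarith
  have h6 : (1 + ‖l‖) ^ r ≤ (1 + ‖l‖) ^ N * (1 + ‖l‖) ^ (-(t + 1 : ℝ)) := by
    rw [← Real.rpow_natCast, ← Real.rpow_add hR]
    exact Real.rpow_le_rpow_of_exponent_le (by linarith [norm_nonneg l]) (by linarith)
  have h7 : (0 : ℝ) < (1 + ‖l‖) ^ N := by positivity
  have h8 : (0 : ℝ) < m ^ N := by positivity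
  rw [← mul_le_mul_iff_right₀ (mul_pos h8 h7)]
  refine h5.trans ?_
  calc _ ≤ 2 ^ N * (((2 * Real.pi) ^ N * 2 ^ N + 1) * (V *
        ((1 + ‖l‖) ^ N * (1 + ‖l‖) ^ (-(t + 1 : ℝ)) * L))) := by
        gcongr
    _ = _ := by
        field_simp

end Decay

/-! ### Distributional limits of truncated integrals. -/

section Osc

variable {d t : ℕ} {Ω : Opens (EuclideanSpace ℝ (Fin d))}
  {w : EuclideanSpace ℝ (Fin t) → EuclideanSpace ℝ (Fin d)}

theorem integrable_test_mul (f : 𝓓(Ω, ℝ)) {g : EuclideanSpace ℝ (Fin d) → ℂ}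
    (hg : ContinuousOn g Ω) : Integrable fun k => (f k : ℂ) * g k := by
  have h := f.integrable_bilin (𝕜 := ℝ) (μ := volume) (ContinuousLinearMap.lsmul ℝ ℝ)
    (hg.locallyIntegrableOn Ω.isOpen.measurableSet)
  simpa using h

theorem continuous_test_phaseIntegrand (hw : Continuous w) (f : 𝓓(Ω, ℝ))
    {a : EuclideanSpace ℝ (Fin d) → EuclideanSpace ℝ (Fin t) → ℂ} (ha : SmoothOnProd Ω a) :
    Continuous fun z : EuclideanSpace ℝ (Fin d) × EuclideanSpace ℝ (Fin t) =>
      (f z.1 : ℂ) * phaseIntegrand w a z.1 z.2 := by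
  have h1 := (contDiff_test_mul f ha).continuous
  have h2 : Continuous fun z : EuclideanSpace ℝ (Fin d) × EuclideanSpace ℝ (Fin t) =>
      Complex.exp (Complex.I * (linearPhase w z.1 z.2 : ℂ)) := by
    unfold linearPhase; fun_prop
  exact (h1.mul h2).congr fun z => mul_assoc _ _ _

theorem integrable_test_phaseIntegrand (hw : Continuous w) (f : 𝓓(Ω, ℝ))
    {a : EuclideanSpace ℝ (Fin d) → EuclideanSpace ℝ (Fin t) → ℂ} (ha : SmoothOnProd Ω a)
    (l : EuclideanSpace ℝ (Fin t)) : Integrable fun k => (f k : ℂ) * phaseIntegrand w a k l :=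
  ((continuous_test_phaseIntegrand hw f ha).comp (Continuous.prodMk_left l)).integrable_of_hasCompactSupport
    (hasCompactSupport_test_mul f fun k => phaseIntegrand w a k l)

/-- Fubini: the integrand is continuous and lives on the compact set `tsupport f × ball`. Performing
the `k`-integration first is what reveals the decay in `l`. -/
theorem integral_test_mul_truncatedIntegral (hw : Continuous w) (f : 𝓓(Ω, ℝ))
    {a : EuclideanSpace ℝ (Fin d) → EuclideanSpace ℝ (Fin t) → ℂ} (ha : SmoothOnProd Ω a)
    (ρ : ℝ) :
    ∫ k, (f k : ℂ) * truncatedIntegral w a ρ k =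
      ∫ l in Metric.closedBall 0 ρ, phaseTransform w f a l := by
  simp only [truncatedIntegral, phaseTransform, ← integral_const_mul]
  refine integral_integral_swap ?_
  have hc := continuous_test_phaseIntegrand hw f ha
  have h1 : IntegrableOn (fun z : EuclideanSpace ℝ (Fin d) × EuclideanSpace ℝ (Fin t) =>
      (f z.1 : ℂ) * phaseIntegrand w a z.1 z.2)
      (univ ×ˢ Metric.closedBall (0 : EuclideanSpace ℝ (Fin t)) ρ) (volume.prod volume) := by
    have h2 : IntegrableOn (fun z : EuclideanSpace ℝ (Fin d) × EuclideanSpace ℝ (Fin t) =>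
        (f z.1 : ℂ) * phaseIntegrand w a z.1 z.2)
        (tsupport f ×ˢ Metric.closedBall (0 : EuclideanSpace ℝ (Fin t)) ρ)
        (volume.prod volume) :=
      hc.continuousOn.integrableOn_compact
        (f.hasCompactSupport.isCompact.prod (isCompact_closedBall _ _))
    refine h2.of_forall_sdiff_eq_zero
      (MeasurableSet.univ.prod Metric.isClosed_closedBall.measurableSet) ?_
    rintro ⟨k, l⟩ ⟨⟨_, hl⟩, hkl⟩
    have hk : k ∉ tsupport f := fun hk => hkl ⟨hk, hl⟩
    simp [image_eq_zero_of_notMem_tsupport hk]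
  rwa [IntegrableOn, ← Measure.prod_restrict, Measure.restrict_univ] at h1

theorem aestronglyMeasurable_phaseTransform (hw : Continuous w) (f : 𝓓(Ω, ℝ))
    {a : EuclideanSpace ℝ (Fin d) → EuclideanSpace ℝ (Fin t) → ℂ} (ha : SmoothOnProd Ω a) :
    AEStronglyMeasurable (phaseTransform w f a) volume := by
  have h := (continuous_test_phaseIntegrand hw f ha).stronglyMeasurable
  exact (h.integral_prod_left' (μ := volume)).aestronglyMeasurable

theorem integrable_bracket (t : ℕ) :
    Integrable fun l : EuclideanSpace ℝ (Fin t) => (1 + ‖l‖) ^ (-(t + 1 : ℝ)) :=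
  integrable_one_add_norm (by simp)

theorem exists_integral_phaseTransform_le {c : ℝ} (hw : Continuous w) (hc : 0 < c)
    (hwc : ∀ l, c * ‖l‖ ≤ ‖w l‖) (K : CompactsIn Ω) (r : ℝ) :
    ∃ (N : ℕ) (M : ℝ), ∀ (f : 𝓓(Ω, ℝ)), tsupport f ⊆ K.1 →
      ∀ a : EuclideanSpace ℝ (Fin d) → EuclideanSpace ℝ (Fin t) → ℂ, SmoothOnProd Ω a →
      ∀ P S : ℕ → ℝ, (∀ i k, ‖iteratedFDeriv ℝ i f k‖ ≤ P i) →
        (∀ i, ∀ k ∈ K.1, ∀ l, symNorm r i a k l ≤ S i) → (∀ i, 0 ≤ S i) →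
        Integrable (phaseTransform w f a) ∧
        ‖∫ l, phaseTransform w f a l‖ ≤ M * leibnizSum N P S := by
  obtain ⟨N, M, hM0, hM⟩ := exists_norm_phaseTransform_le hc hwc K r
  refine ⟨N, M * ∫ l : EuclideanSpace ℝ (Fin t), (1 + ‖l‖) ^ (-(t + 1 : ℝ)),
    fun f hf a ha P S hP hS hS0 => ?_⟩
  have hb := hM f hf a ha P S hP hS hS0
  have hi := (integrable_bracket t).const_mul (M * leibnizSum N P S)
  refine ⟨hi.mono' (aestronglyMeasurable_phaseTransform hw f ha) (Eventually.of_forall hb), ?_⟩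
  refine (norm_integral_le_of_norm_le hi (Eventually.of_forall hb)).trans (le_of_eq ?_)
  rw [integral_const_mul]; ring

/-- The support of a test function. -/
def testSupport (f : 𝓓(Ω, ℝ)) : CompactsIn Ω := ⟨tsupport f, f.hasCompactSupport, f.tsupport_subset⟩

theorem exists_iteratedFDeriv_bound (f : 𝓓(Ω, ℝ)) :
    ∃ P : ℕ → ℝ, ∀ i k, ‖iteratedFDeriv ℝ i f k‖ ≤ P i := by
  have h : ∀ i : ℕ, ∃ C, ∀ k, ‖iteratedFDeriv ℝ i f k‖ ≤ C := fun i =>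
    (f.contDiff.continuous_iteratedFDeriv
      (by exact_mod_cast le_top)).bounded_above_of_compact_support (f.hasCompactSupport.iteratedFDeriv i)
  choose P hP using h
  exact ⟨P, hP⟩

theorem integrable_phaseTransform {c : ℝ} (hw : Continuous w) (hc : 0 < c)
    (hwc : ∀ l, c * ‖l‖ ≤ ‖w l‖) (f : 𝓓(Ω, ℝ)) {r : ℝ}
    {a : EuclideanSpace ℝ (Fin d) → EuclideanSpace ℝ (Fin t) → ℂ} (ha : a ∈ symSubmodule Ω t r) :
    Integrable (phaseTransform w f a) := by
  obtain ⟨N, M, h⟩ := exists_integral_phaseTransform_le hw hc hwc (testSupport f) r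
  obtain ⟨P, hP⟩ := exists_iteratedFDeriv_bound f
  choose S hS0 hS using exists_symNorm_bound ha (testSupport f)
  exact (h f subset_rfl a ha.1 P S hP hS hS0).1

theorem leibnizSum_zero_left (N : ℕ) (S : ℕ → ℝ) : leibnizSum N (fun _ => 0) S = 0 := by
  simp [leibnizSum]

theorem leibnizSum_zero_right (N : ℕ) (P : ℕ → ℝ) : leibnizSum N P (fun _ => 0) = 0 := by
  simp [leibnizSum]

theorem continuous_leibnizSum {X : Type*} [TopologicalSpace X] (N : ℕ) {P S : X → ℕ → ℝ}
    (hP : ∀ i, Continuous fun x => P x i) (hS : ∀ i, Continuous fun x => S x i) :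
    Continuous fun x => leibnizSum N (P x) (S x) := by
  unfold leibnizSum
  fun_prop

theorem phaseTransform_add (hw : Continuous w) (f g : 𝓓(Ω, ℝ))
    {a : EuclideanSpace ℝ (Fin d) → EuclideanSpace ℝ (Fin t) → ℂ} (ha : SmoothOnProd Ω a) :
    phaseTransform w (f + g) a = phaseTransform w f a + phaseTransform w g a := by
  ext l
  rw [Pi.add_apply, phaseTransform, phaseTransform, phaseTransform,
    ← integral_add (integrable_test_phaseIntegrand hw f ha l)
      (integrable_test_phaseIntegrand hw g ha l)]
  refine integral_congr_ae (Eventually.of_forall fun k => ?_)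
  have : (f + g) k = f k + g k := rfl
  simp only [this]
  push_cast
  ring

theorem phaseTransform_smul (x : ℝ) (f : 𝓓(Ω, ℝ))
    (a : EuclideanSpace ℝ (Fin d) → EuclideanSpace ℝ (Fin t) → ℂ) :
    phaseTransform w (x • f) a = x • phaseTransform w f a := by
  ext l
  rw [Pi.smul_apply, phaseTransform, phaseTransform, ← integral_smul]
  refine integral_congr_ae (Eventually.of_forall fun k => ?_)
  have : (x • f) k = x * f k := rfl
  simp only [this, Complex.real_smul]
  push_cast
  ring

/-- The distribution `f ↦ ∫ dl ∫ dk f(k) a(k, l) e^{i k·w(l)}` for a symbol `a`. -/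
def symbolDistribution {c : ℝ} (hw : Continuous w) (hc : 0 < c)
    (hwc : ∀ l, c * ‖l‖ ≤ ‖w l‖) {r : ℝ}
    {a : EuclideanSpace ℝ (Fin d) → EuclideanSpace ℝ (Fin t) → ℂ} (ha : a ∈ symSubmodule Ω t r) :
    𝓓(Ω, ℝ) →L[ℝ] ℂ :=
  TestFunction.mkCLM ℝ (fun f => ∫ l, phaseTransform w f a l)
    (fun f g => by
      rw [phaseTransform_add hw f g ha.1]
      exact integral_add (integrable_phaseTransform hw hc hwc f ha)
        (integrable_phaseTransform hw hc hwc g ha))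
    (fun x f => by
      rw [phaseTransform_smul, ← integral_smul]
      rfl)
    (fun K hK => by
      -- Continuity is tested on functions supported in a fixed compact `K`. There an additive map
      -- need only be continuous at `0`, and the bound is a finite combination of seminorms of `f`.
      let Λ : 𝓓_{K}(EuclideanSpace ℝ (Fin d), ℝ) →+ ℂ :=
        { toFun := fun f => ∫ l, phaseTransform w (TestFunction.ofSupportedIn hK f) a l
          map_zero' := by
            have h : phaseTransform w (TestFunction.ofSupportedIn hK
                (0 : 𝓓_{K}(EuclideanSpace ℝ (Fin d), ℝ))) a = 0 := by
              ext l; simp [phaseTransform]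
            rw [h]; simp
          map_add' := fun f g => by
            have h : TestFunction.ofSupportedIn hK (f + g) =
              TestFunction.ofSupportedIn hK f + TestFunction.ofSupportedIn hK g := rfl
            rw [h, phaseTransform_add hw _ _ ha.1]
            exact integral_add (integrable_phaseTransform hw hc hwc _ ha)
              (integrable_phaseTransform hw hc hwc _ ha) }
      let K' : CompactsIn Ω := ⟨K, K.isCompact, hK⟩
      obtain ⟨N, M, h⟩ := exists_integral_phaseTransform_le hw hc hwc K' r
      choose S hS0 hS using exists_symNorm_bound ha K'
      have hn : ∀ i : ℕ, Continuous fun f : 𝓓_{K}(EuclideanSpace ℝ (Fin d), ℝ) =>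
          N[ℝ]_{K, i} f := fun i =>
        (ContDiffMapSupportedIn.withSeminorms ℝ (EuclideanSpace ℝ (Fin d)) ℝ ⊤
          K).continuous_seminorm i
      have hcont : Continuous fun f : 𝓓_{K}(EuclideanSpace ℝ (Fin d), ℝ) => M * leibnizSum N
          (fun i => N[ℝ]_{K, i} f) S :=
        continuous_const.mul (continuous_leibnizSum N
          hn
          fun i => continuous_const)
      have hb : ∀ f, ‖Λ f‖ ≤ M * leibnizSum N
          (fun i => N[ℝ]_{K, i} f) S := fun f => by
        refine (h (TestFunction.ofSupportedIn hK f) f.tsupport_subset a ha.1 _ S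
          (fun i k => ?_) hS hS0).2
        exact ContDiffMapSupportedIn.norm_iteratedFDeriv_apply_le_seminorm_top ℝ
      refine continuous_of_continuousAt_zero Λ ?_
      rw [ContinuousAt, map_zero]
      refine squeeze_zero_norm hb ?_
      have := hcont.tendsto 0
      simpa [leibnizSum_zero_left] using this)

/-- `a` is an amplitude with a distributional limit of the truncated integrals. -/
def HasPhaseLimit (w : EuclideanSpace ℝ (Fin t) → EuclideanSpace ℝ (Fin d))
    (a : EuclideanSpace ℝ (Fin d) → EuclideanSpace ℝ (Fin t) → ℂ) (u : 𝓓'(Ω, ℂ)) : Prop :=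
  ∀ f : 𝓓(Ω, ℝ), Tendsto (fun n : ℕ => ∫ k, (f k : ℂ) * truncatedIntegral w a n k) atTop
    (𝓝 (u f))

/-- After integration over `k` the integral over `l` converges absolutely, so it is the limit of the
integrals over balls. -/
theorem hasPhaseLimit_symbol {c : ℝ} (hw : Continuous w) (hc : 0 < c)
    (hwc : ∀ l, c * ‖l‖ ≤ ‖w l‖) {r : ℝ}
    {a : EuclideanSpace ℝ (Fin d) → EuclideanSpace ℝ (Fin t) → ℂ} (ha : a ∈ symSubmodule Ω t r) :
    HasPhaseLimit (Ω := Ω) w a (symbolDistribution hw hc hwc ha) := by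
  intro f
  simp only [integral_test_mul_truncatedIntegral hw f ha.1]
  exact (aecover_closedBall tendsto_natCast_atTop_atTop).integral_tendsto_of_countably_generated
    (integrable_phaseTransform hw hc hwc f ha)

theorem truncatedIntegral_eq_phaseIntegral
    {a : EuclideanSpace ℝ (Fin d) → EuclideanSpace ℝ (Fin t) → ℂ} {ρ : ℝ}
    {k : EuclideanSpace ℝ (Fin d)} (h : ∀ l, ρ < ‖l‖ → a k l = 0) :
    truncatedIntegral w a ρ k = phaseIntegral (linearPhase w) a k := by
  refine setIntegral_eq_integral_of_forall_compl_eq_zero fun l hl => ?_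
  rw [phaseIntegrand, h l (by simpa using hl), zero_mul]

/-- Near any `k` the support in `l` stays in one ball, so the full integral is locally a truncated
one. -/
theorem contDiffOn_phaseIntegral (hw : Continuous w)
    {a : EuclideanSpace ℝ (Fin d) → EuclideanSpace ℝ (Fin t) → ℂ}
    (ha : IsLocallySmoothLinfty Ω a) (hs : HasCompactSupportInL Ω a) :
    ContDiffOn ℝ ∞ (phaseIntegral (linearPhase w) a) Ω := by
  intro k hk
  obtain ⟨K, hK, hkK, hKΩ⟩ := exists_compact_subset Ω.isOpen hk
  obtain ⟨R, hR⟩ := hs ⟨K, hK, hKΩ⟩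
  have h1 := (ha.contDiffOn_truncatedIntegral hw R).contDiffAt (Ω.isOpen.mem_nhds hk)
  refine (h1.congr_of_eventuallyEq ?_).contDiffWithinAt
  filter_upwards [isOpen_interior.mem_nhds hkK] with k' hk'
  exact (truncatedIntegral_eq_phaseIntegral (hR k' (interior_subset hk'))).symm

/-- Over the compact support of `f` the support of `a` in `l` is bounded, so the sequence of
truncations becomes constant. -/
theorem eventually_integral_eq
    {a : EuclideanSpace ℝ (Fin d) → EuclideanSpace ℝ (Fin t) → ℂ}
    (hs : HasCompactSupportInL Ω a) (f : 𝓓(Ω, ℝ)) :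
    ∀ᶠ n : ℕ in atTop, ∫ k, (f k : ℂ) * truncatedIntegral w a n k =
      ∫ k, (f k : ℂ) * phaseIntegral (linearPhase w) a k := by
  obtain ⟨R, hR⟩ := hs (testSupport f)
  filter_upwards [tendsto_natCast_atTop_atTop.eventually_ge_atTop R] with n hn
  refine integral_congr_ae (Eventually.of_forall fun k => ?_)
  by_cases hk : k ∈ tsupport f
  · simp only
    rw [truncatedIntegral_eq_phaseIntegral fun l hl => hR k hk l (hn.trans_lt hl)]
  · simp [image_eq_zero_of_notMem_tsupport hk]

theorem HasPhaseLimit.isGivenBy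
    {a : EuclideanSpace ℝ (Fin d) → EuclideanSpace ℝ (Fin t) → ℂ} {u : 𝓓'(Ω, ℂ)}
    (h : HasPhaseLimit w a u) (hs : HasCompactSupportInL Ω a) :
    IsGivenBy u (phaseIntegral (linearPhase w) a) := fun f =>
  tendsto_nhds_unique (h f) (tendsto_const_nhds.congr' (by
    filter_upwards [eventually_integral_eq hs f] with n hn using hn.symm))

theorem exists_hasPhaseLimit_of_compactSupport (hw : Continuous w)
    {a : EuclideanSpace ℝ (Fin d) → EuclideanSpace ℝ (Fin t) → ℂ}
    (ha : IsLocallySmoothLinfty Ω a) (hs : HasCompactSupportInL Ω a) :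
    ∃ u : 𝓓'(Ω, ℂ), HasPhaseLimit w a u := by
  have hloc : LocallyIntegrableOn (phaseIntegral (linearPhase w) a) Ω volume :=
    (contDiffOn_phaseIntegral hw ha hs).continuousOn.locallyIntegrableOn Ω.isOpen.measurableSet
  refine ⟨(TestFunction.integralAgainstBilinCLM (ContinuousLinearMap.lsmul ℝ ℝ) volume
    (phaseIntegral (linearPhase w) a) : 𝓓(Ω, ℝ) →L[ℝ] ℂ), fun f => ?_⟩
  refine tendsto_const_nhds.congr' ?_
  filter_upwards [eventually_integral_eq (w := w) hs f] with n hn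
  rw [hn]
  refine (TestFunction.integralAgainstBilinCLM_eq_integral hloc).trans ?_
  simp

theorem HasPhaseLimit.add (hw : Continuous w)
    {a b : EuclideanSpace ℝ (Fin d) → EuclideanSpace ℝ (Fin t) → ℂ} {u v : 𝓓'(Ω, ℂ)}
    (ha : IsLocallySmoothLinfty Ω a) (hb : IsLocallySmoothLinfty Ω b)
    (hu : HasPhaseLimit w a u) (hv : HasPhaseLimit w b v) : HasPhaseLimit w (a + b) (u + v) := by
  intro f
  refine ((hu f).add (hv f)).congr fun n => ?_
  rw [← integral_add (integrable_test_mul f (ha.contDiffOn_truncatedIntegral hw n).continuousOn)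
    (integrable_test_mul f (hb.contDiffOn_truncatedIntegral hw n).continuousOn)]
  refine integral_congr_ae (Eventually.of_forall fun k => ?_)
  by_cases hk : k ∈ tsupport f
  · simp only
    rw [truncatedIntegral_add hw ha hb n (f.tsupport_subset hk), mul_add]
  · simp [image_eq_zero_of_notMem_tsupport hk]

theorem HasPhaseLimit.smul
    {a : EuclideanSpace ℝ (Fin d) → EuclideanSpace ℝ (Fin t) → ℂ} {u : 𝓓'(Ω, ℂ)}
    (hu : HasPhaseLimit w a u) (c : ℂ) : HasPhaseLimit w (c • a) (c • u) := by
  intro f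
  refine ((hu f).const_mul c).congr fun n => ?_
  rw [← integral_const_mul]
  simp only [truncatedIntegral_smul, mul_left_comm]

end Osc

/-! ### Existence, uniqueness and evaluation of the oscillatory integral by cutoffs. -/

section OscExistence

variable {d t : ℕ} {Ω : Opens (EuclideanSpace ℝ (Fin d))}
  {w : EuclideanSpace ℝ (Fin t) → EuclideanSpace ℝ (Fin d)}

theorem isLocallySmoothLinfty_of_mem_smoothLinfty
    {a : EuclideanSpace ℝ (Fin d) → EuclideanSpace ℝ (Fin t) → ℂ}
    (ha : a ∈ smoothLinftySubmodule Ω t) : IsLocallySmoothLinfty Ω a := by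
  obtain ⟨_, A, hA, hA'⟩ := ha
  exact fun ρ => ⟨A, hA, fun k hk => ae_restrict_of_ae (hA' k hk)⟩

theorem asymptoticSymbols_induction
    {C : (EuclideanSpace ℝ (Fin d) → EuclideanSpace ℝ (Fin t) → ℂ) → Prop}
    (hsym : ∀ r, ∀ a ∈ symSubmodule Ω t r, C a) (hinf : ∀ a ∈ smoothLinftySubmodule Ω t, C a)
    (hadd : ∀ a b, C a → C b → C (a + b))
    {a : EuclideanSpace ℝ (Fin d) → EuclideanSpace ℝ (Fin t) → ℂ}
    (ha : a ∈ asymptoticSymbols Ω t) : C a := by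
  refine Submodule.iSup_induction _ (motive := C) ha (fun r x hx => ?_) (hsym 0 0 (Submodule.zero_mem _)) hadd
  obtain ⟨y, hy, z, hz, rfl⟩ := Submodule.mem_sup.1 hx
  exact hadd y z (hsym r y hy) (hinf z hz)

/-- The truncated integrals depend on `a` alone, not on its order or its decomposition, so their
limit is unambiguous. Local smoothness in `L^∞` is carried along because additivity of the truncated
integrals requires integrability. -/
theorem exists_phaseLimit_of_asymptotic {c : ℝ} (hw : Continuous w) (hc : 0 < c)
    (hwc : ∀ l, c * ‖l‖ ≤ ‖w l‖) {a : EuclideanSpace ℝ (Fin d) → EuclideanSpace ℝ (Fin t) → ℂ}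
    (ha : a ∈ asymptoticSymbols Ω t) :
    IsLocallySmoothLinfty Ω a ∧ ∃ u : 𝓓'(Ω, ℂ), HasPhaseLimit w a u := by
  refine asymptoticSymbols_induction
    (C := fun a => IsLocallySmoothLinfty Ω a ∧ ∃ u : 𝓓'(Ω, ℂ), HasPhaseLimit w a u)
    (fun r a ha => ?_) (fun a ha => ?_) (fun a b => ?_) ha
  · exact ⟨ha.1.isLocallySmoothLinfty, _, hasPhaseLimit_symbol hw hc hwc ha⟩
  · have h := isLocallySmoothLinfty_of_mem_smoothLinfty ha
    exact ⟨h, exists_hasPhaseLimit_of_compactSupport hw h ha.1⟩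
  · rintro ⟨ha, u, hu⟩ ⟨hb, v, hv⟩
    exact ⟨ha.add hb, u + v, hu.add hw ha hb hv⟩

theorem HasPhaseLimit.unique {a : EuclideanSpace ℝ (Fin d) → EuclideanSpace ℝ (Fin t) → ℂ}
    {u v : 𝓓'(Ω, ℂ)} (hu : HasPhaseLimit w a u) (hv : HasPhaseLimit w a v) : u = v :=
  DFunLike.ext _ _ fun f => tendsto_nhds_unique (hu f) (hv f)

/-- The oscillatory integral of a phase that is linear in `k`, as the limit of truncated
integrals. -/
def linearPhaseOscillatoryIntegral (Ω : Opens (EuclideanSpace ℝ (Fin d))) {c : ℝ}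
    (hw : Continuous w) (hc : 0 < c) (hwc : ∀ l, c * ‖l‖ ≤ ‖w l‖) :
    asymptoticSymbols Ω t →ₗ[ℂ] 𝓓'(Ω, ℂ) where
  toFun a := (exists_phaseLimit_of_asymptotic hw hc hwc a.2).2.choose
  map_add' a b := by
    have ha := exists_phaseLimit_of_asymptotic hw hc hwc a.2
    have hb := exists_phaseLimit_of_asymptotic hw hc hwc b.2
    exact (exists_phaseLimit_of_asymptotic hw hc hwc (a + b).2).2.choose_spec.unique
      (ha.2.choose_spec.add hw ha.1 hb.1 hb.2.choose_spec)
  map_smul' c a := by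
    have ha := exists_phaseLimit_of_asymptotic hw hc hwc a.2
    exact (exists_phaseLimit_of_asymptotic hw hc hwc (c • a).2).2.choose_spec.unique
      (ha.2.choose_spec.smul c)

theorem linearPhaseOscillatoryIntegral_spec {c : ℝ} (hw : Continuous w) (hc : 0 < c)
    (hwc : ∀ l, c * ‖l‖ ≤ ‖w l‖) (a : asymptoticSymbols Ω t) :
    HasPhaseLimit w a.1 (linearPhaseOscillatoryIntegral Ω hw hc hwc a) :=
  (exists_phaseLimit_of_asymptotic hw hc hwc a.2).2.choose_spec

/-- For continuity on symbols, the limit is the absolutely convergent integral of `phaseTransform`,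
and with `f` fixed the decay estimate bounds it by finitely many seminorms of `a`. -/
theorem isOscillatoryIntegral_linearPhase {c : ℝ} (hw : Continuous w) (hc : 0 < c)
    (hwc : ∀ l, c * ‖l‖ ≤ ‖w l‖) :
    IsOscillatoryIntegral Ω (linearPhase w) (linearPhaseOscillatoryIntegral (t := t) Ω hw hc hwc) where
  isGivenBy_of_compactSupport a hs :=
    ⟨contDiffOn_phaseIntegral hw (exists_phaseLimit_of_asymptotic hw hc hwc a.2).1 hs,
      (linearPhaseOscillatoryIntegral_spec hw hc hwc a).isGivenBy hs⟩
  continuous_on_sym r f := by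
    let Λ : SymbolSpace Ω t r →+ ℂ :=
      { toFun := fun a => linearPhaseOscillatoryIntegral Ω hw hc hwc a.toAsymptotic f
        map_zero' := by
          have h : (0 : SymbolSpace Ω t r).toAsymptotic = 0 := rfl
          rw [h, map_zero]; rfl
        map_add' := fun a b => by
          have h : (a + b).toAsymptotic = a.toAsymptotic + b.toAsymptotic := rfl
          rw [h, map_add]; rfl }
    obtain ⟨N, M, h⟩ := exists_integral_phaseTransform_le hw hc hwc (testSupport f) r
    obtain ⟨P, hP⟩ := exists_iteratedFDeriv_bound f
    choose v hv using fun N => exists_symNorm_le_seminorm Ω t N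
    have hws := SymbolSpace.withSeminorms Ω t r
    have hb : ∀ a, ‖Λ a‖ ≤ M * leibnizSum N P
        (fun i => ∑ x, symSeminorm Ω t r (testSupport f, v i x) a) := fun a => by
      have h1 := (h f subset_rfl a.1 a.2.1 P
        (fun i => ∑ x, symSeminorm Ω t r (testSupport f, v i x) a) hP
        (fun i k hk l => hv i r a (testSupport f) k hk l)
        fun i => Finset.sum_nonneg fun x _ => apply_nonneg _ _).2
      have h2 : linearPhaseOscillatoryIntegral Ω hw hc hwc a.toAsymptotic =
          symbolDistribution hw hc hwc a.2 :=
        (linearPhaseOscillatoryIntegral_spec hw hc hwc a.toAsymptotic).unique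
          (hasPhaseLimit_symbol hw hc hwc a.2)
      have h3 : Λ a = ∫ l, phaseTransform w f a.1 l := by
        change linearPhaseOscillatoryIntegral Ω hw hc hwc a.toAsymptotic f = _
        rw [h2]; rfl
      rw [h3]; exact h1
    have hcont : Continuous fun a : SymbolSpace Ω t r => M * leibnizSum N P
        (fun i => ∑ x, symSeminorm Ω t r (testSupport f, v i x) a) :=
      continuous_const.mul (continuous_leibnizSum N (fun i => continuous_const)
        fun i => continuous_finsetSum _ fun x _ => hws.continuous_seminorm _)
    have : IsTopologicalAddGroup (SymbolSpace Ω t r) := hws.topologicalAddGroup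
    refine continuous_of_continuousAt_zero Λ ?_
    rw [ContinuousAt, map_zero]
    refine squeeze_zero_norm hb ?_
    have := hcont.tendsto 0
    simpa [leibnizSum_zero_right] using this

/-- Cutoffs `G n` of compact support in `l` which converge to `1` as symbols of order `1` and are
`1` on each compact set eventually. -/
structure IsCutoffSequence (Ω : Opens (EuclideanSpace ℝ (Fin d))) (t : ℕ)
    (G : ℕ → SymbolSpace Ω t 1) (one : SymbolSpace Ω t 1) : Prop where
  one_eq : one.1 = fun _ _ => 1
  tendsto : Tendsto G atTop (𝓝 one)
  compactSupport : ∀ᶠ n in atTop, HasCompactSupportInL Ω (G n).1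
  eventually_eq_one : ∀ (K : CompactsIn Ω) (R : ℝ), ∀ᶠ n in atTop, ∀ k ∈ K.1, ∀ l, ‖l‖ ≤ R →
    (G n).1 k l = 1

variable {φ : EuclideanSpace ℝ (Fin d) → EuclideanSpace ℝ (Fin t) → ℝ}
  {T T' : asymptoticSymbols Ω t →ₗ[ℂ] 𝓓'(Ω, ℂ)}

theorem HasCompactSupportInL.mul_right
    {g : EuclideanSpace ℝ (Fin d) → EuclideanSpace ℝ (Fin t) → ℂ} (hg : HasCompactSupportInL Ω g)
    (a : EuclideanSpace ℝ (Fin d) → EuclideanSpace ℝ (Fin t) → ℂ) :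
    HasCompactSupportInL Ω (g * a) := fun K => by
  obtain ⟨R, hR⟩ := hg K
  exact ⟨R, fun k hk l hl => by simp [hR k hk l hl]⟩

/-- `G n · a` converges to `a` only in the symbols of order `1 + r`; continuity of `T` at that order
suffices because `T` is one map on the asymptotic symbols of all orders. -/
theorem IsOscillatoryIntegral.tendsto_of_symbol {G : ℕ → SymbolSpace Ω t 1}
    {one : SymbolSpace Ω t 1} (hG : IsCutoffSequence Ω t G one)
    (hT : IsOscillatoryIntegral Ω φ T) {r : ℝ} (a : SymbolSpace Ω t r) (f : 𝓓(Ω, ℝ)) :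
    Tendsto (fun n => ∫ k, (f k : ℂ) * phaseIntegral φ ((G n).1 * a.1) k) atTop
      (𝓝 (T a.toAsymptotic f)) := by
  have h1 : Tendsto (fun n => T ((G n).mul a).toAsymptotic f) atTop
      (𝓝 (T (one.mul a).toAsymptotic f)) :=
    ((hT.continuous_on_sym (1 + r) f).tendsto _).comp
      (SymbolSpace.tendsto_mul_right hG.tendsto a)
  have h2 : (one.mul a).toAsymptotic = a.toAsymptotic := by
    refine Subtype.ext ?_
    change one.1 * a.1 = a.1
    rw [hG.one_eq]
    exact one_mul _
  rw [h2] at h1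
  refine h1.congr' ?_
  filter_upwards [hG.compactSupport] with n hn
  exact (hT.isGivenBy_of_compactSupport ((G n).mul a).toAsymptotic (hn.mul_right a.1)).2 f

/-- On symbols both maps are limits of the same cut-off integrals; on the `L^∞` part both are given
by the ordinary integral. -/
theorem IsOscillatoryIntegral.unique {G : ℕ → SymbolSpace Ω t 1} {one : SymbolSpace Ω t 1}
    (hG : IsCutoffSequence Ω t G one) (hT : IsOscillatoryIntegral Ω φ T)
    (hT' : IsOscillatoryIntegral Ω φ T') : T = T' := by
  refine LinearMap.ext fun a => ?_
  have h : ∃ h : a.1 ∈ asymptoticSymbols Ω t, T ⟨a.1, h⟩ = T' ⟨a.1, h⟩ := by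
    refine asymptoticSymbols_induction
      (C := fun a => ∃ h : a ∈ asymptoticSymbols Ω t, T ⟨a, h⟩ = T' ⟨a, h⟩)
      (fun r a ha => ?_) (fun a ha => ?_) (fun a b => ?_) a.2
    · refine ⟨SymbolSpace.toAsymptotic ⟨a, ha⟩ |>.2, DFunLike.ext _ _ fun f => ?_⟩
      exact tendsto_nhds_unique (hT.tendsto_of_symbol hG ⟨a, ha⟩ f)
        (hT'.tendsto_of_symbol hG ⟨a, ha⟩ f)
    · have hm : a ∈ asymptoticSymbols Ω t :=
        asymptoticSymbolsOfOrder_le Ω t 0 (Submodule.mem_sup_right ha)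
      refine ⟨hm, DFunLike.ext _ _ fun f => ?_⟩
      rw [(hT.isGivenBy_of_compactSupport ⟨a, hm⟩ ha.1).2 f,
        (hT'.isGivenBy_of_compactSupport ⟨a, hm⟩ ha.1).2 f]
    · rintro ⟨ha, ha'⟩ ⟨hb, hb'⟩
      refine ⟨Submodule.add_mem _ ha hb, ?_⟩
      have h := congrArg₂ (· + ·) ha' hb'
      simp only [← map_add] at h
      exact h
  exact h.2

/-- For large `n` the cutoff equals `1` on the bounded `l`-support of the `L^∞` part over the
support of `f`, so only the symbol part of `a` is affected by it. -/
theorem IsOscillatoryIntegral.tendsto_of_mem_order {G : ℕ → SymbolSpace Ω t 1}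
    {one : SymbolSpace Ω t 1} (hG : IsCutoffSequence Ω t G one) (hw : Continuous w)
    {T : asymptoticSymbols Ω t →ₗ[ℂ] 𝓓'(Ω, ℂ)}
    (hT : IsOscillatoryIntegral Ω (linearPhase w) T) {r : ℝ} (a : asymptoticSymbols Ω t)
    (ha : a.1 ∈ asymptoticSymbolsOfOrder Ω t r) (f : 𝓓(Ω, ℝ)) :
    Tendsto (fun n => ∫ k, (f k : ℂ) * phaseIntegral (linearPhase w) ((G n).1 * a.1) k) atTop
      (𝓝 (T a f)) := by
  obtain ⟨a₁, ha₁, a₂, ha₂, hsum⟩ := Submodule.mem_sup.1 ha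
  let b : SymbolSpace Ω t r := ⟨a₁, ha₁⟩
  have hm : a₂ ∈ asymptoticSymbols Ω t :=
    asymptoticSymbolsOfOrder_le Ω t r (Submodule.mem_sup_right ha₂)
  have h1 := hT.tendsto_of_symbol hG b f
  have h2 := (hT.isGivenBy_of_compactSupport ⟨a₂, hm⟩ ha₂.1).2 f
  have h3 : T a f = T b.toAsymptotic f + T ⟨a₂, hm⟩ f := by
    have : a = b.toAsymptotic + ⟨a₂, hm⟩ := Subtype.ext hsum.symm
    rw [this, map_add]; rfl
  rw [h3, h2]
  refine (h1.add_const _).congr' ?_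
  obtain ⟨R, hR⟩ := ha₂.1 (testSupport f)
  have hl₂ := isLocallySmoothLinfty_of_mem_smoothLinfty ha₂
  filter_upwards [hG.eventually_eq_one (testSupport f) R, hG.compactSupport] with n hn hcs
  have hl₁ : IsLocallySmoothLinfty Ω ((G n).1 * a₁) :=
    (mul_mem_symSubmodule (G n).2 ha₁).1.isLocallySmoothLinfty
  have hcs₁ := hcs.mul_right a₁
  have hsm₁ := contDiffOn_phaseIntegral hw hl₁ hcs₁
  have hsm₂ := contDiffOn_phaseIntegral hw hl₂ ha₂.1
  rw [← integral_add (integrable_test_mul f hsm₁.continuousOn)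
    (integrable_test_mul f hsm₂.continuousOn)]
  refine integral_congr_ae (Eventually.of_forall fun k => ?_)
  by_cases hk : k ∈ tsupport f
  · simp only
    rw [← mul_add]
    congr 1
    -- Both pieces vanish beyond `max R R₁`, so both integrals may be taken over that ball, where
    -- truncated integrals are additive.
    obtain ⟨R₁, hR₁⟩ := hcs₁ (testSupport f)
    have hkΩ : k ∈ Ω := f.tsupport_subset hk
    have e1 : ∀ l, max R R₁ < ‖l‖ → ((G n).1 * a₁) k l = 0 := fun l hl =>
      hR₁ k hk l ((le_max_right _ _).trans_lt hl)
    have e2 : ∀ l, max R R₁ < ‖l‖ → a₂ k l = 0 := fun l hl =>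
      hR k hk l ((le_max_left _ _).trans_lt hl)
    rw [← truncatedIntegral_eq_phaseIntegral e1, ← truncatedIntegral_eq_phaseIntegral e2,
      ← truncatedIntegral_add hw hl₁ hl₂ _ hkΩ, truncatedIntegral_eq_phaseIntegral]
    · refine integral_congr_ae (Eventually.of_forall fun l => ?_)
      simp only
      congr 1
      rw [← hsum]
      simp only [Pi.add_apply, Pi.mul_apply, mul_add]
      rcases le_or_gt ‖l‖ R with hlR | hlR
      · rw [hn k hk l hlR, one_mul, one_mul]
      · rw [hR k hk l hlR, mul_zero]
    · intro l hl
      rw [Pi.add_apply, Pi.add_apply, e1 l hl, e2 l hl, add_zero]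
  · simp [image_eq_zero_of_notMem_tsupport hk]

end OscExistence

/-! ### Kinematics -/

section Kinematics

@[simp] theorem fourVector_zero (x : ℝ) (l : EuclideanSpace ℝ (Fin 3)) : fourVector x l 0 = x := rfl

@[simp] theorem fourVector_succ (x : ℝ) (l : EuclideanSpace ℝ (Fin 3)) (i : Fin 3) :
    fourVector x l i.succ = l i := rfl

@[simp] theorem spatialPart_fourVector (x : ℝ) (l : EuclideanSpace ℝ (Fin 3)) :
    spatialPart (fourVector x l) = l := rfl

@[simp] theorem spatialPart_apply (p : EuclideanSpace ℝ (Fin 4)) (i : Fin 3) :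
    spatialPart p i = p i.succ := rfl

theorem fourVector_ext {p q : EuclideanSpace ℝ (Fin 4)} (h0 : p 0 = q 0)
    (h : spatialPart p = spatialPart q) : p = q := by
  ext i
  refine Fin.cases h0 (fun j => ?_) i
  exact congrArg (fun l : EuclideanSpace ℝ (Fin 3) => l j) h

/-- The Minkowski product. -/
def minkowski (k p : EuclideanSpace ℝ (Fin 4)) : ℝ :=
  k 0 * p 0 - inner ℝ (spatialPart k) (spatialPart p)

theorem inner_three (a b : EuclideanSpace ℝ (Fin 3)) : inner ℝ a b = ∑ i, a i * b i := by
  simp [PiLp.inner_apply, mul_comm]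

theorem minkowskiSq_eq (k : EuclideanSpace ℝ (Fin 4)) :
    minkowskiSq k = k 0 ^ 2 - ‖spatialPart k‖ ^ 2 := by
  rw [minkowskiSq, EuclideanSpace.real_norm_sq_eq]; rfl

theorem minkowskiSq_sub (k p : EuclideanSpace ℝ (Fin 4)) :
    minkowskiSq (k - p) = minkowskiSq k - 2 * minkowski k p + minkowskiSq p := by
  simp only [minkowskiSq, minkowski, inner_three, Fin.sum_univ_three, spatialPart_apply,
    PiLp.sub_apply]
  ring

theorem minkowskiSq_add (k p : EuclideanSpace ℝ (Fin 4)) :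
    minkowskiSq (k + p) = minkowskiSq k + 2 * minkowski k p + minkowskiSq p := by
  simp only [minkowskiSq, minkowski, inner_three, Fin.sum_univ_three, spatialPart_apply,
    PiLp.add_apply]
  ring

theorem energy_sq (m x : ℝ) : energy m x ^ 2 = x ^ 2 + m ^ 2 := Real.sq_sqrt (by positivity)

theorem energy_nonneg (m x : ℝ) : 0 ≤ energy m x := Real.sqrt_nonneg _

theorem energy_pos {m : ℝ} (hm : 0 < m) (x : ℝ) : 0 < energy m x :=
  Real.sqrt_pos.2 (by positivity)

theorem lt_energy {m : ℝ} (hm : 0 < m) (x : ℝ) : x < energy m x :=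
  Real.lt_sqrt_of_sq_lt (by nlinarith [sq_pos_of_pos hm])

theorem eq_energy {m x e : ℝ} (he : 0 ≤ e) (h : e ^ 2 = x ^ 2 + m ^ 2) : e = energy m x := by
  rw [energy, ← h, Real.sqrt_sq he]

@[simp] theorem onShell_zero (m : ℝ) (l : EuclideanSpace ℝ (Fin 3)) :
    onShell m l 0 = energy m ‖l‖ := rfl

@[simp] theorem spatialPart_onShell (m : ℝ) (l : EuclideanSpace ℝ (Fin 3)) :
    spatialPart (onShell m l) = l := rfl

theorem minkowskiSq_onShell (m : ℝ) (l : EuclideanSpace ℝ (Fin 3)) :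
    minkowskiSq (onShell m l) = m ^ 2 := by
  rw [minkowskiSq_eq, onShell_zero, spatialPart_onShell, energy_sq]; ring

theorem onShell_of_pos {m : ℝ} {p : EuclideanSpace ℝ (Fin 4)} (h0 : 0 ≤ p 0)
    (h : minkowskiSq p = m ^ 2) : onShell m (spatialPart p) = p := by
  refine fourVector_ext ?_ rfl
  rw [onShell_zero]
  refine (eq_energy h0 ?_).symm
  rw [minkowskiSq_eq] at h
  linarith

theorem continuous_onShell (m : ℝ) : Continuous (onShell m) := by
  have h : Continuous fun l : EuclideanSpace ℝ (Fin 3) => energy m ‖l‖ := by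
    unfold energy; fun_prop
  unfold onShell fourVector
  refine (PiLp.continuous_toLp 2 _).comp (continuous_pi fun i => ?_)
  refine Fin.cases ?_ (fun j => ?_) i
  · simpa using h
  · simp only [Fin.cons_succ]; fun_prop

/-! #### Pure boosts -/

variable {v : EuclideanSpace ℝ (Fin 3)}

theorem one_sub_norm_sq_pos (hv : ‖v‖ < 1) : 0 < 1 - ‖v‖ ^ 2 := by
  nlinarith [norm_nonneg v]

theorem lorentzFactor_pos (hv : ‖v‖ < 1) : 0 < lorentzFactor v :=
  one_div_pos.2 (Real.sqrt_pos.2 (one_sub_norm_sq_pos hv))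

theorem lorentzFactor_sq_mul (hv : ‖v‖ < 1) :
    lorentzFactor v ^ 2 * ‖v‖ ^ 2 = lorentzFactor v ^ 2 - 1 := by
  have h := one_sub_norm_sq_pos hv
  have h1 : lorentzFactor v ^ 2 * (1 - ‖v‖ ^ 2) = 1 := by
    rw [lorentzFactor, div_pow, one_pow, Real.sq_sqrt h.le, one_div_mul_cancel h.ne']
  linarith

/-- The coefficient `γ²/(1 + γ)` is `(γ - 1)/|v|²` written without a singularity at `v = 0`; this
identity and `γ²|v|² = γ² - 1` are all the algebra of boosts that is needed. -/
theorem lorentzFactor_coeff (hv : ‖v‖ < 1) :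
    lorentzFactor v ^ 2 / (1 + lorentzFactor v) * ‖v‖ ^ 2 = lorentzFactor v - 1 := by
  have h := lorentzFactor_pos hv
  rw [div_mul_eq_mul_div, lorentzFactor_sq_mul hv, div_eq_iff (by positivity)]
  ring

@[simp] theorem lorentzFactor_neg (v : EuclideanSpace ℝ (Fin 3)) :
    lorentzFactor (-v) = lorentzFactor v := by
  simp [lorentzFactor]

theorem pureBoost_zero (v : EuclideanSpace ℝ (Fin 3)) (p : EuclideanSpace ℝ (Fin 4)) :
    pureBoost v p 0 = lorentzFactor v * (p 0 - inner ℝ v (spatialPart p)) := rfl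

theorem spatialPart_pureBoost (v : EuclideanSpace ℝ (Fin 3)) (p : EuclideanSpace ℝ (Fin 4)) :
    spatialPart (pureBoost v p) = spatialPart p +
      (lorentzFactor v ^ 2 / (1 + lorentzFactor v) * inner ℝ v (spatialPart p)
        - lorentzFactor v * p 0) • v := rfl

theorem minkowskiSq_pureBoost (hv : ‖v‖ < 1) (p : EuclideanSpace ℝ (Fin 4)) :
    minkowskiSq (pureBoost v p) = minkowskiSq p := by
  have h1 := lorentzFactor_sq_mul hv
  have h2 := lorentzFactor_coeff hv
  have h0 := lorentzFactor_pos hv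
  have h3 : lorentzFactor v ^ 2 / (1 + lorentzFactor v) * (1 + lorentzFactor v) =
      lorentzFactor v ^ 2 := div_mul_cancel₀ _ (by positivity)
  have h4 (x : ℝ) : ‖x • v‖ ^ 2 = x ^ 2 * ‖v‖ ^ 2 := by
    rw [norm_smul, mul_pow, Real.norm_eq_abs, sq_abs]
  rw [minkowskiSq_eq, minkowskiSq_eq, pureBoost_zero, spatialPart_pureBoost, norm_add_sq_real,
    inner_smul_right, h4, real_inner_comm v (spatialPart p)]
  set s := inner ℝ v (spatialPart p)
  set γ := lorentzFactor v
  set c := γ ^ 2 / (1 + γ)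
  set u := ‖v‖ ^ 2
  linear_combination (p 0 ^ 2) * (-h1) + (-c * s ^ 2 + 2 * γ * s * p 0) * h2 - s ^ 2 * h3

theorem pureBoost_neg_pureBoost (hv : ‖v‖ < 1) (p : EuclideanSpace ℝ (Fin 4)) :
    pureBoost (-v) (pureBoost v p) = p := by
  have h1 := lorentzFactor_sq_mul hv
  have h2 := lorentzFactor_coeff hv
  have h0 := lorentzFactor_pos hv
  have h3 : lorentzFactor v ^ 2 / (1 + lorentzFactor v) * (1 + lorentzFactor v) =
      lorentzFactor v ^ 2 := div_mul_cancel₀ _ (by positivity)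
  have hin : inner ℝ v (spatialPart (pureBoost v p)) =
      lorentzFactor v * inner ℝ v (spatialPart p) - lorentzFactor v * ‖v‖ ^ 2 * p 0 := by
    rw [spatialPart_pureBoost, inner_add_right, inner_smul_right, real_inner_self_eq_norm_sq]
    linear_combination inner ℝ v (spatialPart p) * h2
  refine fourVector_ext ?_ ?_
  · rw [pureBoost_zero, lorentzFactor_neg, inner_neg_left, hin, pureBoost_zero]
    linear_combination (-p 0) * h1
  · rw [spatialPart_pureBoost, lorentzFactor_neg, inner_neg_left, hin, pureBoost_zero,
      spatialPart_pureBoost, smul_neg, add_assoc, ← sub_eq_add_neg, ← sub_smul]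
    set s := inner ℝ v (spatialPart p)
    set γ := lorentzFactor v
    set c := γ ^ 2 / (1 + γ)
    set u := ‖v‖ ^ 2
    have : c * s - γ * p 0 - (c * -(γ * s - γ * u * p 0) - γ * (γ * (p 0 - s))) = 0 := by
      linear_combination s * h3 - γ * p 0 * h2
    rw [this, zero_smul, add_zero]

/-- The action of a pure boost on the spatial momenta of on-shell vectors. -/
def boostMomentum (m : ℝ) (v l : EuclideanSpace ℝ (Fin 3)) : EuclideanSpace ℝ (Fin 3) :=
  spatialPart (pureBoost v (onShell m l))

theorem inner_lt_energy {m : ℝ} (hm : 0 < m) (hv : ‖v‖ < 1) (l : EuclideanSpace ℝ (Fin 3)) :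
    inner ℝ v l < energy m ‖l‖ := by
  refine lt_of_le_of_lt ((real_inner_le_norm v l).trans ?_) (lt_energy hm ‖l‖)
  nlinarith [norm_nonneg l]

/-- The boost preserves the Minkowski square, and it preserves positivity of the energy since `v · l
< ω_l`; these two properties characterize on-shell vectors. -/
theorem onShell_boostMomentum {m : ℝ} (hm : 0 < m) (hv : ‖v‖ < 1)
    (l : EuclideanSpace ℝ (Fin 3)) :
    onShell m (boostMomentum m v l) = pureBoost v (onShell m l) := by
  refine onShell_of_pos ?_ ?_
  · rw [pureBoost_zero, onShell_zero, spatialPart_onShell]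
    exact mul_nonneg (lorentzFactor_pos hv).le (sub_nonneg.2 (inner_lt_energy hm hv l).le)
  · rw [minkowskiSq_pureBoost hv, minkowskiSq_onShell]

theorem energy_boostMomentum {m : ℝ} (hm : 0 < m) (hv : ‖v‖ < 1) (l : EuclideanSpace ℝ (Fin 3)) :
    energy m ‖boostMomentum m v l‖ = lorentzFactor v * (energy m ‖l‖ - inner ℝ v l) := by
  rw [← onShell_zero, onShell_boostMomentum hm hv]; rfl

theorem boostMomentum_neg {m : ℝ} (hm : 0 < m) (hv : ‖v‖ < 1) (l : EuclideanSpace ℝ (Fin 3)) :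
    boostMomentum m (-v) (boostMomentum m v l) = l := by
  rw [boostMomentum, onShell_boostMomentum hm hv, pureBoost_neg_pureBoost hv, spatialPart_onShell]

theorem hasFDerivAt_energy {m : ℝ} (hm : 0 < m) (l : EuclideanSpace ℝ (Fin 3)) :
    HasFDerivAt (fun l : EuclideanSpace ℝ (Fin 3) => energy m ‖l‖)
      ((energy m ‖l‖)⁻¹ • innerSL ℝ l) l := by
  have h1 : HasFDerivAt (fun l : EuclideanSpace ℝ (Fin 3) => ‖l‖ ^ 2 + m ^ 2)
      (2 • innerSL ℝ l) l := (hasStrictFDerivAt_norm_sq l).hasFDerivAt.add_const _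
  have h2 := h1.sqrt (by positivity)
  refine h2.congr_fderiv ?_
  ext x
  simp only [smul_apply, smul_eq_mul, energy, nsmul_eq_mul]
  field_simp
  simp

/-- The boost changes `l` only along `v`, so its derivative is the identity plus a rank-one map,
whose determinant is a single inner product. -/
theorem hasFDerivAt_boostMomentum {m : ℝ} (hm : 0 < m) (l : EuclideanSpace ℝ (Fin 3)) :
    HasFDerivAt (boostMomentum m v) (ContinuousLinearMap.id ℝ _ +
      (innerSL ℝ ((lorentzFactor v ^ 2 / (1 + lorentzFactor v)) • v -
        (lorentzFactor v * (energy m ‖l‖)⁻¹) • l)).smulRight v) l := by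
  have h1 : HasFDerivAt (fun l : EuclideanSpace ℝ (Fin 3) => inner ℝ v l) (innerSL ℝ v) l :=
    (innerSL ℝ v).hasFDerivAt
  have h2 := ((h1.const_mul (lorentzFactor v ^ 2 / (1 + lorentzFactor v))).sub
    ((hasFDerivAt_energy hm l).const_mul (lorentzFactor v))).smul_const v
  refine ((hasFDerivAt_id l).add h2).congr_fderiv ?_
  ext x
  simp [sub_mul, mul_assoc]

theorem det_one_add_smulRight (a v : EuclideanSpace ℝ (Fin 3)) :
    (ContinuousLinearMap.id ℝ _ + (innerSL ℝ a).smulRight v :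
      EuclideanSpace ℝ (Fin 3) →L[ℝ] EuclideanSpace ℝ (Fin 3)).det = 1 + inner ℝ a v := by
  have h := LinearMap.transvection.det ((innerSL ℝ a : _ →L[ℝ] ℝ) : _ →ₗ[ℝ] ℝ) v
  rw [ContinuousLinearMap.det]
  exact h

/-- Lorentz invariance of `d³l / ω_l`. -/
theorem integral_boostMomentum {m : ℝ} (hm : 0 < m) (hv : ‖v‖ < 1)
    (Φ : EuclideanSpace ℝ (Fin 3) → ℂ) :
    ∫ l, ((energy m ‖l‖)⁻¹ : ℝ) • Φ (boostMomentum m v l) = ∫ l, ((energy m ‖l‖)⁻¹ : ℝ) • Φ l := by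
  have hinj : InjOn (boostMomentum m v) univ :=
    (Function.LeftInverse.injective (boostMomentum_neg hm hv)).injOn
  have hsurj : boostMomentum m v '' univ = univ := by
    rw [image_univ]
    refine Function.Surjective.range_eq fun l => ⟨boostMomentum m (-v) l, ?_⟩
    simpa using boostMomentum_neg (v := -v) hm (by simpa using hv) l
  have h := integral_image_eq_integral_abs_det_fderiv_smul volume MeasurableSet.univ
    (fun l _ => (hasFDerivAt_boostMomentum (v := v) hm l).hasFDerivWithinAt) hinj
    (fun l => ((energy m ‖l‖)⁻¹ : ℝ) • Φ l)
  rw [hsurj, Measure.restrict_univ] at h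
  rw [h]
  refine integral_congr_ae (Eventually.of_forall fun l => ?_)
  have hE := energy_pos hm ‖l‖
  have hE' := energy_pos hm ‖boostMomentum m v l‖
  -- The Jacobian is `ω_{Λl}/ω_l`, which is what turns `1/ω_{Λl}` into `1/ω_l`.
  have hdet : 1 + inner ℝ ((lorentzFactor v ^ 2 / (1 + lorentzFactor v)) • v -
      (lorentzFactor v * (energy m ‖l‖)⁻¹) • l) v =
      energy m ‖boostMomentum m v l‖ * (energy m ‖l‖)⁻¹ := by
    rw [energy_boostMomentum hm hv, inner_sub_left, inner_smul_left, inner_smul_left,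
      real_inner_self_eq_norm_sq, real_inner_comm]
    have h2 := lorentzFactor_coeff hv
    simp only [conj_trivial]
    rw [h2]
    field_simp
    ring
  simp only
  rw [det_one_add_smulRight, hdet, abs_of_pos (by positivity), smul_smul]
  congr 1
  field_simp

end Kinematics

/-! ### Kinematics of the shell region -/

section ShellRegion

variable {m : ℝ} {k : EuclideanSpace ℝ (Fin 4)}

theorem pureBoost_add (v : EuclideanSpace ℝ (Fin 3)) (p q : EuclideanSpace ℝ (Fin 4)) :
    pureBoost v (p + q) = pureBoost v p + pureBoost v q := by
  have h : spatialPart (p + q) = spatialPart p + spatialPart q := rfl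
  have h' : ∀ a b : EuclideanSpace ℝ (Fin 4),
      spatialPart (a + b) = spatialPart a + spatialPart b := fun _ _ => rfl
  refine fourVector_ext ?_ ?_
  · rw [PiLp.add_apply]
    simp only [pureBoost_zero, h, inner_add_right, PiLp.add_apply]
    ring
  · rw [h']
    simp only [spatialPart_pureBoost, h, inner_add_right, PiLp.add_apply]
    module

/-- Polarization of the invariance of the Minkowski square. -/
theorem minkowski_pureBoost {v : EuclideanSpace ℝ (Fin 3)} (hv : ‖v‖ < 1)
    (p q : EuclideanSpace ℝ (Fin 4)) :
    minkowski (pureBoost v p) (pureBoost v q) = minkowski p q := by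
  have h1 := minkowskiSq_add (pureBoost v p) (pureBoost v q)
  rw [← pureBoost_add] at h1
  simp only [minkowskiSq_pureBoost hv, minkowskiSq_add p q] at h1
  linarith

theorem minkowski_self (k : EuclideanSpace ℝ (Fin 4)) : minkowski k k = minkowskiSq k := by
  rw [minkowski, minkowskiSq_eq, real_inner_self_eq_norm_sq, ← sq]

theorem minkowskiSq_mem_shellRegion (hm : 0 < m) (hk : k ∈ shellRegion m) :
    m ^ 2 / 4 < minkowskiSq k ∧ minkowskiSq k < 9 * m ^ 2 / 4 := by
  obtain ⟨h1, h2⟩ := hk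
  rw [Real.lt_sqrt (by positivity)] at h1
  rw [Real.sqrt_lt' (by positivity)] at h2
  constructor <;> nlinarith

theorem minkowskiSq_pos (hm : 0 < m) (hk : k ∈ shellRegion m) : 0 < minkowskiSq k :=
  lt_trans (by positivity) (minkowskiSq_mem_shellRegion hm hk).1

theorem norm_spatialPart_lt (hm : 0 < m) (hk : k ∈ shellRegion m) : ‖spatialPart k‖ < |k 0| := by
  have h := minkowskiSq_pos hm hk
  rw [minkowskiSq_eq] at h
  exact lt_of_pow_lt_pow_left₀ 2 (abs_nonneg _) (by rw [sq_abs]; linarith)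

theorem time_ne_zero (hm : 0 < m) (hk : k ∈ shellRegion m) : k 0 ≠ 0 :=
  abs_pos.1 ((norm_nonneg _).trans_lt (norm_spatialPart_lt hm hk))

/-- The velocity `𝐤 / k₀`. -/
def velocity (k : EuclideanSpace ℝ (Fin 4)) : EuclideanSpace ℝ (Fin 3) := (k 0)⁻¹ • spatialPart k

theorem norm_velocity_lt (hm : 0 < m) (hk : k ∈ shellRegion m) : ‖velocity k‖ < 1 := by
  rw [velocity, norm_smul, norm_inv, Real.norm_eq_abs,
    inv_mul_lt_one₀ (abs_pos.2 (time_ne_zero hm hk))]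
  exact norm_spatialPart_lt hm hk

theorem lorentzFactor_velocity (hm : 0 < m) (hk : k ∈ shellRegion m) :
    lorentzFactor (velocity k) = |k 0| / √(minkowskiSq k) := by
  have h0 := time_ne_zero hm hk
  have h : 1 - ‖velocity k‖ ^ 2 = minkowskiSq k / |k 0| ^ 2 := by
    rw [velocity, norm_smul, norm_inv, Real.norm_eq_abs, mul_pow, inv_pow, minkowskiSq_eq, sq_abs]
    field_simp
  rw [lorentzFactor, h, Real.sqrt_div (minkowskiSq_pos hm hk).le, Real.sqrt_sq (abs_nonneg _),
    one_div_div]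

/-- The time component in the rest frame of `k` is the Minkowski product with the unit vector along
`k`; the sign is present because `k₀` may be negative. -/
theorem restBoost_time (hm : 0 < m) (hk : k ∈ shellRegion m) (p : EuclideanSpace ℝ (Fin 4)) :
    restBoost k p 0 = SignType.sign (k 0) / √(minkowskiSq k) * minkowski k p := by
  have h0 := time_ne_zero hm hk
  have h1 : 0 < √(minkowskiSq k) := Real.sqrt_pos.2 (minkowskiSq_pos hm hk)
  have h2 : |k 0| = SignType.sign (k 0) * k 0 := (sign_mul_self (k 0)).symm
  rw [restBoost, ← velocity, pureBoost_zero, lorentzFactor_velocity hm hk, velocity,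
    inner_smul_left, minkowski, h2]
  simp only [conj_trivial]
  field_simp

theorem sign_sq_eq_one {x : ℝ} (hx : x ≠ 0) : ((SignType.sign x : SignType) : ℝ) ^ 2 = 1 := by
  rcases lt_or_gt_of_ne hx with h | h
  · simp [sign_neg h]
  · simp [sign_pos h]

theorem restBoost_time_sq (hm : 0 < m) (hk : k ∈ shellRegion m) (p : EuclideanSpace ℝ (Fin 4)) :
    restBoost k p 0 ^ 2 = minkowski k p ^ 2 / minkowskiSq k := by
  rw [restBoost_time hm hk, mul_pow, div_pow, sign_sq_eq_one (time_ne_zero hm hk),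
    Real.sq_sqrt (minkowskiSq_pos hm hk).le]
  ring

theorem minkowskiSq_restBoost (hm : 0 < m) (hk : k ∈ shellRegion m)
    (p : EuclideanSpace ℝ (Fin 4)) : minkowskiSq (restBoost k p) = minkowskiSq p :=
  minkowskiSq_pureBoost (norm_velocity_lt hm hk) p

/-- The boost enters the cutoffs only through this invariant, which is rational in `k · p` and `k²`,
so smoothness in `k` can be seen without differentiating the boost. -/
theorem norm_sq_spatialPart_restBoost (hm : 0 < m) (hk : k ∈ shellRegion m)
    (p : EuclideanSpace ℝ (Fin 4)) :
    ‖spatialPart (restBoost k p)‖ ^ 2 = minkowski k p ^ 2 / minkowskiSq k - minkowskiSq p := by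
  have h := minkowskiSq_restBoost hm hk p
  rw [minkowskiSq_eq (restBoost k p), restBoost_time_sq hm hk] at h
  linarith

theorem restBoost_self (hm : 0 < m) (hk : k ∈ shellRegion m) :
    restBoost k k = fourVector (SignType.sign (k 0) * √(minkowskiSq k)) 0 := by
  have h := minkowskiSq_pos hm hk
  have h1 : 0 < √(minkowskiSq k) := Real.sqrt_pos.2 h
  refine fourVector_ext ?_ ?_
  · rw [restBoost_time hm hk, minkowski_self, fourVector_zero]
    nth_rewrite 2 [← Real.sq_sqrt h.le]
    field_simp
  -- The spatial part vanishes because its square is `(k²)²/k² - k² = 0`.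
  · rw [spatialPart_fourVector, ← norm_eq_zero, ← sq_eq_zero_iff,
      norm_sq_spatialPart_restBoost hm hk, minkowski_self]
    field_simp
    ring

/-- The spatial momentum of an on-shell vector in the rest frame of `k`. -/
def restMomentum (m : ℝ) (k : EuclideanSpace ℝ (Fin 4)) (l : EuclideanSpace ℝ (Fin 3)) :
    EuclideanSpace ℝ (Fin 3) :=
  spatialPart (restBoost k (onShell m l))

theorem restMomentum_eq (m : ℝ) (k : EuclideanSpace ℝ (Fin 4)) :
    restMomentum m k = boostMomentum m (velocity k) := rfl

theorem norm_restMomentum_sq (hm : 0 < m) (hk : k ∈ shellRegion m)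
    (l : EuclideanSpace ℝ (Fin 3)) :
    ‖restMomentum m k l‖ ^ 2 = minkowski k (onShell m l) ^ 2 / minkowskiSq k - m ^ 2 := by
  rw [restMomentum, norm_sq_spatialPart_restBoost hm hk, minkowskiSq_onShell]

theorem minkowski_onShell_sq (hm : 0 < m) (hk : k ∈ shellRegion m)
    (l : EuclideanSpace ℝ (Fin 3)) :
    minkowski k (onShell m l) ^ 2 = minkowskiSq k * energy m ‖restMomentum m k l‖ ^ 2 := by
  have h := minkowskiSq_pos hm hk
  rw [energy_sq, norm_restMomentum_sq hm hk]
  field_simp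
  ring

/-- Here the bound `√(k²) < 3m/2` enters: `k² - 4m² ≤ (9/4 - 4) m² = -(7/4) m²`. The threshold
`√(k²) = 2m` is not reached. -/
theorem rest_denominator_neg (hm : 0 < m) (hk : k ∈ shellRegion m) (x : ℝ) :
    minkowskiSq k - 4 * energy m x ^ 2 ≤ -(7 / 4 * (x ^ 2 + m ^ 2)) := by
  have h := (minkowskiSq_mem_shellRegion hm hk).2
  rw [energy_sq]
  nlinarith [sq_nonneg x]

theorem rest_denominator_lt (hm : 0 < m) (hk : k ∈ shellRegion m) (x : ℝ) :
    minkowskiSq k - 4 * energy m x ^ 2 < 0 :=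
  (rest_denominator_neg hm hk x).trans_lt (neg_neg_of_pos (by positivity))

/-- On the mass shell `(k ∓ l)² - m² = k² ∓ 2 k·l`. A zero would force `(k²)² = 4 (k·l)² = 4 k² ω²`,
with `ω` the energy in the rest frame of `k`, contrary to `k² < 4ω²`. -/
theorem off_shell (hm : 0 < m) (hk : k ∈ shellRegion m) (l : EuclideanSpace ℝ (Fin 3)) :
    minkowskiSq (k - onShell m l) ≠ m ^ 2 ∧ minkowskiSq (k + onShell m l) ≠ m ^ 2 := by
  have h := minkowskiSq_pos hm hk
  have h1 := minkowski_onShell_sq hm hk l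
  have h2 := rest_denominator_lt hm hk ‖restMomentum m k l‖
  rw [minkowskiSq_sub, minkowskiSq_add, minkowskiSq_onShell]
  have h3 : minkowskiSq k * minkowskiSq k - 4 * minkowski k (onShell m l) ^ 2 < 0 := by
    rw [h1]; nlinarith
  constructor <;> intro h4 <;> nlinarith

/-- The denominators are `k² ∓ 2 k·l`, so the terms odd in `k·l` cancel in the sum. -/
theorem propagator_sum (hm : 0 < m) (hk : k ∈ shellRegion m) (l : EuclideanSpace ℝ (Fin 3)) :
    -1 / (minkowskiSq (k - onShell m l) - m ^ 2) + -1 / (minkowskiSq (k + onShell m l) - m ^ 2) =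
      -2 * minkowskiSq k / (minkowskiSq k ^ 2 - 4 * minkowski k (onShell m l) ^ 2) := by
  obtain ⟨h1, h2⟩ := off_shell hm hk l
  rw [← sub_ne_zero] at h1 h2
  rw [div_add_div _ _ h1 h2]
  rw [minkowskiSq_sub, minkowskiSq_add, minkowskiSq_onShell]
  congr 1 <;> ring

theorem propagator_sum_rest (hm : 0 < m) (hk : k ∈ shellRegion m)
    (l : EuclideanSpace ℝ (Fin 3)) :
    -1 / (minkowskiSq (k - onShell m l) - m ^ 2) + -1 / (minkowskiSq (k + onShell m l) - m ^ 2) =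
      -2 / (minkowskiSq k - 4 * energy m ‖restMomentum m k l‖ ^ 2) := by
  have h := minkowskiSq_pos hm hk
  have h2 := rest_denominator_lt hm hk ‖restMomentum m k l‖
  rw [propagator_sum hm hk, minkowski_onShell_sq hm hk,
    div_eq_div_iff (by nlinarith) h2.ne]
  ring

/-- On-shell momenta grow in the rest frame of `k`. -/
theorem le_abs_minkowski_onShell (k : EuclideanSpace ℝ (Fin 4)) (x : ℝ)
    (l : EuclideanSpace ℝ (Fin 3)) (hx : ‖l‖ ≤ x) :
    (|k 0| - ‖spatialPart k‖) * x ≤ |minkowski k (fourVector x l)| := by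
  have h1 : |inner ℝ (spatialPart k) l| ≤ ‖spatialPart k‖ * x :=
    (abs_real_inner_le_norm _ _).trans (by gcongr)
  have h2 := abs_sub_abs_le_abs_sub (k 0 * x) (inner ℝ (spatialPart k) l)
  rw [abs_mul, abs_of_nonneg ((norm_nonneg l).trans hx)] at h2
  rw [minkowski, fourVector_zero, spatialPart_fourVector]
  linarith

/-! #### The twist -/

variable {σ : Matrix (Fin 4) (Fin 4) ℝ}

/-- `kσ` is a covector; raising its index flips the sign of the spatial part, and the pairing
becomes a Minkowski product, on which boosts act isometrically. -/
theorem twistPairing_eq (σ : Matrix (Fin 4) (Fin 4) ℝ) (k p : EuclideanSpace ℝ (Fin 4)) :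
    twistPairing σ k p = minkowski (fourVector (twist σ k 0) (-spatialPart (twist σ k))) p := by
  rw [twistPairing, minkowski, inner_three, fourVector_zero, spatialPart_fourVector,
    Fin.sum_univ_succ]
  simp

theorem twistPairing_self (hσ : σ.transpose = -σ) (k : EuclideanSpace ℝ (Fin 4)) :
    twistPairing σ k k = 0 := by
  have h : ∀ i j, σ i j = -σ j i := fun i j => by
    have := congrFun (congrFun hσ j) i
    simpa using this
  have h1 : twistPairing σ k k = ∑ ν, ∑ μ, k μ * σ μ ν * k ν := by
    simp [twistPairing, twist, Finset.sum_mul]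
  have h2 : twistPairing σ k k = -twistPairing σ k k := by
    nth_rewrite 2 [h1]
    conv_lhs => rw [h1, Finset.sum_comm]
    rw [← Finset.sum_neg_distrib]
    refine Finset.sum_congr rfl fun μ _ => ?_
    rw [← Finset.sum_neg_distrib]
    refine Finset.sum_congr rfl fun ν _ => ?_
    rw [h μ ν]; ring
  linarith

/-- The covector `kσ` in the rest frame of `k`, where it is purely spatial. -/
def restTwist (σ : Matrix (Fin 4) (Fin 4) ℝ) (k : EuclideanSpace ℝ (Fin 4)) :
    EuclideanSpace ℝ (Fin 3) :=
  -spatialPart (restBoost k (fourVector (twist σ k 0) (-spatialPart (twist σ k))))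

/-- Antisymmetry gives `kσk = 0`: the vector `kσ` is orthogonal to `k` and so has no time component
in the rest frame of `k`. -/
theorem restBoost_twist_time (hσ : σ.transpose = -σ) (hm : 0 < m) (hk : k ∈ shellRegion m) :
    restBoost k (fourVector (twist σ k 0) (-spatialPart (twist σ k))) 0 = 0 := by
  have h := twistPairing_self hσ k
  rw [twistPairing_eq] at h
  have hc : minkowski k (fourVector (twist σ k 0) (-spatialPart (twist σ k))) = 0 := by
    rw [← h, minkowski, minkowski, real_inner_comm, mul_comm]
  rw [restBoost_time hm hk, hc, mul_zero]

theorem twistPairing_eq_inner (hσ : σ.transpose = -σ) (hm : 0 < m) (hk : k ∈ shellRegion m)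
    (p : EuclideanSpace ℝ (Fin 4)) :
    twistPairing σ k p = inner ℝ (restTwist σ k) (spatialPart (restBoost k p)) := by
  rw [twistPairing_eq, ← minkowski_pureBoost (norm_velocity_lt hm hk)]
  change minkowski (restBoost k _) (restBoost k p) = _
  rw [minkowski, restBoost_twist_time hσ hm hk, restTwist, inner_neg_left]
  ring

theorem norm_sq_restTwist (hσ : σ.transpose = -σ) (hm : 0 < m) (hk : k ∈ shellRegion m) :
    ‖restTwist σ k‖ ^ 2 = -minkowskiSq (twist σ k) := by
  have h := minkowskiSq_restBoost hm hk (fourVector (twist σ k 0) (-spatialPart (twist σ k)))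
  rw [minkowskiSq_eq, minkowskiSq_eq, restBoost_twist_time hσ hm hk, fourVector_zero,
    spatialPart_fourVector, norm_neg] at h
  rw [minkowskiSq_eq, restTwist, norm_neg]
  linarith

theorem twistLength_eq (hσ : σ.transpose = -σ) (hm : 0 < m) (hk : k ∈ shellRegion m) :
    twistLength σ k = ‖restTwist σ k‖ := by
  rw [twistLength, ← norm_sq_restTwist hσ hm hk, Real.sqrt_sq (norm_nonneg _)]

theorem eq_zero_of_twist_eq_zero (hσ' : σ.det ≠ 0) (h : twist σ k = 0) : k = 0 := by
  have h1 : Matrix.vecMul (WithLp.ofLp k) σ = 0 := by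
    ext ν
    have := congrArg (fun p : EuclideanSpace ℝ (Fin 4) => p ν) h
    simpa [twist, Matrix.vecMul, dotProduct] using this
  have h2 := Matrix.eq_zero_of_vecMul_eq_zero hσ' h1
  ext i
  exact congrFun h2 i

/-- In the rest frame `-(kσ)²` is the square of a spatial vector. If that vector vanished then `kσp
= 0` for every `p`, and nondegeneracy would give `k = 0`. -/
theorem twistLength_pos (hσ : σ.transpose = -σ) (hσ' : σ.det ≠ 0) (hm : 0 < m)
    (hk : k ∈ shellRegion m) : 0 < twistLength σ k := by
  rw [twistLength_eq hσ hm hk, norm_pos_iff]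
  intro h
  have h1 : twist σ k = 0 := by
    ext ν
    have h2 := twistPairing_eq_inner hσ hm hk (EuclideanSpace.single ν 1)
    rw [h, inner_zero_left] at h2
    simpa [twistPairing] using h2
  exact time_ne_zero hm hk (by rw [eq_zero_of_twist_eq_zero hσ' h1]; rfl)

/-! #### The phase -/

/-- The gradient in `k` of the phase. -/
def phaseGradient (σ : Matrix (Fin 4) (Fin 4) ℝ) (ε : ℝ) (l : EuclideanSpace ℝ (Fin 3)) :
    EuclideanSpace ℝ (Fin 4) :=
  ε • Matrix.toEuclideanCLM (𝕜 := ℝ) σ (fourVector ‖l‖ l)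

theorem twistPairing_eq_inner_toEuclideanCLM (σ : Matrix (Fin 4) (Fin 4) ℝ)
    (k p : EuclideanSpace ℝ (Fin 4)) :
    twistPairing σ k p = inner ℝ k (Matrix.toEuclideanCLM (𝕜 := ℝ) σ p) := by
  have h : ∀ i, Matrix.toEuclideanCLM (𝕜 := ℝ) σ p i = ∑ j, σ i j * p j := fun i => by
    rw [Matrix.ofLp_toEuclideanCLM]; rfl
  simp only [twistPairing, twist, PiLp.inner_apply, h, Finset.sum_mul, RCLike.inner_apply,
    conj_trivial]
  rw [Finset.sum_comm]
  refine Finset.sum_congr rfl fun i _ => Finset.sum_congr rfl fun j _ => by ring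

theorem twistPhase_eq_linearPhase (σ : Matrix (Fin 4) (Fin 4) ℝ) (ε : ℝ) :
    twistPhase σ ε = linearPhase (phaseGradient σ ε) := by
  funext k l
  rw [twistPhase, twistPairing_eq_inner_toEuclideanCLM, linearPhase, phaseGradient,
    inner_smul_right]

theorem contDiff_fourVector :
    ContDiff ℝ ∞ fun z : ℝ × EuclideanSpace ℝ (Fin 3) => fourVector z.1 z.2 := by
  rw [contDiff_euclidean]
  intro i
  refine Fin.cases ?_ (fun j => ?_) i
  · simp only [fourVector_zero]; fun_prop
  · simp only [fourVector_succ]; fun_prop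

theorem norm_le_norm_fourVector (x : ℝ) (l : EuclideanSpace ℝ (Fin 3)) :
    ‖l‖ ≤ ‖fourVector x l‖ := by
  refine le_of_sq_le_sq ?_ (norm_nonneg _)
  rw [EuclideanSpace.real_norm_sq_eq, EuclideanSpace.real_norm_sq_eq,
    Fin.sum_univ_succ (f := fun i => fourVector x l i ^ 2)]
  simp only [fourVector_zero, fourVector_succ]
  nlinarith [sq_nonneg x]

theorem continuous_phaseGradient (σ : Matrix (Fin 4) (Fin 4) ℝ) (ε : ℝ) :
    Continuous (phaseGradient σ ε) := by
  refine Continuous.const_smul ((Matrix.toEuclideanCLM (𝕜 := ℝ) σ).continuous.comp ?_) ε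
  exact contDiff_fourVector.continuous.comp (continuous_norm.prodMk continuous_id)

/-- `|l| ≤ |(|l|, l)| ≤ ‖σ⁻¹‖ |σ(|l|, l)|`. The `+ 1` in the constant makes it visibly positive. -/
theorem exists_le_norm_phaseGradient (hσ' : σ.det ≠ 0) {ε : ℝ} (hε : ε = 1 ∨ ε = -1) :
    ∃ c : ℝ, 0 < c ∧ ∀ l, c * ‖l‖ ≤ ‖phaseGradient σ ε l‖ := by
  set B := Matrix.toEuclideanCLM (𝕜 := ℝ) σ⁻¹ with hB
  have h1 (p : EuclideanSpace ℝ (Fin 4)) : B (Matrix.toEuclideanCLM (𝕜 := ℝ) σ p) = p := by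
    rw [← mul_apply_eq_comp, hB, ← map_mul, Matrix.nonsing_inv_mul _ (isUnit_iff_ne_zero.2 hσ'),
      map_one]
    rfl
  have hε' : |ε| = 1 := by rcases hε with rfl | rfl <;> simp
  refine ⟨(‖B‖ + 1)⁻¹, by positivity, fun l => ?_⟩
  rw [phaseGradient, norm_smul, Real.norm_eq_abs, hε', one_mul, inv_mul_le_iff₀ (by positivity)]
  calc ‖l‖ ≤ ‖fourVector ‖l‖ l‖ := norm_le_norm_fourVector _ _
    _ = ‖B (Matrix.toEuclideanCLM (𝕜 := ℝ) σ (fourVector ‖l‖ l))‖ := by rw [h1]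
    _ ≤ ‖B‖ * ‖Matrix.toEuclideanCLM (𝕜 := ℝ) σ (fourVector ‖l‖ l)‖ := B.le_opNorm _
    _ ≤ _ := by gcongr; linarith

theorem phaseGradient_smul {c : ℝ} (hc : 0 ≤ c) (σ : Matrix (Fin 4) (Fin 4) ℝ) (ε : ℝ)
    (l : EuclideanSpace ℝ (Fin 3)) : phaseGradient σ ε (c • l) = c • phaseGradient σ ε l := by
  have h : fourVector ‖c • l‖ (c • l) = c • fourVector ‖l‖ l := by
    refine fourVector_ext ?_ rfl
    rw [fourVector_zero, norm_smul, Real.norm_of_nonneg hc]; rfl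
  rw [phaseGradient, h, map_smul, smul_comm]; rfl

/-- The `k`-part of the gradient is `w(l)` itself, which is nonzero for `l ≠ 0` by the lower bound;
the gradient in `l` is not needed. -/
theorem isPhaseFunction_twistPhase (Ω : Opens (EuclideanSpace ℝ (Fin 4))) (hσ' : σ.det ≠ 0)
    {ε : ℝ} (hε : ε = 1 ∨ ε = -1) : IsPhaseFunction Ω (twistPhase σ ε) := by
  have hsm : ∀ l : EuclideanSpace ℝ (Fin 3), l ≠ 0 → ContDiffAt ℝ ∞ (phaseGradient σ ε) l := by
    intro l hl
    have h1 : ContDiffAt ℝ ∞ (fun l : EuclideanSpace ℝ (Fin 3) => fourVector ‖l‖ l) l :=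
      contDiff_fourVector.contDiffAt.comp l ((contDiffAt_norm ℝ hl).prodMk contDiffAt_id)
    exact ((Matrix.toEuclideanCLM (𝕜 := ℝ) σ).contDiff.contDiffAt.comp l h1).const_smul ε
  have hun : Function.uncurry (linearPhase (phaseGradient σ ε)) =
      fun z : EuclideanSpace ℝ (Fin 4) × EuclideanSpace ℝ (Fin 3) =>
        inner ℝ z.1 (phaseGradient σ ε z.2) := rfl
  have hat : ∀ k : EuclideanSpace ℝ (Fin 4), ∀ l : EuclideanSpace ℝ (Fin 3), l ≠ 0 →
      ContDiffAt ℝ ∞ (Function.uncurry (linearPhase (phaseGradient σ ε))) (k, l) := by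
    intro k l hl
    rw [hun]
    exact contDiffAt_fst.inner ℝ (ContDiffAt.comp (g := phaseGradient σ ε) (k, l) (hsm l hl)
      contDiffAt_snd)
  rw [twistPhase_eq_linearPhase]
  refine ⟨?_, ?_, ?_, ?_⟩
  · rw [hun]
    exact (continuous_fst.inner
      ((continuous_phaseGradient σ ε).comp continuous_snd)).continuousOn
  · intro c hc k _ l
    rw [linearPhase, phaseGradient_smul hc, inner_smul_right]; rfl
  · rintro ⟨k, l⟩ ⟨_, hl⟩
    exact (hat k l hl).contDiffWithinAt
  · intro k _ l hl h0
    obtain ⟨c, hc, hcl⟩ := exists_le_norm_phaseGradient hσ' hε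
    have h1 : HasFDerivAt (Function.uncurry (linearPhase (phaseGradient σ ε)))
        (0 : _ →L[ℝ] ℝ) (k, l) := by
      rw [← h0]
      exact ((hat k l hl).differentiableAt (by simp)).hasFDerivAt
    have h2 : HasFDerivAt (fun k' => (k', l)) (ContinuousLinearMap.inl ℝ _ _) k :=
      hasFDerivAt_prodMk_left k l
    have h3 := h1.comp k h2
    have h4 : HasFDerivAt (fun k' => inner ℝ k' (phaseGradient σ ε l))
        (innerSL ℝ (phaseGradient σ ε l)) k := by
      refine ((innerSL ℝ (phaseGradient σ ε l)).hasFDerivAt (x := k)).congr_of_eventuallyEq ?_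
      exact Eventually.of_forall fun k' => real_inner_comm _ _
    have h5 := congrArg (fun L => L (phaseGradient σ ε l)) (h4.unique h3)
    simp only [innerSL_apply_apply, ContinuousLinearMap.zero_comp, zero_apply,
      real_inner_self_eq_norm_sq] at h5
    have h6 := hcl l
    rw [pow_eq_zero_iff two_ne_zero] at h5
    rw [h5] at h6
    exact absurd h6 (not_le.2 (mul_pos hc (norm_pos_iff.2 hl)))

end ShellRegion

/-! ### The amplitude is an asymptotic symbol -/

section Amplitude

variable {m : ℝ} {k : EuclideanSpace ℝ (Fin 4)}

/-- Rescaling momenta by `R` amounts to replacing the mass by `m/R`, so large momenta correspond to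
the massless limit. -/
theorem energy_mul {R : ℝ} (hR : 0 < R) (m : ℝ) (l : EuclideanSpace ℝ (Fin 3)) :
    energy m ‖R • l‖ = R * energy (R⁻¹ * m) ‖l‖ := by
  refine (eq_energy (mul_nonneg hR.le (energy_nonneg _ _)) ?_).symm
  rw [mul_pow, energy_sq, norm_smul, Real.norm_of_nonneg hR.le]
  field_simp

theorem onShell_smul {R : ℝ} (hR : 0 < R) (m : ℝ) (l : EuclideanSpace ℝ (Fin 3)) :
    onShell m (R • l) = R • onShell (R⁻¹ * m) l := by
  refine fourVector_ext ?_ rfl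
  rw [onShell_zero, energy_mul hR]; rfl

theorem minkowski_smul (k p : EuclideanSpace ℝ (Fin 4)) (R : ℝ) :
    minkowski k (R • p) = R * minkowski k p := by
  have h : spatialPart (R • p) = R • spatialPart p := rfl
  rw [minkowski, minkowski, h, inner_smul_right, PiLp.smul_apply, smul_eq_mul]
  ring

theorem contDiff_minkowskiSq : ContDiff ℝ ∞ minkowskiSq := by
  unfold minkowskiSq; fun_prop

theorem contDiff_minkowski : ContDiff ℝ ∞
    fun z : EuclideanSpace ℝ (Fin 4) × EuclideanSpace ℝ (Fin 4) => minkowski z.1 z.2 := by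
  simp only [minkowski, inner_three, spatialPart_apply]
  fun_prop

theorem contDiff_twist_time (σ : Matrix (Fin 4) (Fin 4) ℝ) :
    ContDiff ℝ ∞ fun k => twist σ k 0 := by
  simp only [twist]
  fun_prop

/-- The alternative in the hypothesis serves both regimes: `u = 1` with `l` arbitrary, including
`0`, and `u` arbitrary, including the massless value `0`, with `l ≠ 0`. -/
theorem contDiffAt_energy {u : ℝ} {l : EuclideanSpace ℝ (Fin 3)} (h : u * m ≠ 0 ∨ l ≠ 0) :
    ContDiffAt ℝ ∞ (fun z : ℝ × EuclideanSpace ℝ (Fin 3) => energy (z.1 * m) ‖z.2‖) (u, l) := by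
  have h1 : ‖l‖ ^ 2 + (u * m) ^ 2 ≠ 0 := by
    rcases h with h | h
    · have := pow_pos (abs_pos.2 h) 2
      rw [sq_abs] at this
      positivity
    · have := norm_pos_iff.2 h
      positivity
  refine ContDiffAt.sqrt (f := fun z : ℝ × EuclideanSpace ℝ (Fin 3) =>
    ‖z.2‖ ^ 2 + (z.1 * m) ^ 2) ?_ h1
  exact ((contDiff_snd.norm_sq ℝ).add ((contDiff_fst.mul contDiff_const).pow 2)).contDiffAt

theorem energy_pos_of {u : ℝ} {l : EuclideanSpace ℝ (Fin 3)} (h : u * m ≠ 0 ∨ l ≠ 0) :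
    0 < energy (u * m) ‖l‖ := by
  refine Real.sqrt_pos.2 ?_
  rcases h with h | h
  · have := pow_pos (abs_pos.2 h) 2
    rw [sq_abs] at this
    positivity
  · have := norm_pos_iff.2 h
    positivity

theorem contDiffAt_onShell {u : ℝ} {l : EuclideanSpace ℝ (Fin 3)} (h : u * m ≠ 0 ∨ l ≠ 0) :
    ContDiffAt ℝ ∞ (fun z : ℝ × EuclideanSpace ℝ (Fin 3) => onShell (z.1 * m) z.2) (u, l) :=
  contDiff_fourVector.contDiffAt.comp (u, l) ((contDiffAt_energy h).prodMk contDiffAt_snd)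

theorem contDiffAt_minkowski_onShell {u : ℝ} {l : EuclideanSpace ℝ (Fin 3)}
    (k : EuclideanSpace ℝ (Fin 4)) (h : u * m ≠ 0 ∨ l ≠ 0) :
    ContDiffAt ℝ ∞ (fun z : EuclideanSpace ℝ (Fin 4) × (ℝ × EuclideanSpace ℝ (Fin 3)) =>
      minkowski z.1 (onShell (z.2.1 * m) z.2.2)) (k, (u, l)) :=
  contDiff_minkowski.contDiffAt.comp (k, (u, l)) (contDiffAt_fst.prodMk
    (ContDiffAt.comp (g := fun z : ℝ × EuclideanSpace ℝ (Fin 3) => onShell (z.1 * m) z.2)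
      (k, (u, l)) (contDiffAt_onShell h) contDiffAt_snd))

/-- For `u = 0` the vector is lightlike and nonzero, so its product with the timelike `k` does not
vanish. For `u ≠ 0` the rest-frame energy is at least `|u| m`, that is `(k·l)² ≥ k² u² m²`, and `k²
< 4m²` concludes. -/
theorem scaled_denominator_neg (hm : 0 < m) (hk : k ∈ shellRegion m) {u : ℝ}
    {l : EuclideanSpace ℝ (Fin 3)} (h : u * m ≠ 0 ∨ l ≠ 0) :
    u ^ 2 * minkowskiSq k ^ 2 - 4 * minkowski k (onShell (u * m) l) ^ 2 < 0 := by
  have h0 := minkowskiSq_pos hm hk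
  have h1 := (minkowskiSq_mem_shellRegion hm hk).2
  by_cases hu : u = 0
  · subst hu
    have hl : l ≠ 0 := h.resolve_left (by simp)
    have h2 := le_abs_minkowski_onShell k (energy (0 * m) ‖l‖) l
      (Real.le_sqrt_of_sq_le (by simp))
    have h3 : 0 < |minkowski k (onShell (0 * m) l)| := lt_of_lt_of_le
      (mul_pos (sub_pos.2 (norm_spatialPart_lt hm hk)) (energy_pos_of h)) h2
    have h4 : 0 < minkowski k (onShell (0 * m) l) ^ 2 := by
      rw [← sq_abs]; positivity
    nlinarith
  · have h2 := norm_sq_spatialPart_restBoost hm hk (onShell (u * m) l)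
    rw [minkowskiSq_onShell] at h2
    have h3 : (u * m) ^ 2 ≤ minkowski k (onShell (u * m) l) ^ 2 / minkowskiSq k := by
      linarith [sq_nonneg ‖spatialPart (restBoost k (onShell (u * m) l))‖]
    rw [le_div_iff₀ h0] at h3
    have h4 : 0 < u ^ 2 := by positivity
    have h5 : u ^ 2 * minkowskiSq k ^ 2 < 4 * ((u * m) ^ 2 * minkowskiSq k) := by
      have : u ^ 2 * (minkowskiSq k * minkowskiSq k) <
          u ^ 2 * ((4 * m ^ 2) * minkowskiSq k) := by
        gcongr; nlinarith
      nlinarith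
    linarith

/-- The amplitude on the mass shell `u m`, with `x` in place of `|l|`. -/
def scaledAmplitude (m : ℝ) (σ : Matrix (Fin 4) (Fin 4) ℝ) (ε : ℝ)
    (z : (EuclideanSpace ℝ (Fin 4) × (ℝ × EuclideanSpace ℝ (Fin 3))) × ℝ) : ℂ :=
  ((((2 * Real.pi) ^ 3)⁻¹ * (1 / (2 * energy (z.2 * m) ‖z.1.2.2‖)) *
    (-2 * minkowskiSq z.1.1 / (z.2 ^ 2 * minkowskiSq z.1.1 ^ 2 -
      4 * minkowski z.1.1 (onShell (z.2 * m) z.1.2.2) ^ 2)) : ℝ) : ℂ) *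
    Complex.exp (Complex.I * ((ε * twist σ z.1.1 0 *
      (z.2 * m ^ 2 / (energy (z.2 * m) ‖z.1.2.2‖ + z.1.2.1)) : ℝ) : ℂ))

/-- The only obstruction to smoothness at positive mass is `|l|` in the exponent. Replacing it by an
independent variable `x ≥ 0` gives a function smooth also at `l = 0`; for `l ≠ 0` it is smooth up to
`u = 0`. -/
theorem contDiffAt_scaledAmplitude (hm : 0 < m) (σ : Matrix (Fin 4) (Fin 4) ℝ) (ε : ℝ)
    (hk : k ∈ shellRegion m) {u x : ℝ} {l : EuclideanSpace ℝ (Fin 3)} (h : u * m ≠ 0 ∨ l ≠ 0)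
    (hx : 0 ≤ x) : ContDiffAt ℝ ∞ (scaledAmplitude m σ ε) ((k, (x, l)), u) := by
  have hE := energy_pos_of h
  have cE : ContDiffAt ℝ ∞
      (fun z : (EuclideanSpace ℝ (Fin 4) × (ℝ × EuclideanSpace ℝ (Fin 3))) × ℝ =>
        energy (z.2 * m) ‖z.1.2.2‖) ((k, (x, l)), u) :=
    ContDiffAt.comp (g := fun z : ℝ × EuclideanSpace ℝ (Fin 3) => energy (z.1 * m) ‖z.2‖)
      (f := fun z : (EuclideanSpace ℝ (Fin 4) × (ℝ × EuclideanSpace ℝ (Fin 3))) × ℝ =>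
        (z.2, z.1.2.2)) _ (contDiffAt_energy h) (by fun_prop)
  have cM : ContDiffAt ℝ ∞
      (fun z : (EuclideanSpace ℝ (Fin 4) × (ℝ × EuclideanSpace ℝ (Fin 3))) × ℝ =>
        minkowski z.1.1 (onShell (z.2 * m) z.1.2.2)) ((k, (x, l)), u) :=
    ContDiffAt.comp (g := fun z : EuclideanSpace ℝ (Fin 4) × (ℝ × EuclideanSpace ℝ (Fin 3)) =>
        minkowski z.1 (onShell (z.2.1 * m) z.2.2))
      (f := fun z : (EuclideanSpace ℝ (Fin 4) × (ℝ × EuclideanSpace ℝ (Fin 3))) × ℝ =>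
        (z.1.1, (z.2, z.1.2.2))) _ (contDiffAt_minkowski_onShell k h) (by fun_prop)
  have cS : ContDiffAt ℝ ∞
      (fun z : (EuclideanSpace ℝ (Fin 4) × (ℝ × EuclideanSpace ℝ (Fin 3))) × ℝ =>
        minkowskiSq z.1.1) ((k, (x, l)), u) :=
    (contDiff_minkowskiSq.comp (contDiff_fst.comp contDiff_fst)).contDiffAt
  have cT : ContDiffAt ℝ ∞
      (fun z : (EuclideanSpace ℝ (Fin 4) × (ℝ × EuclideanSpace ℝ (Fin 3))) × ℝ =>
        twist σ z.1.1 0) ((k, (x, l)), u) :=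
    ((contDiff_twist_time σ).comp (contDiff_fst.comp contDiff_fst)).contDiffAt
  have cx : ContDiffAt ℝ ∞
      (fun z : (EuclideanSpace ℝ (Fin 4) × (ℝ × EuclideanSpace ℝ (Fin 3))) × ℝ =>
        z.1.2.1) ((k, (x, l)), u) := by fun_prop
  have cu : ContDiffAt ℝ ∞
      (fun z : (EuclideanSpace ℝ (Fin 4) × (ℝ × EuclideanSpace ℝ (Fin 3))) × ℝ =>
        z.2) ((k, (x, l)), u) := by fun_prop
  have hofReal : ContDiff ℝ ∞ (fun x : ℝ => (x : ℂ)) := Complex.ofRealCLM.contDiff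
  unfold scaledAmplitude
  refine ContDiffAt.mul (hofReal.contDiffAt.comp _ ?_)
    (ContDiffAt.cexp (contDiffAt_const.mul (hofReal.contDiffAt.comp _ ?_)))
  · refine (contDiffAt_const.mul (contDiffAt_const.div (contDiffAt_const.mul cE) ?_)).mul
      ((contDiffAt_const.mul cS).div (((cu.pow 2).mul (cS.pow 2)).sub
        (contDiffAt_const.mul (cM.pow 2))) ?_)
    · exact (mul_pos two_pos hE).ne'
    · exact (scaled_denominator_neg hm hk h).ne
  · refine (contDiffAt_const.mul cT).mul ((cu.mul contDiffAt_const).div (cE.add cx) ?_)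
    exact (add_pos_of_pos_of_nonneg hE hx).ne'

/-- Of the factor `R^(-3)` one power comes from `1/ω_l` and two from the summed propagators. In the
exponent, `ω_l - |l| = m²/(ω_l + |l|)` removes the cancellation and exhibits smoothness in `1/R`. -/
theorem amplitude_smul (hm : 0 < m) (σ : Matrix (Fin 4) (Fin 4) ℝ) (ε : ℝ)
    (hk : k ∈ shellRegion m) {R : ℝ} (hR : 0 < R) (l : EuclideanSpace ℝ (Fin 3)) :
    amplitude m σ ε k (R • l) =
      (R ^ (-3 : ℝ) : ℝ) • scaledAmplitude m σ ε ((k, (‖l‖, l)), R⁻¹) := by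
  have hu : R⁻¹ * m ≠ 0 ∨ l ≠ 0 := Or.inl (by positivity)
  have hE := energy_pos_of hu
  have hD := (scaled_denominator_neg hm hk hu).ne
  have h3 : (R ^ (-3 : ℝ) : ℝ) = (R ^ 3)⁻¹ := by
    rw [Real.rpow_neg hR.le]; norm_cast
  have hdiff : energy m ‖R • l‖ - ‖R • l‖ = R⁻¹ * m ^ 2 / (energy (R⁻¹ * m) ‖l‖ + ‖l‖) := by
    have hs := energy_sq (R⁻¹ * m) ‖l‖
    rw [energy_mul hR, norm_smul, Real.norm_of_nonneg hR.le, eq_div_iff (by positivity)]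
    calc _ = R * (energy (R⁻¹ * m) ‖l‖ ^ 2 - ‖l‖ ^ 2) := by ring
      _ = _ := by rw [hs]; field_simp; ring
  have hre : ((2 * Real.pi) ^ 3)⁻¹ * (1 / (2 * energy m ‖R • l‖)) *
      (-1 / (minkowskiSq (k - onShell m (R • l)) - m ^ 2)
        + -1 / (minkowskiSq (k + onShell m (R • l)) - m ^ 2)) =
      (R ^ 3)⁻¹ * (((2 * Real.pi) ^ 3)⁻¹ * (1 / (2 * energy (R⁻¹ * m) ‖l‖)) *
    (-2 * minkowskiSq k / (R⁻¹ ^ 2 * minkowskiSq k ^ 2 -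
      4 * minkowski k (onShell (R⁻¹ * m) l) ^ 2))) := by
    rw [propagator_sum hm hk, energy_mul hR, onShell_smul hR, minkowski_smul]
    have h4 : minkowskiSq k ^ 2 - 4 * (R * minkowski k (onShell (R⁻¹ * m) l)) ^ 2 =
        R ^ 2 * (R⁻¹ ^ 2 * minkowskiSq k ^ 2 - 4 * minkowski k (onShell (R⁻¹ * m) l) ^ 2) := by
      field_simp
    rw [h4]
    set D := R⁻¹ ^ 2 * minkowskiSq k ^ 2 - 4 * minkowski k (onShell (R⁻¹ * m) l) ^ 2
    field_simp
  rw [amplitude, hre, hdiff, h3, scaledAmplitude, Complex.real_smul, Complex.ofReal_mul,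
    mul_assoc]

theorem amplitude_eq_scaledAmplitude (hm : 0 < m) (σ : Matrix (Fin 4) (Fin 4) ℝ) (ε : ℝ)
    (hk : k ∈ shellRegion m) (l : EuclideanSpace ℝ (Fin 3)) :
    amplitude m σ ε k l = scaledAmplitude m σ ε ((k, (‖l‖, l)), 1) := by
  simpa using amplitude_smul hm σ ε hk one_pos l

theorem contDiffAt_amplitude (hm : 0 < m) (σ : Matrix (Fin 4) (Fin 4) ℝ) (ε : ℝ)
    (hk : k ∈ shellRegion m) {l : EuclideanSpace ℝ (Fin 3)} (hl : l ≠ 0) :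
    ContDiffAt ℝ ∞ (Function.uncurry (amplitude m σ ε)) (k, l) := by
  have h1 : ContDiffAt ℝ ∞ (fun z : EuclideanSpace ℝ (Fin 4) × EuclideanSpace ℝ (Fin 3) =>
      scaledAmplitude m σ ε ((z.1, (‖z.2‖, z.2)), 1)) (k, l) := by
    refine ContDiffAt.comp (g := scaledAmplitude m σ ε) (f := fun z :
      EuclideanSpace ℝ (Fin 4) × EuclideanSpace ℝ (Fin 3) => ((z.1, (‖z.2‖, z.2)), (1 : ℝ))) _
      (contDiffAt_scaledAmplitude hm σ ε hk (Or.inr hl) (norm_nonneg l)) ?_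
    exact (contDiffAt_fst.prodMk ((contDiffAt_snd.norm ℝ hl).prodMk contDiffAt_snd)).prodMk
      contDiffAt_const
  refine h1.congr_of_eventuallyEq ?_
  have hev : ∀ᶠ z in 𝓝 (k, l), z.1 ∈ shellRegion m :=
    continuous_fst.continuousAt.eventually ((shellRegion m).isOpen.mem_nhds hk)
  filter_upwards [hev] with z hz
  exact amplitude_eq_scaledAmplitude hm σ ε hz z.2

/-- A smooth cutoff at the origin of momentum space. -/
def momentumBump : ContDiffBump (0 : EuclideanSpace ℝ (Fin 3)) := ⟨1, 2, one_pos, one_lt_two⟩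

theorem contDiff_momentumBump :
    ContDiff ℝ ∞ fun l : EuclideanSpace ℝ (Fin 3) => ((momentumBump l : ℝ) : ℂ) :=
  Complex.ofRealCLM.contDiff.comp momentumBump.contDiff

theorem momentumBump_eq_one {l : EuclideanSpace ℝ (Fin 3)} (h : ‖l‖ ≤ 1) : momentumBump l = 1 :=
  momentumBump.one_of_mem_closedBall (by simpa [momentumBump] using h)

theorem momentumBump_eq_zero {l : EuclideanSpace ℝ (Fin 3)} (h : 2 ≤ ‖l‖) : momentumBump l = 0 :=
  momentumBump.zero_of_le_dist (by simpa [momentumBump] using h)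

/-- Near `l = 0` the amplitude is only continuous in `l`, but it is a smooth function of `(k, s)` at
the continuous parameter `s = (|l|, l)`; this gives a smooth map into `L^∞`. -/
theorem bump_mul_amplitude_mem (hm : 0 < m) (σ : Matrix (Fin 4) (Fin 4) ℝ) (ε : ℝ) :
    (fun k l => ((momentumBump l : ℝ) : ℂ) * amplitude m σ ε k l) ∈
      smoothLinftySubmodule (shellRegion m) 3 := by
  refine ⟨fun K => ⟨2, fun k _ l hl => by simp [momentumBump_eq_zero hl.le]⟩, ?_⟩
  obtain ⟨A, hA, hA'⟩ := exists_contDiffOn_Linfty (Ω := shellRegion m)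
    (Φ := fun z : EuclideanSpace ℝ (Fin 4) × (ℝ × EuclideanSpace ℝ (Fin 3)) =>
      ((momentumBump z.2.2 : ℝ) : ℂ) * scaledAmplitude m σ ε (z, 1))
    (s := fun l => (‖l‖, l)) (by fun_prop) (fun k hk l => by
      refine ContDiffAt.mul ?_ ?_
      · exact (contDiff_momentumBump.comp (contDiff_snd.comp contDiff_snd)).contDiffAt
      · refine ContDiffAt.comp (g := scaledAmplitude m σ ε) (f := fun z :
          EuclideanSpace ℝ (Fin 4) × (ℝ × EuclideanSpace ℝ (Fin 3)) => (z, (1 : ℝ))) _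
          (contDiffAt_scaledAmplitude hm σ ε hk (Or.inl ?_) (norm_nonneg l)) (by fun_prop)
        rw [one_mul]; exact hm.ne') 2
  refine ⟨A, hA, fun k hk => (hA' k hk).trans (Eventually.of_forall fun l => ?_)⟩
  by_cases hl : l ∈ Metric.closedBall 0 2
  · simp only [indicator_of_mem hl, amplitude_eq_scaledAmplitude hm σ ε hk]
  · rw [indicator_of_notMem hl]
    simp only [Metric.mem_closedBall, dist_zero_right, not_le] at hl
    simp [momentumBump_eq_zero hl.le]

theorem contDiffAt_scaledAmplitude_norm (hm : 0 < m) (σ : Matrix (Fin 4) (Fin 4) ℝ) (ε : ℝ)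
    (hk : k ∈ shellRegion m) {l : EuclideanSpace ℝ (Fin 3)} (hl : l ≠ 0) (u : ℝ) :
    ContDiffAt ℝ ∞ (fun z : (EuclideanSpace ℝ (Fin 4) × EuclideanSpace ℝ (Fin 3)) × ℝ =>
      scaledAmplitude m σ ε ((z.1.1, (‖z.1.2‖, z.1.2)), z.2)) ((k, l), u) := by
  have h1 : ContDiffAt ℝ ∞ (fun z : (EuclideanSpace ℝ (Fin 4) × EuclideanSpace ℝ (Fin 3)) × ℝ
    => z.1.1) ((k, l), u) := by fun_prop
  have h2 : ContDiffAt ℝ ∞ (fun z : (EuclideanSpace ℝ (Fin 4) × EuclideanSpace ℝ (Fin 3)) × ℝ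
    => z.1.2) ((k, l), u) := by fun_prop
  have h3 : ContDiffAt ℝ ∞ (fun z : (EuclideanSpace ℝ (Fin 4) × EuclideanSpace ℝ (Fin 3)) × ℝ
    => z.2) ((k, l), u) := by fun_prop
  exact ContDiffAt.comp (g := scaledAmplitude m σ ε) (f := fun z :
    (EuclideanSpace ℝ (Fin 4) × EuclideanSpace ℝ (Fin 3)) × ℝ =>
      ((z.1.1, (‖z.1.2‖, z.1.2)), z.2)) _
    (contDiffAt_scaledAmplitude hm σ ε hk (Or.inr hl) (norm_nonneg l))
    ((h1.prodMk ((h2.norm ℝ hl).prodMk h2)).prodMk h3)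

/-- For large `l` the rescaled function is exactly `R^(-3)` times a function smooth on a compact
parameter range `0 ≤ u ≤ 1` that includes the massless limit. -/
theorem one_sub_bump_mul_amplitude_mem (hm : 0 < m) (σ : Matrix (Fin 4) (Fin 4) ℝ) (ε : ℝ) :
    (fun k l => (1 - ((momentumBump l : ℝ) : ℂ)) * amplitude m σ ε k l) ∈
      symSubmodule (shellRegion m) 3 (-3) := by
  refine mem_symSubmodule_of_large ?_ 3 fun K N => ?_
  · rintro ⟨k, l⟩ ⟨hk, -⟩
    refine ContDiffAt.contDiffWithinAt ?_
    by_cases hl : l = 0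
    · have h0 : ContDiffAt ℝ ∞
          (fun _ : EuclideanSpace ℝ (Fin 4) × EuclideanSpace ℝ (Fin 3) => (0 : ℂ)) (k, l) :=
        contDiffAt_const
      refine h0.congr_of_eventuallyEq ?_
      have hev : ∀ᶠ z : EuclideanSpace ℝ (Fin 4) × EuclideanSpace ℝ (Fin 3) in 𝓝 (k, l),
          ‖z.2‖ < 1 := continuous_snd.norm.continuousAt.eventually_lt_const (by simp [hl])
      filter_upwards [hev] with z hz
      simp [Function.uncurry, momentumBump_eq_one hz.le]
    · exact ((contDiff_const.sub contDiff_momentumBump).comp contDiff_snd).contDiffAt.mul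
        (contDiffAt_amplitude hm σ ε hk hl)
  · obtain ⟨C, -, hC⟩ := exists_symNorm_bound_of_scaling (t := 3)
      (H := fun z : (EuclideanSpace ℝ (Fin 4) × EuclideanSpace ℝ (Fin 3)) × ℝ =>
        scaledAmplitude m σ ε ((z.1.1, (‖z.1.2‖, z.1.2)), z.2)) K.2.1
      (isCompact_Icc (a := (0 : ℝ)) (b := 1)) (fun k hk l hl _ u _ => by
        exact contDiffAt_scaledAmplitude_norm hm σ ε (K.2.2 hk)
          (norm_pos_iff.1 (by linarith)) u) N
    refine ⟨C, fun k hk l hl => ?_⟩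
    have hp : (1 + ‖l‖)⁻¹ ∈ Icc (0 : ℝ) 1 :=
      ⟨by positivity, inv_le_one_of_one_le₀ (by linarith [norm_nonneg l])⟩
    refine hC (-3) _ k hk l (by linarith) (1 + ‖l‖)⁻¹ hp ?_
    have hR : 0 < 1 + ‖l‖ := by positivity
    have h1 : ∀ᶠ z : EuclideanSpace ℝ (Fin 4) × EuclideanSpace ℝ (Fin 3) in
        𝓝 (k, (1 + ‖l‖)⁻¹ • l), z.1 ∈ shellRegion m :=
      continuous_fst.continuousAt.eventually ((shellRegion m).isOpen.mem_nhds (K.2.2 hk))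
    -- From `|l| ≥ 3` all nearby momenta have norm above `2`, where the bump vanishes identically.
    have h2 : ∀ᶠ z : EuclideanSpace ℝ (Fin 4) × EuclideanSpace ℝ (Fin 3) in
        𝓝 (k, (1 + ‖l‖)⁻¹ • l), 2 < ‖(1 + ‖l‖) • z.2‖ := by
      have hc : Continuous fun z : EuclideanSpace ℝ (Fin 4) × EuclideanSpace ℝ (Fin 3) =>
        ‖(1 + ‖l‖) • z.2‖ := by fun_prop
      refine hc.continuousAt.eventually_const_lt ?_
      change 2 < ‖(1 + ‖l‖) • (1 + ‖l‖)⁻¹ • l‖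
      rw [smul_inv_smul₀ hR.ne']; linarith
    filter_upwards [h1, h2] with z hz1 hz2
    rw [rescale, momentumBump_eq_zero hz2.le, Complex.ofReal_zero, sub_zero, one_mul,
      amplitude_smul hm σ ε hz1 hR]

theorem amplitude_mem_asymptoticSymbolsOfOrder (hm : 0 < m) (σ : Matrix (Fin 4) (Fin 4) ℝ)
    (ε : ℝ) : amplitude m σ ε ∈ asymptoticSymbolsOfOrder (shellRegion m) 3 (-3) := by
  refine Submodule.mem_sup.2 ⟨_, one_sub_bump_mul_amplitude_mem hm σ ε, _,
    bump_mul_amplitude_mem hm σ ε, ?_⟩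
  funext k l
  simp only [Pi.add_apply]
  ring

/-- The integrand of the self-energy as amplitude times phase factor. -/
theorem amplitude_mul_exp (m : ℝ) (σ : Matrix (Fin 4) (Fin 4) ℝ) (ε : ℝ)
    (k : EuclideanSpace ℝ (Fin 4)) (l : EuclideanSpace ℝ (Fin 3)) :
    amplitude m σ ε k l * Complex.exp (Complex.I * (twistPhase σ ε k l : ℂ)) =
      (((2 * Real.pi)⁻¹ * (1 / (2 * energy m ‖l‖)) : ℝ) : ℂ) *
        selfEnergyIntegrand m σ ε k (onShell m l) := by
  have h : ε * twist σ k 0 * (energy m ‖l‖ - ‖l‖) + twistPhase σ ε k l =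
      ε * twistPairing σ k (onShell m l) := by
    rw [twistPhase, twistPairing_eq, twistPairing_eq]
    simp only [minkowski, fourVector_zero, spatialPart_fourVector, onShell_zero,
      spatialPart_onShell]
    ring
  rw [amplitude, selfEnergyIntegrand, mul_assoc, ← Complex.exp_add, ← mul_add,
    ← Complex.ofReal_add, h, retardedPropagator, retardedPropagator]
  push_cast
  ring

end Amplitude

/-! ### The boost-adapted cutoffs -/

section SymbolCriteria

variable {d t : ℕ} {Ω : Opens (EuclideanSpace ℝ (Fin d))}

theorem symWeight_eq_zero_of_eventually {r : ℝ} {α : List (Fin d)} {β : List (Fin t)}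
    {a : EuclideanSpace ℝ (Fin d) → EuclideanSpace ℝ (Fin t) → ℂ}
    {k : EuclideanSpace ℝ (Fin d)} {l : EuclideanSpace ℝ (Fin t)}
    (h : ∀ᶠ z in 𝓝 (k, l), Function.uncurry a z = 0) : symWeight r α β a k l = 0 := by
  have h1 : Function.uncurry a =ᶠ[𝓝 (k, l)] (fun _ => (0 : ℂ)) := h
  rw [symWeight, mixedPartial, (h1.iteratedFDeriv ℝ _).self_of_nhds]
  simp

/-- Vanishing near a point makes all derivatives vanish there, and the remaining region is compact.
-/
theorem mem_symSubmodule_of_eventually_zero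
    {a : EuclideanSpace ℝ (Fin d) → EuclideanSpace ℝ (Fin t) → ℂ} (ha : SmoothOnProd Ω a) (r : ℝ)
    (h : ∀ K : CompactsIn Ω, ∃ R, ∀ k ∈ K.1, ∀ l, R ≤ ‖l‖ →
      ∀ᶠ z in 𝓝 (k, l), Function.uncurry a z = 0) : a ∈ symSubmodule Ω t r := by
  refine ⟨ha, fun K α β => ?_⟩
  obtain ⟨R, hR⟩ := h K
  obtain ⟨C, hC⟩ := exists_symWeight_bound_of_norm_le (r := r) ha K α β R
  refine ⟨max C 0, ?_⟩
  rintro _ ⟨z, rfl⟩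
  rcases le_total R ‖z.2‖ with hz | hz
  · exact (symWeight_eq_zero_of_eventually (hR _ z.1.2 _ hz)).le.trans (le_max_right _ _)
  · exact (hC _ z.1.2 _ hz).trans (le_max_left _ _)

theorem const_mem_symSubmodule (c : ℂ) {r : ℝ} (hr : 0 ≤ r) :
    (fun _ _ => c : EuclideanSpace ℝ (Fin d) → EuclideanSpace ℝ (Fin t) → ℂ) ∈
      symSubmodule Ω t r := by
  refine ⟨contDiffOn_const, fun K α β => ⟨‖c‖, ?_⟩⟩
  rintro _ ⟨z, rfl⟩
  have hu : Function.uncurry (fun _ _ => c : EuclideanSpace ℝ (Fin d) →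
    EuclideanSpace ℝ (Fin t) → ℂ) = fun _ => c := rfl
  simp only [symWeight, mixedPartial, hu]
  by_cases h0 : α.length + β.length = 0
  · have h1 : (1 + ‖z.2‖) ^ ((β.length : ℝ) - r) ≤ 1 := by
      have hβ : β.length = 0 := by omega
      have h2 : (β.length : ℝ) - r ≤ 0 := by rw [hβ, Nat.cast_zero]; linarith
      exact Real.rpow_le_one_of_one_le_of_nonpos (by linarith [norm_nonneg z.2]) h2
    have h2 : ∀ (j : ℕ) (_ : j = 0) (v : Fin j → _), iteratedFDeriv ℝ j
        (fun _ : EuclideanSpace ℝ (Fin d) × EuclideanSpace ℝ (Fin t) => c) (z.1.1, z.2) v = c := by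
      rintro j rfl v; rw [iteratedFDeriv_zero_apply]
    rw [h2 _ h0]
    exact mul_le_of_le_one_left (norm_nonneg c) h1
  · rw [iteratedFDeriv_const_of_ne h0]
    simp

/-- The additional factor `(1 + |l|)⁻¹` is what turns boundedness of order `0` into convergence of
order `1`. -/
theorem symWeight_one_eq (α : List (Fin d)) (β : List (Fin t))
    (a : EuclideanSpace ℝ (Fin d) → EuclideanSpace ℝ (Fin t) → ℂ)
    (k : EuclideanSpace ℝ (Fin d)) (l : EuclideanSpace ℝ (Fin t)) :
    symWeight 1 α β a k l = (1 + ‖l‖)⁻¹ * symWeight 0 α β a k l := by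
  have h : (0 : ℝ) < 1 + ‖l‖ := by positivity
  rw [symWeight, symWeight, ← mul_assoc, ← Real.rpow_neg_one, ← Real.rpow_add h]
  congr 2
  ring

end SymbolCriteria

/-! ### The cutoffs as symbols, with bounds uniform in `n`. -/

section BoostCutoff

variable {m : ℝ} {k : EuclideanSpace ℝ (Fin 4)} {g : ℝ → ℂ}

/-- The square of the spatial momentum, in the rest frame of `k`, of the vector with spatial part
`l` on the mass shell `m`. -/
def restNormSq (m : ℝ) (k : EuclideanSpace ℝ (Fin 4)) (l : EuclideanSpace ℝ (Fin 3)) : ℝ :=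
  minkowski k (onShell m l) ^ 2 / minkowskiSq k - m ^ 2

theorem boostCutoffOnShell_eq (hm : 0 < m) (hk : k ∈ shellRegion m) (g : ℝ → ℂ) (n : ℕ)
    (l : EuclideanSpace ℝ (Fin 3)) :
    boostCutoffOnShell m g n k l = g (restNormSq m k l / n ^ 2) := by
  rw [boostCutoffOnShell, boostCutoff, div_pow, ← restMomentum, norm_restMomentum_sq hm hk,
    restNormSq]

theorem restNormSq_nonneg (hm : 0 < m) (hk : k ∈ shellRegion m) (l : EuclideanSpace ℝ (Fin 3)) :
    0 ≤ restNormSq m k l := by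
  rw [restNormSq, ← norm_restMomentum_sq hm hk]; positivity

theorem restNormSq_smul {R : ℝ} (hR : 0 < R) (m : ℝ) (k : EuclideanSpace ℝ (Fin 4))
    (l : EuclideanSpace ℝ (Fin 3)) :
    restNormSq m k (R • l) = R ^ 2 * restNormSq (R⁻¹ * m) k l := by
  rw [restNormSq, restNormSq, onShell_smul hR, minkowski_smul]
  field_simp

theorem contDiffAt_restNormSq (hm : 0 < m) (hk : k ∈ shellRegion m) {u : ℝ}
    {l : EuclideanSpace ℝ (Fin 3)} (h : u * m ≠ 0 ∨ l ≠ 0) :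
    ContDiffAt ℝ ∞ (fun z : EuclideanSpace ℝ (Fin 4) × (ℝ × EuclideanSpace ℝ (Fin 3)) =>
      restNormSq (z.2.1 * m) z.1 z.2.2) (k, (u, l)) := by
  unfold restNormSq
  have h1 : ContDiffAt ℝ ∞ (fun z : EuclideanSpace ℝ (Fin 4) × (ℝ × EuclideanSpace ℝ (Fin 3)) =>
      minkowskiSq z.1) (k, (u, l)) := (contDiff_minkowskiSq.comp contDiff_fst).contDiffAt
  exact (((contDiffAt_minkowski_onShell k h).pow 2).div h1 (minkowskiSq_pos hm hk).ne').sub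
    (by fun_prop)

theorem contDiffAt_restNormSq_mass (hm : 0 < m) (hk : k ∈ shellRegion m) {u : ℝ}
    {l : EuclideanSpace ℝ (Fin 3)} (h : u * m ≠ 0 ∨ l ≠ 0) :
    ContDiffAt ℝ ∞ (fun z : EuclideanSpace ℝ (Fin 4) × EuclideanSpace ℝ (Fin 3) =>
      restNormSq (u * m) z.1 z.2) (k, l) :=
  ContDiffAt.comp (k, l)
    (g := fun z : EuclideanSpace ℝ (Fin 4) × (ℝ × EuclideanSpace ℝ (Fin 3)) =>
      restNormSq (z.2.1 * m) z.1 z.2.2)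
    (f := fun z : EuclideanSpace ℝ (Fin 4) × EuclideanSpace ℝ (Fin 3) => (z.1, (u, z.2)))
    (contDiffAt_restNormSq hm hk h) (by fun_prop)

theorem contDiffAt_restNormSq_one (hm : 0 < m) (hk : k ∈ shellRegion m)
    (l : EuclideanSpace ℝ (Fin 3)) :
    ContDiffAt ℝ ∞ (fun z : EuclideanSpace ℝ (Fin 4) × EuclideanSpace ℝ (Fin 3) =>
      restNormSq m z.1 z.2) (k, l) := by
  simpa using contDiffAt_restNormSq_mass hm hk (u := 1) (l := l) (Or.inl (by simpa using hm.ne'))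

theorem continuous_spatialPart : Continuous spatialPart := by
  unfold spatialPart; fun_prop

/-- Over a compact set of timelike `k` the ratios `(|k₀| ± |𝐤|)²/k²` are bounded above and away from
zero, so momenta in the rest frame are comparable with `|l|`, uniformly in `k`. -/
theorem exists_restNormSq_bounds (hm : 0 < m) (K : CompactsIn (shellRegion m)) :
    ∃ c D : ℝ, 0 < c ∧ 0 ≤ D ∧ ∀ k ∈ K.1, ∀ l : EuclideanSpace ℝ (Fin 3),
      c * ‖l‖ ^ 2 - m ^ 2 ≤ restNormSq m k l ∧ restNormSq m k l ≤ D * (‖l‖ ^ 2 + m ^ 2) := by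
  have hcS : Continuous fun k : EuclideanSpace ℝ (Fin 4) => ‖spatialPart k‖ :=
    continuous_spatialPart.norm
  have hcT : Continuous fun k : EuclideanSpace ℝ (Fin 4) => |k 0| := by fun_prop
  have hne : ∀ k ∈ K.1, minkowskiSq k ≠ 0 := fun k hk => (minkowskiSq_pos hm (K.2.2 hk)).ne'
  obtain ⟨D, hD⟩ := K.2.1.exists_bound_of_continuousOn
    (f := fun k => (|k 0| + ‖spatialPart k‖) ^ 2 / minkowskiSq k)
    (((hcT.add hcS).pow 2).continuousOn.div contDiff_minkowskiSq.continuous.continuousOn hne)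
  have hmin : ∃ c : ℝ, 0 < c ∧ ∀ k ∈ K.1, c ≤ (|k 0| - ‖spatialPart k‖) ^ 2 / minkowskiSq k := by
    rcases K.1.eq_empty_or_nonempty with h | h
    · exact ⟨1, one_pos, fun k hk => by simp [h] at hk⟩
    · obtain ⟨k₀, hk₀, hk⟩ := K.2.1.exists_isMinOn h
        (f := fun k => (|k 0| - ‖spatialPart k‖) ^ 2 / minkowskiSq k)
        (((hcT.sub hcS).pow 2).continuousOn.div contDiff_minkowskiSq.continuous.continuousOn hne)
      refine ⟨_, ?_, fun k hk' => hk hk'⟩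
      have h1 := norm_spatialPart_lt hm (K.2.2 hk₀)
      have h2 := minkowskiSq_pos hm (K.2.2 hk₀)
      have h3 := sub_pos.2 h1
      positivity
  obtain ⟨c, hc, hcK⟩ := hmin
  refine ⟨c, max D 0, hc, le_max_right _ _, fun k hk l => ?_⟩
  have hk0 := minkowskiSq_pos hm (K.2.2 hk)
  have h1 := (norm_spatialPart_lt hm (K.2.2 hk)).le
  have hE := energy_nonneg m ‖l‖
  have hlo := le_abs_minkowski_onShell k (energy m ‖l‖) l (lt_energy hm ‖l‖).le
  have hup : |minkowski k (onShell m l)| ≤ (|k 0| + ‖spatialPart k‖) * energy m ‖l‖ := by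
    rw [minkowski, onShell_zero, spatialPart_onShell]
    refine (abs_sub _ _).trans ?_
    rw [abs_mul, abs_of_nonneg hE, add_mul]
    gcongr
    exact (abs_real_inner_le_norm _ _).trans (by gcongr; exact (lt_energy hm ‖l‖).le)
  constructor
  · rw [restNormSq, ← sq_abs (minkowski _ _)]
    have h2 : c * ‖l‖ ^ 2 ≤ (|k 0| - ‖spatialPart k‖) ^ 2 / minkowskiSq k * energy m ‖l‖ ^ 2 := by
      rw [energy_sq]
      exact mul_le_mul (hcK k hk) (by nlinarith) (by positivity) (hc.le.trans (hcK k hk))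
    refine sub_le_sub_right (h2.trans ?_) _
    rw [div_mul_eq_mul_div, ← mul_pow]
    exact div_le_div_of_nonneg_right
      (pow_le_pow_left₀ (mul_nonneg (sub_nonneg.2 h1) hE) hlo 2) hk0.le
  · rw [restNormSq, ← sq_abs (minkowski _ _)]
    have h2 : |minkowski k (onShell m l)| ^ 2 / minkowskiSq k ≤
        (|k 0| + ‖spatialPart k‖) ^ 2 / minkowskiSq k * energy m ‖l‖ ^ 2 := by
      rw [div_mul_eq_mul_div, ← mul_pow]
      gcongr
    have h3 : (|k 0| + ‖spatialPart k‖) ^ 2 / minkowskiSq k ≤ max D 0 :=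
      ((le_abs_self _).trans (hD k hk)).trans (le_max_left _ _)
    rw [energy_sq] at h2
    have h4 := h2.trans (mul_le_mul_of_nonneg_right h3 (by positivity))
    linarith [sq_nonneg m]

theorem eventually_mem_shellRegion (hk : k ∈ shellRegion m) {F : Type*} [TopologicalSpace F]
    (l : F) : ∀ᶠ z in 𝓝 (k, l), z.1 ∈ shellRegion m :=
  continuous_fst.continuousAt.eventually ((shellRegion m).isOpen.mem_nhds hk)

theorem smoothOnProd_boostCutoffOnShell (hm : 0 < m) (hg : ContDiff ℝ ∞ g) (n : ℕ) :
    SmoothOnProd (shellRegion m) (boostCutoffOnShell m g n) := by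
  rintro ⟨k, l⟩ ⟨hk, -⟩
  refine ContDiffAt.contDiffWithinAt ?_
  have h1 : ContDiffAt ℝ ∞ (fun z : EuclideanSpace ℝ (Fin 4) × EuclideanSpace ℝ (Fin 3) =>
      g (restNormSq m z.1 z.2 / n ^ 2)) (k, l) :=
    hg.contDiffAt.comp _ ((contDiffAt_restNormSq_one hm hk l).div_const _)
  refine h1.congr_of_eventuallyEq ?_
  filter_upwards [eventually_mem_shellRegion hk l] with z hz
  exact boostCutoffOnShell_eq hm hz g n z.2

theorem eventually_boostCutoffOnShell_eq_zero (hm : 0 < m) (hg2 : ∀ x, 2 ≤ |x| → g x = 0)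
    {n : ℕ} (hn : 0 < n) (hk : k ∈ shellRegion m) {l : EuclideanSpace ℝ (Fin 3)}
    (h : 2 * (n : ℝ) ^ 2 < restNormSq m k l) :
    ∀ᶠ z in 𝓝 (k, l), Function.uncurry (boostCutoffOnShell m g n) z = 0 := by
  have hc := (contDiffAt_restNormSq_one hm hk l).continuousAt
  filter_upwards [eventually_mem_shellRegion hk l, hc.eventually_const_lt h] with z hz1 hz2
  refine (boostCutoffOnShell_eq hm hz1 g n z.2).trans (hg2 _ ?_)
  rw [abs_of_nonneg (div_nonneg (restNormSq_nonneg hm hz1 _) (by positivity)),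
    le_div_iff₀ (by positivity)]
  exact hz2.le

theorem eventually_boostCutoffOnShell_eq_one (hm : 0 < m) (hg1 : ∀ x, |x| ≤ 1 → g x = 1)
    {n : ℕ} (hn : 0 < n) (hk : k ∈ shellRegion m) {l : EuclideanSpace ℝ (Fin 3)}
    (h : restNormSq m k l < (n : ℝ) ^ 2) :
    ∀ᶠ z in 𝓝 (k, l), Function.uncurry (boostCutoffOnShell m g n) z = 1 := by
  have hc := (contDiffAt_restNormSq_one hm hk l).continuousAt
  filter_upwards [eventually_mem_shellRegion hk l, hc.eventually_lt_const h] with z hz1 hz2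
  refine (boostCutoffOnShell_eq hm hz1 g n z.2).trans (hg1 _ ?_)
  rw [abs_of_nonneg (div_nonneg (restNormSq_nonneg hm hz1 _) (by positivity)),
    div_le_one (by positivity)]
  exact hz2.le

theorem boostCutoffOnShell_eventually_zero_of_large (hm : 0 < m) (hg2 : ∀ x, 2 ≤ |x| → g x = 0)
    {n : ℕ} (hn : 0 < n) (K : CompactsIn (shellRegion m)) :
    ∃ R, ∀ k ∈ K.1, ∀ l, R ≤ ‖l‖ →
      ∀ᶠ z in 𝓝 (k, l), Function.uncurry (boostCutoffOnShell m g n) z = 0 := by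
  obtain ⟨c, D, hc, -, hK⟩ := exists_restNormSq_bounds hm K
  refine ⟨(2 * (n : ℝ) ^ 2 + m ^ 2) / c + 1, fun k hk l hl =>
    eventually_boostCutoffOnShell_eq_zero hm hg2 hn (K.2.2 hk) ?_⟩
  have h1 : 1 ≤ ‖l‖ := le_trans (by linarith [show 0 ≤ (2 * (n : ℝ) ^ 2 + m ^ 2) / c by positivity]) hl
  have h2 : (2 * (n : ℝ) ^ 2 + m ^ 2) / c < ‖l‖ ^ 2 := by nlinarith
  rw [div_lt_iff₀ hc] at h2
  linarith [(hK k hk l).1]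

theorem hasCompactSupportInL_boostCutoffOnShell (hm : 0 < m) (hg2 : ∀ x, 2 ≤ |x| → g x = 0)
    {n : ℕ} (hn : 0 < n) :
    HasCompactSupportInL (shellRegion m) (boostCutoffOnShell m g n) := by
  intro K
  obtain ⟨R, hR⟩ := boostCutoffOnShell_eventually_zero_of_large hm hg2 hn K
  exact ⟨R, fun k hk l hl => (hR k hk l hl.le).self_of_nhds⟩

theorem boostCutoffOnShell_mem_symSubmodule (hm : 0 < m) (hg : ContDiff ℝ ∞ g)
    (hg1 : ∀ x, |x| ≤ 1 → g x = 1) (hg2 : ∀ x, 2 ≤ |x| → g x = 0) (n : ℕ) {r : ℝ} (hr : 0 ≤ r) :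
    boostCutoffOnShell m g n ∈ symSubmodule (shellRegion m) 3 r := by
  -- For `n = 0` the quotient by `n` is `0` by convention, and `g 0 = 1` makes the cutoff constant.
  rcases n.eq_zero_or_pos with rfl | hn
  · have : boostCutoffOnShell m g 0 = fun _ _ => 1 := by
      funext k l
      simp [boostCutoffOnShell, boostCutoff, hg1]
    rw [this]
    exact const_mem_symSubmodule 1 hr
  · exact mem_symSubmodule_of_eventually_zero (smoothOnProd_boostCutoffOnShell hm hg n) r
      (boostCutoffOnShell_eventually_zero_of_large hm hg2 hn)

/-- Symbol bounds of order `0`, uniformly in `n`. -/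
theorem exists_symNorm_boostCutoff_bound (hm : 0 < m) (hg : ContDiff ℝ ∞ g)
    (hg2 : ∀ x, 2 ≤ |x| → g x = 0) (K : CompactsIn (shellRegion m)) (N : ℕ) :
    ∃ C ρ : ℝ, 0 ≤ C ∧ ∀ n : ℕ, 0 < n → ∀ k ∈ K.1, ∀ l, ρ ≤ ‖l‖ →
      symNorm 0 N (boostCutoffOnShell m g n - fun _ _ => 1) k l ≤ C := by
  obtain ⟨c, D, hc, -, hK⟩ := exists_restNormSq_bounds hm K
  -- Chosen so that `W² c/8 > 2`: below, `c/8` is a lower bound for the rescaled square of the rest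
  -- momentum, so the cutoff vanishes once `R/n ≥ W`.
  set W : ℝ := 16 / c + 1 with hW
  have hW0 : 0 < W := by positivity
  have hW2 : 16 / c < W ^ 2 := by
    have : 0 < 16 / c := by positivity
    nlinarith
  rw [div_lt_iff₀ hc] at hW2
  obtain ⟨C, hC0, hC⟩ := exists_symNorm_bound_of_scaling (t := 3)
    (H := fun z : (EuclideanSpace ℝ (Fin 4) × EuclideanSpace ℝ (Fin 3)) × (ℝ × ℝ) =>
      g (z.2.2 ^ 2 * restNormSq (z.2.1 * m) z.1.1 z.1.2) - 1) K.2.1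
    ((isCompact_Icc (a := (0 : ℝ)) (b := 1)).prod (isCompact_Icc (a := (0 : ℝ)) (b := W)))
    (fun k hk l hl _ p _ => by
      have hl0 : l ≠ 0 := norm_pos_iff.1 (by linarith)
      have h1 : ContDiffAt ℝ ∞
          (fun z : (EuclideanSpace ℝ (Fin 4) × EuclideanSpace ℝ (Fin 3)) × (ℝ × ℝ) =>
          restNormSq (z.2.1 * m) z.1.1 z.1.2) ((k, l), p) :=
        ContDiffAt.comp (g := fun z : EuclideanSpace ℝ (Fin 4) ×
            (ℝ × EuclideanSpace ℝ (Fin 3)) => restNormSq (z.2.1 * m) z.1 z.2.2)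
          (f := fun z : (EuclideanSpace ℝ (Fin 4) × EuclideanSpace ℝ (Fin 3)) × (ℝ × ℝ) =>
            (z.1.1, (z.2.1, z.1.2))) _
          (contDiffAt_restNormSq hm (K.2.2 hk) (Or.inr hl0)) (by fun_prop)
      have h2 : ContDiffAt ℝ ∞
          (fun z : (EuclideanSpace ℝ (Fin 4) × EuclideanSpace ℝ (Fin 3)) × (ℝ × ℝ) =>
          z.2.2 ^ 2) ((k, l), p) := by fun_prop
      exact (hg.contDiffAt.comp _ (h2.mul h1)).sub contDiffAt_const) N
  -- Beyond this radius `c|l|² - m² ≥ c|l|²/2 ≥ c R²/8`, with `R = 1 + |l| ≤ 2|l|`.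
  refine ⟨C, max 1 (2 * m ^ 2 / c), hC0, fun n hn k hk l hl => ?_⟩
  have hl1 : 1 ≤ ‖l‖ := (le_max_left _ _).trans hl
  have hl2 : 2 * m ^ 2 / c ≤ ‖l‖ := (le_max_right _ _).trans hl
  have hR : 0 < 1 + ‖l‖ := by positivity
  have hn' : (0 : ℝ) < n := by exact_mod_cast hn
  obtain ⟨R, hRdef⟩ : ∃ R, R = 1 + ‖l‖ := ⟨_, rfl⟩
  rw [← hRdef] at hR
  -- The true parameter `R/n` is unbounded; replacing it by its minimum with `W` confines it to a
  -- compact interval without changing the function near the point.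
  have hp : (R⁻¹, min (R / n) W) ∈ Icc (0 : ℝ) 1 ×ˢ Icc (0 : ℝ) W :=
    ⟨⟨by positivity, inv_le_one_of_one_le₀ (by linarith)⟩,
      ⟨le_min (by positivity) hW0.le, min_le_right _ _⟩⟩
  refine hC 0 _ k hk l hl1 (R⁻¹, min (R / n) W) hp ?_
  rw [← hRdef]
  have hpos : 2 < W ^ 2 * restNormSq (R⁻¹ * m) k (R⁻¹ • l) := by
    have h1 := (hK k hk l).1
    have h2 := restNormSq_smul hR m k (R⁻¹ • l)
    rw [smul_inv_smul₀ hR.ne'] at h2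
    rw [div_le_iff₀ hc] at hl2
    have h3 : c / 8 * R ^ 2 ≤ R ^ 2 * restNormSq (R⁻¹ * m) k (R⁻¹ • l) := by
      rw [← h2]
      have h4 : 2 * m ^ 2 ≤ c * ‖l‖ ^ 2 := by nlinarith
      have h5 : R ^ 2 ≤ 4 * ‖l‖ ^ 2 := by rw [hRdef]; nlinarith
      nlinarith
    have h4 : c / 8 ≤ restNormSq (R⁻¹ * m) k (R⁻¹ • l) := by
      rw [mul_comm] at h3
      exact le_of_mul_le_mul_left h3 (by positivity)
    calc (2 : ℝ) = 16 / 8 := by norm_num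
      _ < W ^ 2 * c / 8 := by linarith
      _ = W ^ 2 * (c / 8) := by ring
      _ ≤ _ := by gcongr
  have hcont : ContinuousAt (fun z : EuclideanSpace ℝ (Fin 4) × EuclideanSpace ℝ (Fin 3) =>
      W ^ 2 * restNormSq (R⁻¹ * m) z.1 z.2) (k, R⁻¹ • l) :=
    continuousAt_const.mul (contDiffAt_restNormSq_mass (l := R⁻¹ • l) hm (K.2.2 hk)
      (Or.inl (by positivity))).continuousAt
  filter_upwards [eventually_mem_shellRegion (K.2.2 hk) (R⁻¹ • l),
    hcont.eventually_const_lt hpos] with z hz1 hz2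
  have h0 : rescale R (boostCutoffOnShell m g n - fun _ _ => 1) z =
      g ((R / n) ^ 2 * restNormSq (R⁻¹ * m) z.1 z.2) - 1 := by
    rw [rescale, Pi.sub_apply, Pi.sub_apply, boostCutoffOnShell_eq hm hz1, restNormSq_smul hR]
    congr 2
    ring
  rw [h0, Real.rpow_zero, one_smul]
  -- If `R/n ≥ W`, the arguments of `g` for both parameters exceed `2`, and both values are `0`.
  rcases le_total (R / n) W with h | h
  · rw [min_eq_left h]
  · have hnn : 0 ≤ restNormSq (R⁻¹ * m) z.1 z.2 :=
      (pos_of_mul_pos_right (lt_trans two_pos hz2) (by positivity)).le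
    rw [min_eq_right h, hg2 (W ^ 2 * _) (hz2.le.trans (le_abs_self _)), hg2 _ ?_]
    refine (hz2.le.trans ?_).trans (le_abs_self _)
    gcongr

/-- The boost-adapted cutoffs as symbols of order `1`. -/
def boostCutoffSymbol (hm : 0 < m) (hg : ContDiff ℝ ∞ g) (hg1 : ∀ x, |x| ≤ 1 → g x = 1)
    (hg2 : ∀ x, 2 ≤ |x| → g x = 0) (n : ℕ) : SymbolSpace (shellRegion m) 3 1 :=
  ⟨boostCutoffOnShell m g n, boostCutoffOnShell_mem_symSubmodule hm hg hg1 hg2 n zero_le_one⟩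

/-- The constant `1` as a symbol of order `1`. -/
def oneSymbol (m : ℝ) : SymbolSpace (shellRegion m) 3 1 :=
  ⟨fun _ _ => 1, const_mem_symSubmodule 1 zero_le_one⟩

theorem eventually_forall_restNormSq_lt (hm : 0 < m) (K : CompactsIn (shellRegion m)) (R : ℝ) :
    ∀ᶠ n : ℕ in atTop, 0 < n ∧ ∀ k ∈ K.1, ∀ l, ‖l‖ ≤ R → restNormSq m k l < (n : ℝ) ^ 2 := by
  obtain ⟨c, D, -, hD, hK⟩ := exists_restNormSq_bounds hm K
  have h1 : ∀ᶠ n : ℕ in atTop, D * (R ^ 2 + m ^ 2) < (n : ℝ) ^ 2 :=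
    ((tendsto_pow_atTop two_ne_zero).comp tendsto_natCast_atTop_atTop).eventually_gt_atTop _
  filter_upwards [h1, eventually_gt_atTop 0] with n hn hn0
  refine ⟨hn0, fun k hk l hl => ((hK k hk l).2.trans ?_).trans_lt hn⟩
  gcongr

/-- Inside a large ball the difference from `1` vanishes for large `n`; outside, the uniform bound
of order `0` is divided by `1 + |l|`. -/
theorem tendsto_boostCutoffSymbol (hm : 0 < m) (hg : ContDiff ℝ ∞ g)
    (hg1 : ∀ x, |x| ≤ 1 → g x = 1) (hg2 : ∀ x, 2 ≤ |x| → g x = 0) :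
    Tendsto (boostCutoffSymbol hm hg hg1 hg2) atTop (𝓝 (oneSymbol m)) := by
  rw [tendsto_symbolSpace_iff]
  rintro ⟨K, α, β⟩
  obtain ⟨C, ρ, hC0, hC⟩ := exists_symNorm_boostCutoff_bound hm hg hg2 K (α.length + β.length)
  rw [Metric.tendsto_nhds]
  intro e he
  -- The radius `2C/e` makes `C/(1 + |l|) ≤ e/2` outside the ball.
  filter_upwards [eventually_forall_restNormSq_lt hm K (max ρ (2 * C / e))] with n ⟨hn0, hn⟩
  rw [Real.dist_0_eq_abs, abs_of_nonneg (apply_nonneg _ _)]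
  refine lt_of_le_of_lt (symSeminorm_le _ K α β (half_pos he).le fun k hk l => ?_) (half_lt_self he)
  change symWeight 1 α β (boostCutoffOnShell m g n - fun _ _ => 1) k l ≤ e / 2
  rcases le_total ‖l‖ (max ρ (2 * C / e)) with hl | hl
  · rw [symWeight_eq_zero_of_eventually]
    · exact (half_pos he).le
    · filter_upwards [eventually_boostCutoffOnShell_eq_one hm hg1 hn0 (K.2.2 hk)
        (hn k hk l hl)] with z hz
      change Function.uncurry (boostCutoffOnShell m g n) z - 1 = 0
      rw [hz, sub_self]
  · rw [symWeight_one_eq, inv_mul_le_iff₀ (by positivity)]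
    refine ((symWeight_le_symNorm _ _ _ _ _ _).trans
      (hC n hn0 k hk l ((le_max_left _ _).trans hl))).trans ?_
    have h1 := (le_max_right _ _).trans hl
    rw [div_le_iff₀ he] at h1
    nlinarith

theorem isCutoffSequence_boostCutoffSymbol (hm : 0 < m) (hg : ContDiff ℝ ∞ g)
    (hg1 : ∀ x, |x| ≤ 1 → g x = 1) (hg2 : ∀ x, 2 ≤ |x| → g x = 0) :
    IsCutoffSequence (shellRegion m) 3 (boostCutoffSymbol hm hg hg1 hg2) (oneSymbol m) where
  one_eq := rfl
  tendsto := tendsto_boostCutoffSymbol hm hg hg1 hg2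
  compactSupport := by
    filter_upwards [eventually_gt_atTop 0] with n hn
    exact hasCompactSupportInL_boostCutoffOnShell hm hg2 hn
  eventually_eq_one := fun K R => by
    filter_upwards [eventually_forall_restNormSq_lt hm K R] with n ⟨hn0, hn⟩ k hk l hl
    exact (eventually_boostCutoffOnShell_eq_one hm hg1 hn0 (K.2.2 hk) (hn k hk l hl)).self_of_nhds

/-- There is a smooth cutoff function on the line. -/
theorem exists_lineCutoff : ∃ g : ℝ → ℂ, ContDiff ℝ ∞ g ∧ (∀ x, |x| ≤ 1 → g x = 1) ∧
    ∀ x, 2 ≤ |x| → g x = 0 := by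
  let b : ContDiffBump (0 : ℝ) := ⟨1, 2, one_pos, one_lt_two⟩
  refine ⟨fun x => ((b x : ℝ) : ℂ), Complex.ofRealCLM.contDiff.comp b.contDiff, fun x hx => ?_,
    fun x hx => ?_⟩
  · simp [b.one_of_mem_closedBall (x := x) (by simpa [b] using hx)]
  · simp [b.zero_of_le_dist (x := x) (by simpa [b] using hx)]

end BoostCutoff

/-! ### The radial integral -/

section Radial

variable {m : ℝ} {k : EuclideanSpace ℝ (Fin 4)} {σ : Matrix (Fin 4) (Fin 4) ℝ}

/-- Uses `|sin| ≤ 1`, `x ≤ ω` and `|k² - 4ω²| ≥ x² + m²`; the powers of `x` then cancel. Convergence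
is thus absolute at the price of a factor `1/L`. -/
theorem abs_radialIntegrand_le (hm : 0 < m) (hk : k ∈ shellRegion m)
    (hl : 0 < twistLength σ k) {x : ℝ} (hx : 0 < x) :
    |radialIntegrand m σ k x| ≤ (twistLength σ k)⁻¹ * (x ^ 2 + m ^ 2)⁻¹ := by
  have hE := energy_pos hm x
  have hxE := (lt_energy hm x).le
  have hD := rest_denominator_neg hm hk x
  have hD' := rest_denominator_lt hm hk x
  set L := twistLength σ k
  have h0 : 0 < x ^ 2 + m ^ 2 := by positivity
  rw [radialIntegrand, abs_mul, abs_div, abs_div, abs_mul, abs_of_pos hE,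
    abs_of_pos (show 0 < x ^ 2 by positivity), abs_of_neg hD', abs_of_pos (mul_pos hx hl)]
  have h1 : x ^ 2 + m ^ 2 ≤ -(minkowskiSq k - 4 * energy m x ^ 2) := by linarith
  calc x ^ 2 / (energy m x * -(minkowskiSq k - 4 * energy m x ^ 2)) *
        (|Real.sin (x * L)| / (x * L))
      ≤ x ^ 2 / (x * (x ^ 2 + m ^ 2)) * (1 / (x * L)) := by
        gcongr
        exact Real.abs_sin_le_one _
    _ = _ := by field_simp

theorem measurable_radialIntegrand (m : ℝ) (σ : Matrix (Fin 4) (Fin 4) ℝ)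
    (k : EuclideanSpace ℝ (Fin 4)) : Measurable (radialIntegrand m σ k) := by
  have : Measurable fun x => energy m x := by unfold energy; fun_prop
  unfold radialIntegrand
  fun_prop

theorem integrable_inv_sq_add_sq (hm : 0 < m) :
    Integrable fun x : ℝ => (x ^ 2 + m ^ 2)⁻¹ := by
  refine (integrable_inv_one_add_sq.const_mul (1 + (m ^ 2)⁻¹)).mono' (by fun_prop)
    (Eventually.of_forall fun x => ?_)
  rw [Real.norm_of_nonneg (by positivity), inv_le_iff_one_le_mul₀ (by positivity),
    mul_assoc, ← div_eq_inv_mul, mul_div_assoc', le_div_iff₀ (by positivity)]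
  have h1 : (m ^ 2)⁻¹ * m ^ 2 = 1 := inv_mul_cancel₀ (by positivity)
  have h2 : 0 ≤ (m ^ 2)⁻¹ * x ^ 2 := by positivity
  nlinarith [sq_nonneg x, sq_nonneg m]

theorem integrableOn_radialIntegrand (hm : 0 < m) (hk : k ∈ shellRegion m)
    (hl : 0 < twistLength σ k) : IntegrableOn (radialIntegrand m σ k) (Ioi 0) := by
  refine Integrable.mono' ((integrable_inv_sq_add_sq hm).const_mul (twistLength σ k)⁻¹).integrableOn
    (measurable_radialIntegrand m σ k).aestronglyMeasurable ?_
  filter_upwards [ae_restrict_mem measurableSet_Ioi] with x hx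
  exact abs_radialIntegrand_le hm hk hl hx

/-- The compactified variable `u = 1/(1 + t²)`. -/
def compactVariable (t : ℝ) : Icc (0 : ℝ) 1 :=
  ⟨(1 + t ^ 2)⁻¹, by positivity, inv_le_one_of_one_le₀ (by nlinarith [sq_nonneg t])⟩

theorem continuous_compactVariable : Continuous compactVariable := by
  unfold compactVariable
  exact Continuous.subtype_mk (Continuous.inv₀ (by fun_prop) fun t => by positivity) _

/-- The oscillating weight `t sin t / (1 + t²)^(3/2)`. -/
def oscillatingWeight (t : ℝ) : ℝ := Real.sin t * (t / √(1 + t ^ 2)) * (1 + t ^ 2)⁻¹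

theorem continuous_oscillatingWeight : Continuous oscillatingWeight := by
  unfold oscillatingWeight
  refine (Real.continuous_sin.mul (continuous_id.div (by fun_prop) fun t => ?_)).mul
    (Continuous.inv₀ (by fun_prop) fun t => by positivity)
  exact (Real.sqrt_pos.2 (by positivity)).ne'

theorem abs_oscillatingWeight_le (t : ℝ) : |oscillatingWeight t| ≤ (1 + t ^ 2)⁻¹ := by
  have h1 : |t / √(1 + t ^ 2)| ≤ 1 := by
    rw [abs_div, abs_of_nonneg (Real.sqrt_nonneg _), div_le_one (Real.sqrt_pos.2 (by positivity))]
    exact Real.abs_le_sqrt (by linarith)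
  rw [oscillatingWeight, abs_mul, abs_mul, abs_of_pos (show 0 < (1 + t ^ 2)⁻¹ by positivity)]
  refine mul_le_of_le_one_left (by positivity) ?_
  exact mul_le_one₀ (Real.abs_sin_le_one t) (abs_nonneg _) h1

theorem integrable_oscillatingWeight_mul (g : C(Icc (0 : ℝ) 1, ℝ)) :
    Integrable fun t => oscillatingWeight t * g (compactVariable t) := by
  have hc : Continuous fun t => g (compactVariable t) :=
    g.continuous.comp continuous_compactVariable
  refine (integrable_inv_one_add_sq.mul_const ‖g‖).mono'
    (continuous_oscillatingWeight.mul hc).aestronglyMeasurable (Eventually.of_forall fun t => ?_)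
  rw [norm_mul]
  exact mul_le_mul (abs_oscillatingWeight_le t) (g.norm_coe_le_norm _) (norm_nonneg _)
    (by positivity)

/-- The linear functional `g ↦ ∫₀^∞ t sin t (1 + t²)^(-3/2) g(1/(1 + t²)) dt`. -/
def oscillatingFunctional : C(Icc (0 : ℝ) 1, ℝ) →L[ℝ] ℝ :=
  LinearMap.mkContinuous
    { toFun := fun g => ∫ t in Ioi (0 : ℝ), oscillatingWeight t * g (compactVariable t)
      map_add' := fun g h => by
        rw [← integral_add (integrable_oscillatingWeight_mul g).integrableOn
          (integrable_oscillatingWeight_mul h).integrableOn]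
        simp [mul_add]
      map_smul' := fun c g => by
        rw [RingHom.id_apply, smul_eq_mul, ← integral_const_mul]
        refine integral_congr_ae (Eventually.of_forall fun t => ?_)
        simp only [ContinuousMap.smul_apply, smul_eq_mul]
        ring }
    (∫ t in Ioi (0 : ℝ), (1 + t ^ 2)⁻¹) fun g => by
      rw [← integral_mul_const]
      refine norm_integral_le_of_norm_le
        (integrable_inv_one_add_sq.mul_const ‖g‖).integrableOn (Eventually.of_forall fun t => ?_)
      rw [norm_mul]
      exact mul_le_mul (abs_oscillatingWeight_le t) (g.norm_coe_le_norm _) (norm_nonneg _)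
        (by positivity)

/-- `1/(√(1 + (A - 1) u) (B u - 4 (1 + (A - 1) u)))` with `A = m² λ²`, `B = k² λ²` and
`λ² = -(kσ)²`. -/
def compactIntegrand (m : ℝ) (σ : Matrix (Fin 4) (Fin 4) ℝ)
    (z : EuclideanSpace ℝ (Fin 4) × ℝ) : ℝ :=
  1 / (√(1 + (m ^ 2 * -minkowskiSq (twist σ z.1) - 1) * z.2) *
    (minkowskiSq z.1 * -minkowskiSq (twist σ z.1) * z.2 -
      4 * (1 + (m ^ 2 * -minkowskiSq (twist σ z.1) - 1) * z.2)))

theorem contDiff_twist (σ : Matrix (Fin 4) (Fin 4) ℝ) : ContDiff ℝ ∞ (twist σ) := by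
  rw [contDiff_euclidean]
  intro i
  simp only [twist]
  fun_prop

/-- `1 + (A - 1)u = (1 - u) + A u` is positive on `[0, 1]`, also at `u = 0`, which stands for
infinite momentum. With `B ≤ (9/4) A` the second factor is at most `-(7/4)(1 + (A - 1)u)`. -/
theorem compactIntegrand_denominators (hm : 0 < m) (hk : k ∈ shellRegion m) {L u : ℝ}
    (hL : 0 < L) (hu : u ∈ Icc (0 : ℝ) 1) : 0 < 1 + (m ^ 2 * L - 1) * u ∧
      minkowskiSq k * L * u - 4 * (1 + (m ^ 2 * L - 1) * u) < 0 := by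
  have h1 := (minkowskiSq_mem_shellRegion hm hk).2
  have hA : 0 < m ^ 2 * L := by positivity
  have hpos : 0 < 1 + (m ^ 2 * L - 1) * u := by
    have h2 : 0 ≤ m ^ 2 * L * u := mul_nonneg hA.le hu.1
    rcases hu.1.eq_or_lt with h | h
    · rw [← h]; norm_num
    · have := mul_pos hA h
      linarith [hu.2]
  refine ⟨hpos, ?_⟩
  have h3 : minkowskiSq k * L * u ≤ 9 / 4 * (m ^ 2 * L * u) := by
    have := mul_le_mul_of_nonneg_right h1.le (mul_nonneg hL.le hu.1)
    linarith
  have h4 : m ^ 2 * L * u ≤ 1 + (m ^ 2 * L - 1) * u := by linarith [hu.2]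
  linarith

theorem contDiffAt_compactIntegrand (hm : 0 < m) (hk : k ∈ shellRegion m)
    (hl : 0 < twistLength σ k) {u : ℝ} (hu : u ∈ Icc (0 : ℝ) 1) :
    ContDiffAt ℝ ∞ (compactIntegrand m σ) (k, u) := by
  obtain ⟨h1, h2⟩ := compactIntegrand_denominators hm hk (Real.sqrt_pos.1 hl) hu
  have c1 : ContDiffAt ℝ ∞ (fun z : EuclideanSpace ℝ (Fin 4) × ℝ => minkowskiSq z.1) (k, u) :=
    (contDiff_minkowskiSq.comp contDiff_fst).contDiffAt
  have c2 : ContDiffAt ℝ ∞ (fun z : EuclideanSpace ℝ (Fin 4) × ℝ =>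
      -minkowskiSq (twist σ z.1)) (k, u) :=
    (contDiff_minkowskiSq.comp ((contDiff_twist σ).comp contDiff_fst)).neg.contDiffAt
  have c3 : ContDiffAt ℝ ∞ (fun z : EuclideanSpace ℝ (Fin 4) × ℝ =>
      1 + (m ^ 2 * -minkowskiSq (twist σ z.1) - 1) * z.2) (k, u) :=
    contDiffAt_const.add (((contDiffAt_const.mul c2).sub contDiffAt_const).mul contDiffAt_snd)
  refine contDiffAt_const.div ((c3.sqrt h1.ne').mul (((c1.mul c2).mul contDiffAt_snd).sub
    (contDiffAt_const.mul c3))) ?_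
  exact mul_ne_zero (Real.sqrt_pos.2 h1).ne' h2.ne

/-- In the variable `t = Lx` the sine no longer depends on `k`, so differentiating in `k` never
produces powers of `x`. The rest of the integrand depends on `t` through `t/√(1 + t²)`, `(1 + t²)⁻¹`
and a function of `k` and `u = 1/(1 + t²)`. -/
theorem radialIntegrand_eq_compact (hm : 0 < m) (hk : k ∈ shellRegion m)
    (hl : 0 < twistLength σ k) {x : ℝ} (hx : 0 < x) :
    radialIntegrand m σ k x = twistLength σ k * (oscillatingWeight (twistLength σ k * x) *
      compactIntegrand m σ (k, compactVariable (twistLength σ k * x))) := by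
  have hL : -minkowskiSq (twist σ k) = twistLength σ k ^ 2 :=
    (Real.sq_sqrt (Real.sqrt_pos.1 hl).le).symm
  have hu := (compactVariable (twistLength σ k * x)).2
  obtain ⟨h1, h2⟩ := compactIntegrand_denominators hm hk (pow_pos hl 2) hu
  have hD := rest_denominator_lt hm hk x
  rw [compactIntegrand, hL, radialIntegrand]
  set L := twistLength σ k
  simp only [compactVariable] at h1 h2 ⊢
  have hT : 0 < 1 + (L * x) ^ 2 := by positivity
  have e1 : 1 + (m ^ 2 * L ^ 2 - 1) * (1 + (L * x) ^ 2)⁻¹ =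
      L ^ 2 * energy m x ^ 2 * (1 + (L * x) ^ 2)⁻¹ := by
    rw [energy_sq]; field_simp; ring
  have e2 : minkowskiSq k * L ^ 2 * (1 + (L * x) ^ 2)⁻¹ -
      4 * (L ^ 2 * energy m x ^ 2 * (1 + (L * x) ^ 2)⁻¹) =
      L ^ 2 * (1 + (L * x) ^ 2)⁻¹ * (minkowskiSq k - 4 * energy m x ^ 2) := by ring
  have e3 : √(L ^ 2 * energy m x ^ 2 * (1 + (L * x) ^ 2)⁻¹) =
      L * energy m x / √(1 + (L * x) ^ 2) := by
    rw [← div_eq_mul_inv, Real.sqrt_div (by positivity), ← mul_pow,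
      Real.sqrt_sq (mul_nonneg hl.le (energy_nonneg _ _))]
  rw [e1, e2, e3, oscillatingWeight, mul_comm x L]
  have hE := energy_pos hm x
  have hs : 0 < √(1 + (L * x) ^ 2) := Real.sqrt_pos.2 hT
  have hD' := hD.ne
  set Dn := minkowskiSq k - 4 * energy m x ^ 2
  field_simp

theorem nonplanarSelfEnergy_eq (hm : 0 < m) (hk : k ∈ shellRegion m)
    (hl : 0 < twistLength σ k) : nonplanarSelfEnergy m σ k =
      -2 * ((2 * Real.pi) ^ 2)⁻¹ * oscillatingFunctional (curryOn (compactIntegrand m σ)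
        (⟨Subtype.val, continuous_subtype_val⟩ : C(Icc (0 : ℝ) 1, ℝ)) k) := by
  rw [nonplanarSelfEnergy]
  congr 1
  have h1 : ∫ x in Ioi (0 : ℝ), radialIntegrand m σ k x =
      ∫ x in Ioi (0 : ℝ), twistLength σ k * (oscillatingWeight (twistLength σ k * x) *
        compactIntegrand m σ (k, compactVariable (twistLength σ k * x))) :=
    setIntegral_congr_fun measurableSet_Ioi fun x hx => radialIntegrand_eq_compact hm hk hl hx
  rw [h1, integral_const_mul, integral_comp_mul_left_Ioi (fun t => oscillatingWeight t *
    compactIntegrand m σ (k, compactVariable t)) 0 hl, mul_zero, smul_eq_mul,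
    mul_inv_cancel_left₀ hl.ne']
  change _ = ∫ t in Ioi (0 : ℝ), _
  refine integral_congr_ae (Eventually.of_forall fun t => ?_)
  simp only
  rw [curryOn_apply (fun x => contDiffAt_compactIntegrand hm hk hl x.2)]
  rfl

/-- A continuous linear functional applied to a smooth `C([0, 1])`-valued map; no differentiation
under an improper integral occurs. -/
theorem contDiffOn_nonplanarSelfEnergy (hm : 0 < m)
    (hl : ∀ k ∈ shellRegion m, 0 < twistLength σ k) :
    ContDiffOn ℝ ∞ (nonplanarSelfEnergy m σ) (shellRegion m) := by
  have h1 : ContDiffOn ℝ ∞ (curryOn (compactIntegrand m σ)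
      (⟨Subtype.val, continuous_subtype_val⟩ : C(Icc (0 : ℝ) 1, ℝ))) (shellRegion m) :=
    contDiffOn_curryOn (shellRegion m).isOpen
      fun k hk x => contDiffAt_compactIntegrand hm hk (hl k hk) x.2
  have h2 : ContDiffOn ℝ ∞ (fun k => -2 * ((2 * Real.pi) ^ 2)⁻¹ *
      oscillatingFunctional (curryOn (compactIntegrand m σ)
        (⟨Subtype.val, continuous_subtype_val⟩ : C(Icc (0 : ℝ) 1, ℝ)) k)) (shellRegion m) :=
    contDiffOn_const.mul (oscillatingFunctional.contDiff.comp_contDiffOn h1)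
  exact h2.congr fun k hk => nonplanarSelfEnergy_eq hm hk (hl k hk)

end Radial

/-! ### The Fourier transform of a radial function in three dimensions -/

section Spherical

/-- Assembling a vector from its first coordinate and the two others. -/
def cylinderMap (p : ℝ × EuclideanSpace ℝ (Fin 2)) : EuclideanSpace ℝ (Fin 3) :=
  WithLp.toLp 2 (Fin.cons p.1 fun i => p.2 i)

theorem measurePreserving_cylinderMap : MeasurePreserving cylinderMap := by
  have h1 : MeasurePreserving (Prod.map id (@WithLp.ofLp 2 (Fin 2 → ℝ)) :
      ℝ × EuclideanSpace ℝ (Fin 2) → ℝ × (Fin 2 → ℝ)) :=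
    (MeasurePreserving.id _).prod (PiLp.volume_preserving_ofLp (Fin 2))
  have h2 := (volume_preserving_piFinSuccAbove (fun _ : Fin 3 => ℝ) 0).symm
  have h3 := (PiLp.volume_preserving_toLp (Fin 3)).comp (h2.comp h1)
  convert h3 using 1
  funext p
  simp [cylinderMap, MeasurableEquiv.piFinSuccAbove]
  rfl

theorem norm_sq_cylinderMap (p : ℝ × EuclideanSpace ℝ (Fin 2)) :
    ‖cylinderMap p‖ ^ 2 = p.1 ^ 2 + ‖p.2‖ ^ 2 := by
  rw [EuclideanSpace.real_norm_sq_eq, EuclideanSpace.real_norm_sq_eq, Fin.sum_univ_succ]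
  rfl

theorem exists_orthonormalBasis_of_ne_zero {q : EuclideanSpace ℝ (Fin 3)} (hq : q ≠ 0) :
    ∃ b : OrthonormalBasis (Fin 3) ℝ (EuclideanSpace ℝ (Fin 3)), q = ‖q‖ • b 0 := by
  have hv : Orthonormal ℝ (({0} : Set (Fin 3)).domRestrict
      fun _ : Fin 3 => (‖q‖⁻¹ • q : EuclideanSpace ℝ (Fin 3))) := by
    refine ⟨fun i => ?_, fun i j hij => absurd (Subsingleton.elim i j) hij⟩
    simp [norm_smul, hq]
  obtain ⟨b, hb⟩ := hv.exists_orthonormalBasis_extension_of_card_eq (by simp)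
  refine ⟨b, ?_⟩
  rw [hb 0 rfl, smul_inv_smul₀ (norm_ne_zero_iff.2 hq)]

theorem integral_radial_plane (f : ℝ → ℂ) :
    ∫ y : EuclideanSpace ℝ (Fin 2), f ‖y‖ =
      ((2 * Real.pi : ℝ) : ℂ) * ∫ s in Ioi (0 : ℝ), (s : ℂ) * f s := by
  have h := integral_fun_norm_addHaar (volume : Measure (EuclideanSpace ℝ (Fin 2))) f
  rw [h]
  simp only [finrank_euclideanSpace, Fintype.card_fin, Measure.real,
    EuclideanSpace.volume_ball_fin_two]
  simp [Real.pi_pos.le, mul_assoc]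

/-- Substitution `r = √(z² + s²)`, for which `r dr = s ds`. -/
theorem integral_radial_shift (ρ : ℝ → ℂ) (z : ℝ) :
    ∫ s in Ioi (0 : ℝ), (s : ℂ) * ρ √(z ^ 2 + s ^ 2) = ∫ r in Ioi |z|, (r : ℂ) * ρ r := by
  have himg : (fun s => √(z ^ 2 + s ^ 2)) '' Ioi (0 : ℝ) = Ioi |z| := by
    ext r
    simp only [mem_image, mem_Ioi]
    constructor
    · rintro ⟨s, hs, rfl⟩
      refine Real.lt_sqrt_of_sq_lt ?_
      rw [sq_abs]; nlinarith
    · intro hr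
      have hr0 := (abs_nonneg z).trans_lt hr
      have h1 : 0 < r ^ 2 - z ^ 2 := by
        rw [← sq_abs z]; nlinarith [abs_nonneg z]
      refine ⟨√(r ^ 2 - z ^ 2), Real.sqrt_pos.2 h1, ?_⟩
      rw [Real.sq_sqrt h1.le, add_sub_cancel, Real.sqrt_sq hr0.le]
  have hder : ∀ s ∈ Ioi (0 : ℝ), HasDerivWithinAt (fun s => √(z ^ 2 + s ^ 2))
      (s / √(z ^ 2 + s ^ 2)) (Ioi 0) s := by
    intro s hs
    have hs0 : (0 : ℝ) < s := hs
    have h1 : HasDerivAt (fun s : ℝ => z ^ 2 + s ^ 2) (2 * s) s := by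
      simpa using ((hasDerivAt_pow 2 s).const_add (z ^ 2))
    have h2 := h1.sqrt (by positivity)
    refine (h2.congr_deriv ?_).hasDerivWithinAt
    field_simp
  have hinj : InjOn (fun s => √(z ^ 2 + s ^ 2)) (Ioi (0 : ℝ)) := by
    intro s hs t ht hst
    simp only at hst
    rw [Real.sqrt_inj (by positivity) (by positivity)] at hst
    have hs0 : (0 : ℝ) < s := hs
    have ht0 : (0 : ℝ) < t := ht
    nlinarith
  rw [← himg, integral_image_eq_integral_abs_deriv_smul measurableSet_Ioi hder hinj]
  refine setIntegral_congr_fun measurableSet_Ioi fun s hs => ?_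
  have hs0 : (0 : ℝ) < s := hs
  have hpos : 0 < √(z ^ 2 + s ^ 2) := Real.sqrt_pos.2 (by positivity)
  rw [abs_of_pos (by positivity), Complex.real_smul, ← mul_assoc, ← Complex.ofReal_mul,
    div_mul_cancel₀ _ hpos.ne']

theorem integral_exp_symm {q : ℝ} (hq : q ≠ 0) {r : ℝ} (hr : 0 ≤ r) :
    ∫ z in Ioo (-r) r, Complex.exp (Complex.I * ((q * z : ℝ) : ℂ)) =
      ((2 * Real.sin (r * q) / q : ℝ) : ℂ) := by
  rw [← integral_Ioc_eq_integral_Ioo, ← intervalIntegral.integral_of_le (by linarith)]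
  have h1 : ∀ z : ℝ, Complex.exp (Complex.I * ((q * z : ℝ) : ℂ)) =
      Complex.exp ((Complex.I * q) * z) := fun z => by push_cast; ring_nf
  have hc : Complex.I * (q : ℂ) ≠ 0 := mul_ne_zero Complex.I_ne_zero (by exact_mod_cast hq)
  simp only [h1]
  rw [integral_exp_mul_complex hc]
  have h2 : Complex.I * q * r = ((r * q : ℝ) : ℂ) * Complex.I := by push_cast; ring
  have h3 : Complex.I * q * ((-r : ℝ) : ℂ) = ((-(r * q) : ℝ) : ℂ) * Complex.I := by
    push_cast; ring
  rw [h2, h3, Complex.exp_mul_I, Complex.exp_mul_I, ← Complex.ofReal_cos, ← Complex.ofReal_sin,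
    ← Complex.ofReal_cos, ← Complex.ofReal_sin, Real.cos_neg, Real.sin_neg]
  have hq' : (q : ℂ) ≠ 0 := by exact_mod_cast hq
  rw [div_eq_iff hc]
  push_cast
  field_simp
  ring

variable {ρ : ℝ → ℂ} {R : ℝ}

/-- The region `|z| < r` meets the support of `ρ` inside a compact rectangle, where the integrand is
continuous. -/
theorem integrable_triangle (hρ : Continuous ρ) (hR : ∀ r, R ≤ r → ρ r = 0) (q : ℝ) :
    Integrable (Function.uncurry fun z r : ℝ => (Ioi |z|).indicator
      (fun r => Complex.exp (Complex.I * ((q * z : ℝ) : ℂ)) * ((r : ℂ) * ρ r)) r)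
      (volume.prod volume) := by
  have hc : Continuous fun p : ℝ × ℝ =>
      Complex.exp (Complex.I * ((q * p.1 : ℝ) : ℂ)) * ((p.2 : ℂ) * ρ p.2) := by fun_prop
  have hset : MeasurableSet {p : ℝ × ℝ | |p.1| < p.2} :=
    measurableSet_lt (by fun_prop) measurable_snd
  have heq : (Function.uncurry fun z r : ℝ => (Ioi |z|).indicator
      (fun r => Complex.exp (Complex.I * ((q * z : ℝ) : ℂ)) * ((r : ℂ) * ρ r)) r) =
      {p : ℝ × ℝ | |p.1| < p.2}.indicator fun p =>
        Complex.exp (Complex.I * ((q * p.1 : ℝ) : ℂ)) * ((p.2 : ℂ) * ρ p.2) := by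
    funext p
    simp only [Function.uncurry, indicator, mem_Ioi, mem_ofPred_eq]
  have hK : IsCompact (Icc (-R) R ×ˢ Icc (0 : ℝ) R) := isCompact_Icc.prod isCompact_Icc
  have hint : IntegrableOn (fun p : ℝ × ℝ =>
      Complex.exp (Complex.I * ((q * p.1 : ℝ) : ℂ)) * ((p.2 : ℂ) * ρ p.2))
      (Icc (-R) R ×ˢ Icc (0 : ℝ) R) (volume.prod volume) := hc.continuousOn.integrableOn_compact hK
  rw [heq]
  refine ((integrable_indicator_iff hK.measurableSet).2 hint).norm.mono'
    (hc.aestronglyMeasurable.indicator hset) (Eventually.of_forall fun p => ?_)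
  by_cases hp : |p.1| < p.2
  · rw [indicator_of_mem (by exact hp)]
    by_cases hp2 : p.2 ≤ R
    · rw [indicator_of_mem]
      have := abs_lt.1 hp
      exact ⟨⟨by linarith, by linarith⟩, ⟨(abs_nonneg _).trans hp.le, hp2⟩⟩
    · rw [hR p.2 (not_le.1 hp2).le]
      simp
  · rw [indicator_of_notMem (by exact hp), norm_zero]
    positivity

/-- The Fourier transform of a radial function. -/
theorem integral_radial_mul_exp (hρ : Continuous ρ) (hR : ∀ r, R ≤ r → ρ r = 0)
    {q : EuclideanSpace ℝ (Fin 3)} (hq : q ≠ 0) :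
    ∫ l : EuclideanSpace ℝ (Fin 3), ρ ‖l‖ * Complex.exp (Complex.I * ((inner ℝ q l : ℝ) : ℂ)) =
      ((4 * Real.pi : ℝ) : ℂ) * ∫ r in Ioi (0 : ℝ),
        ρ r * ((r ^ 2 * (Real.sin (r * ‖q‖) / (r * ‖q‖)) : ℝ) : ℂ) := by
  obtain ⟨b, hb⟩ := exists_orthonormalBasis_of_ne_zero hq
  have hQ : ‖q‖ ≠ 0 := norm_ne_zero_iff.2 hq
  set Q := ‖q‖ with hQdef
  set Φ : EuclideanSpace ℝ (Fin 3) → ℂ :=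
    fun l => ρ ‖l‖ * Complex.exp (Complex.I * ((inner ℝ q l : ℝ) : ℂ)) with hΦ
  have hΦc : Continuous Φ := by rw [hΦ]; fun_prop
  have hmp : MeasurePreserving (fun p => b.repr.symm (cylinderMap p)) :=
    b.measurePreserving_repr_symm.comp measurePreserving_cylinderMap
  have hval (p : ℝ × EuclideanSpace ℝ (Fin 2)) : Φ (b.repr.symm (cylinderMap p)) =
      ρ √(p.1 ^ 2 + ‖p.2‖ ^ 2) * Complex.exp (Complex.I * ((Q * p.1 : ℝ) : ℂ)) := by
    have h1 : ‖b.repr.symm (cylinderMap p)‖ = √(p.1 ^ 2 + ‖p.2‖ ^ 2) := by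
      rw [LinearIsometryEquiv.norm_map, ← norm_sq_cylinderMap, Real.sqrt_sq (norm_nonneg _)]
    have h2 : inner ℝ q (b.repr.symm (cylinderMap p)) = Q * p.1 := by
      rw [hb, inner_smul_left, ← b.repr_apply_apply, LinearIsometryEquiv.apply_symm_apply]
      rfl
    simp only [hΦ, h1, h2]
  have hΦi : Integrable Φ := by
    refine hΦc.integrable_of_hasCompactSupport
      (HasCompactSupport.of_support_subset_isCompact (isCompact_closedBall 0 R) fun l hl => ?_)
    rw [Metric.mem_closedBall, dist_zero_right]
    by_contra hlt
    exact hl (by simp only [hΦ, hR _ (not_le.1 hlt).le, zero_mul])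
  have hint : Integrable (fun p : ℝ × EuclideanSpace ℝ (Fin 2) =>
      ρ √(p.1 ^ 2 + ‖p.2‖ ^ 2) * Complex.exp (Complex.I * ((Q * p.1 : ℝ) : ℂ)))
      (volume.prod volume) := by
    have h := (hmp.integrable_comp hΦc.aestronglyMeasurable).2 hΦi
    exact h.congr (Eventually.of_forall hval)
  have h1 : ∫ l, Φ l = ∫ p : ℝ × EuclideanSpace ℝ (Fin 2),
      ρ √(p.1 ^ 2 + ‖p.2‖ ^ 2) * Complex.exp (Complex.I * ((Q * p.1 : ℝ) : ℂ)) := by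
    rw [← hmp.map_eq, integral_map hmp.measurable.aemeasurable hΦc.aestronglyMeasurable]
    exact integral_congr_ae (Eventually.of_forall hval)
  -- With the first axis along `q` the phase depends on `z` only. Polar coordinates in the
  -- orthogonal plane, followed by `r = √(z² + s²)`, leave an integral over `r > |z|`.
  have h2 (z : ℝ) : ∫ y : EuclideanSpace ℝ (Fin 2),
      ρ √(z ^ 2 + ‖y‖ ^ 2) * Complex.exp (Complex.I * ((Q * z : ℝ) : ℂ)) =
      ((2 * Real.pi : ℝ) : ℂ) * ∫ r, (Ioi |z|).indicator
        (fun r => Complex.exp (Complex.I * ((Q * z : ℝ) : ℂ)) * ((r : ℂ) * ρ r)) r := by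
    rw [integral_indicator measurableSet_Ioi, integral_const_mul, integral_mul_const,
      integral_radial_plane (fun s => ρ √(z ^ 2 + s ^ 2)), integral_radial_shift]
    ring
  have h3 (r : ℝ) : ∫ z : ℝ, (Ioi |z|).indicator
        (fun r => Complex.exp (Complex.I * ((Q * z : ℝ) : ℂ)) * ((r : ℂ) * ρ r)) r =
      (Ioi 0).indicator (fun r => ((2 * Real.sin (r * Q) / Q : ℝ) : ℂ) * ((r : ℂ) * ρ r)) r := by
    have h4 : (fun z : ℝ => (Ioi |z|).indicator
        (fun r => Complex.exp (Complex.I * ((Q * z : ℝ) : ℂ)) * ((r : ℂ) * ρ r)) r) =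
        (Ioo (-r) r).indicator
          fun z => Complex.exp (Complex.I * ((Q * z : ℝ) : ℂ)) * ((r : ℂ) * ρ r) := by
      funext z
      simp only [indicator, mem_Ioi, mem_Ioo, abs_lt]
    rw [h4, integral_indicator measurableSet_Ioo, integral_mul_const]
    by_cases hr : 0 < r
    · rw [integral_exp_symm hQ hr.le, indicator_of_mem (by exact hr)]
    · rw [Ioo_eq_empty (by linarith), setIntegral_empty, zero_mul,
        indicator_of_notMem (by exact hr)]
  rw [h1, Measure.volume_eq_prod, integral_prod _ hint]
  simp only [h2]
  -- Exchanging the integrals, `z` runs over `(-r, r)` for fixed `r`; this elementary integral gives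
  -- `2 sin(rQ)/Q`.
  rw [integral_const_mul, integral_integral_swap (integrable_triangle hρ hR Q)]
  simp only [h3]
  rw [integral_indicator measurableSet_Ioi, ← integral_const_mul, ← integral_const_mul]
  refine setIntegral_congr_fun measurableSet_Ioi fun r hr => ?_
  have hr0 : (r : ℂ) ≠ 0 := by exact_mod_cast (ne_of_gt hr)
  have hQ' : (Q : ℂ) ≠ 0 := by exact_mod_cast hQ
  push_cast
  field_simp
  ring

end Spherical

/-! ### Evaluation of the cut-off self-energy -/

section Evaluation

variable {m : ℝ} {k : EuclideanSpace ℝ (Fin 4)} {σ : Matrix (Fin 4) (Fin 4) ℝ} {ε : ℝ}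
  {g : ℝ → ℂ}

theorem continuous_energy (m : ℝ) : Continuous (energy m) := by
  unfold energy; fun_prop

theorem measurableEmbedding_onShell (m : ℝ) : MeasurableEmbedding (onShell m) :=
  (continuous_onShell m).measurableEmbedding
    (Function.LeftInverse.injective (g := spatialPart) fun l => spatialPart_onShell m l)

theorem measurable_shellDensity (m : ℝ) : Measurable fun l : EuclideanSpace ℝ (Fin 3) =>
    ENNReal.ofReal ((2 * Real.pi)⁻¹ * (1 / (2 * energy m ‖l‖))) := by
  have := (continuous_energy m).measurable
  fun_prop

theorem shellDensity_nonneg (m x : ℝ) : 0 ≤ (2 * Real.pi)⁻¹ * (1 / (2 * energy m x)) := by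
  have := energy_nonneg m x
  have := Real.pi_pos
  positivity

theorem integral_positiveFrequencyMeasure (m : ℝ) (h : EuclideanSpace ℝ (Fin 4) → ℂ) :
    ∫ l, h l ∂(positiveFrequencyMeasure m) =
      ∫ l, (((2 * Real.pi)⁻¹ * (1 / (2 * energy m ‖l‖)) : ℝ) : ℂ) * h (onShell m l) := by
  rw [positiveFrequencyMeasure, (measurableEmbedding_onShell m).integral_map,
    integral_withDensity_eq_integral_toReal_smul (measurable_shellDensity m)
      (Eventually.of_forall fun l => ENNReal.ofReal_lt_top)]
  simp only [ENNReal.toReal_ofReal (shellDensity_nonneg m _), Complex.real_smul]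

theorem integrable_positiveFrequencyMeasure_iff (m : ℝ) (h : EuclideanSpace ℝ (Fin 4) → ℂ) :
    Integrable h (positiveFrequencyMeasure m) ↔
      Integrable fun l => (((2 * Real.pi)⁻¹ * (1 / (2 * energy m ‖l‖)) : ℝ) : ℂ) *
        h (onShell m l) := by
  rw [positiveFrequencyMeasure, (measurableEmbedding_onShell m).integrable_map_iff,
    integrable_withDensity_iff_integrable_smul' (measurable_shellDensity m)
      (Eventually.of_forall fun l => ENNReal.ofReal_lt_top)]
  simp only [ENNReal.toReal_ofReal (shellDensity_nonneg m _), Complex.real_smul,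
    Function.comp_def]

theorem cutoffIntegrand_eq (m : ℝ) (σ : Matrix (Fin 4) (Fin 4) ℝ) (ε : ℝ) (g : ℝ → ℂ) (n : ℕ)
    (k : EuclideanSpace ℝ (Fin 4)) (l : EuclideanSpace ℝ (Fin 3)) :
    (((2 * Real.pi)⁻¹ * (1 / (2 * energy m ‖l‖)) : ℝ) : ℂ) *
      (boostCutoff g n k (onShell m l) * selfEnergyIntegrand m σ ε k (onShell m l)) =
    (boostCutoffOnShell m g n * amplitude m σ ε) k l *
      Complex.exp (Complex.I * (twistPhase σ ε k l : ℂ)) := by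
  rw [mul_left_comm, ← amplitude_mul_exp, Pi.mul_apply, Pi.mul_apply, mul_assoc]
  rfl

theorem integral_cutoff_eq_phaseIntegral (m : ℝ) (σ : Matrix (Fin 4) (Fin 4) ℝ) (ε : ℝ)
    (g : ℝ → ℂ) (n : ℕ) (k : EuclideanSpace ℝ (Fin 4)) :
    ∫ l, boostCutoff g n k l * selfEnergyIntegrand m σ ε k l ∂(positiveFrequencyMeasure m) =
      phaseIntegral (twistPhase σ ε) (boostCutoffOnShell m g n * amplitude m σ ε) k := by
  rw [integral_positiveFrequencyMeasure]
  exact integral_congr_ae (Eventually.of_forall fun l => cutoffIntegrand_eq m σ ε g n k l)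

theorem continuous_amplitude (hm : 0 < m) (σ : Matrix (Fin 4) (Fin 4) ℝ) (ε : ℝ)
    (hk : k ∈ shellRegion m) : Continuous (amplitude m σ ε k) := by
  have h1 : amplitude m σ ε k = fun l => scaledAmplitude m σ ε ((k, (‖l‖, l)), 1) :=
    funext fun l => amplitude_eq_scaledAmplitude hm σ ε hk l
  rw [h1, continuous_iff_continuousAt]
  intro l
  have h2 := (contDiffAt_scaledAmplitude hm σ ε hk (u := 1) (l := l)
    (Or.inl (by simpa using hm.ne')) (norm_nonneg l)).continuousAt
  exact ContinuousAt.comp (g := scaledAmplitude m σ ε)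
    (f := fun l : EuclideanSpace ℝ (Fin 3) => ((k, (‖l‖, l)), (1 : ℝ))) h2 (by fun_prop)

theorem continuous_boostCutoffOnShell (hm : 0 < m) (hg : ContDiff ℝ ∞ g) (n : ℕ)
    (hk : k ∈ shellRegion m) : Continuous (boostCutoffOnShell m g n k) := by
  rw [continuous_iff_continuousAt]
  intro l
  exact ContinuousAt.comp (g := Function.uncurry (boostCutoffOnShell m g n))
    (f := fun l => (k, l)) (SmoothOnProd.contDiffAt_top
      (smoothOnProd_boostCutoffOnShell hm hg n) hk l).continuousAt (by fun_prop)

theorem integrable_cutoffIntegrand (hm : 0 < m) (hg : ContDiff ℝ ∞ g)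
    (hg2 : ∀ x, 2 ≤ |x| → g x = 0) {n : ℕ} (hn : 0 < n) (σ : Matrix (Fin 4) (Fin 4) ℝ) (ε : ℝ)
    (hk : k ∈ shellRegion m) :
    Integrable (fun l => boostCutoff g n k l * selfEnergyIntegrand m σ ε k l)
      (positiveFrequencyMeasure m) := by
  rw [integrable_positiveFrequencyMeasure_iff]
  simp only [cutoffIntegrand_eq]
  obtain ⟨R, hR⟩ := hasCompactSupportInL_boostCutoffOnShell hm hg2 hn
    ⟨{k}, isCompact_singleton, by simpa using hk⟩
  have hφ : Continuous fun l => twistPhase σ ε k l := by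
    rw [twistPhase_eq_linearPhase]
    exact continuous_const.inner (continuous_phaseGradient σ ε)
  have h1 := continuous_boostCutoffOnShell hm hg n hk
  have h2 := continuous_amplitude hm σ ε hk
  have hc : Continuous fun l => (boostCutoffOnShell m g n * amplitude m σ ε) k l *
      Complex.exp (Complex.I * (twistPhase σ ε k l : ℂ)) := by
    simp only [Pi.mul_apply]
    fun_prop
  refine hc.integrable_of_hasCompactSupport
    (HasCompactSupport.of_support_subset_isCompact (isCompact_closedBall 0 R) fun l hl => ?_)
  rw [Metric.mem_closedBall, dist_zero_right]
  by_contra hlt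
  exact hl (by simp [hR k rfl l (not_le.1 hlt)])

/-- The radial integral for the self-energy with a cutoff at momentum `n`. -/
def cutoffSelfEnergy (m : ℝ) (σ : Matrix (Fin 4) (Fin 4) ℝ) (g : ℝ → ℂ) (n : ℕ)
    (k : EuclideanSpace ℝ (Fin 4)) : ℂ :=
  ((-2 * ((2 * Real.pi) ^ 2)⁻¹ : ℝ) : ℂ) *
    ∫ x in Ioi (0 : ℝ), g (x ^ 2 / n ^ 2) * (radialIntegrand m σ k x : ℂ)

/-- For fixed `k`, change variables to the momentum in the rest frame: `d³l/ω_l` is invariant,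
cutoff and propagators become radial, and the phase becomes the inner product with a fixed vector of
length `√(-(kσ)²)`. The radial Fourier transform then applies. -/
theorem phaseIntegral_cutoff_eq (hm : 0 < m) (hσ : σ.transpose = -σ) (hσ' : σ.det ≠ 0)
    (hε : ε = 1 ∨ ε = -1) (hg : ContDiff ℝ ∞ g) (hg2 : ∀ x, 2 ≤ |x| → g x = 0) {n : ℕ}
    (hn : 0 < n) (hk : k ∈ shellRegion m) :
    phaseIntegral (twistPhase σ ε) (boostCutoffOnShell m g n * amplitude m σ ε) k =
      cutoffSelfEnergy m σ g n k := by
  have hL := twistLength_pos hσ hσ' hm hk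
  have hn0 : (0 : ℝ) < n := by exact_mod_cast hn
  set q : EuclideanSpace ℝ (Fin 3) := ε • restTwist σ k with hq
  have hqn : ‖q‖ = twistLength σ k := by
    rw [hq, norm_smul, twistLength_eq hσ hm hk]
    rcases hε with rfl | rfl <;> simp
  have hq0 : q ≠ 0 := norm_pos_iff.1 (hqn ▸ hL)
  set c : ℝ := ((2 * Real.pi) ^ 3)⁻¹ * (1 / 2) with hc
  set Ψ : EuclideanSpace ℝ (Fin 3) → ℂ := fun l =>
    ((c * (-2 / (minkowskiSq k - 4 * energy m ‖l‖ ^ 2)) : ℝ) : ℂ) * g (‖l‖ ^ 2 / n ^ 2) *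
      Complex.exp (Complex.I * ((inner ℝ q l : ℝ) : ℂ)) with hΨ
  set ρ : ℝ → ℂ := fun r =>
    ((c * (energy m r)⁻¹ * (-2 / (minkowskiSq k - 4 * energy m r ^ 2)) : ℝ) : ℂ) *
      g (r ^ 2 / n ^ 2) with hρ
  have hEc := continuous_energy m
  have hρc : Continuous ρ := by
    have h1 : Continuous fun r => (energy m r)⁻¹ := hEc.inv₀ fun r => (energy_pos hm r).ne'
    have h2 : Continuous fun r => -2 / (minkowskiSq k - 4 * energy m r ^ 2) :=
      continuous_const.div (by fun_prop) fun r => (rest_denominator_lt hm hk r).ne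
    have h3 := hg.continuous
    rw [hρ]
    fun_prop
  -- For `r ≥ 2n` the argument `r²/n²` is at least `4`, beyond the support of `g`.
  have hρ0 : ∀ r, 2 * (n : ℝ) ≤ r → ρ r = 0 := fun r hr => by
    have : g (r ^ 2 / n ^ 2) = 0 := by
      refine hg2 _ ?_
      rw [abs_of_nonneg (by positivity), le_div_iff₀ (by positivity)]
      nlinarith
    simp only [hρ, this, mul_zero]
  have h1 : phaseIntegral (twistPhase σ ε) (boostCutoffOnShell m g n * amplitude m σ ε) k =
      ∫ l, ((energy m ‖l‖)⁻¹ : ℝ) • Ψ (boostMomentum m (velocity k) l) := by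
    refine integral_congr_ae (Eventually.of_forall fun l => ?_)
    simp only
    have hsum := propagator_sum_rest hm hk l
    rw [← cutoffIntegrand_eq, selfEnergyIntegrand, twistPairing_eq_inner hσ hm hk,
      retardedPropagator, retardedPropagator, ← mul_add, hsum, ← boostCutoffOnShell,
      boostCutoffOnShell_eq hm hk, restNormSq, ← norm_restMomentum_sq hm hk,
      ← restMomentum, restMomentum_eq, ← real_inner_smul_left, ← hq, Complex.real_smul]
    simp only [hΨ, hc]
    push_cast
    ring
  have h2 : ∀ l : EuclideanSpace ℝ (Fin 3), ((energy m ‖l‖)⁻¹ : ℝ) • Ψ l =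
      ρ ‖l‖ * Complex.exp (Complex.I * ((inner ℝ q l : ℝ) : ℂ)) := fun l => by
    rw [Complex.real_smul]
    simp only [hΨ, hρ]
    push_cast
    ring
  rw [h1, integral_boostMomentum hm (norm_velocity_lt hm hk)]
  simp only [h2]
  rw [integral_radial_mul_exp hρc hρ0 hq0, hqn, cutoffSelfEnergy, ← integral_const_mul,
    ← integral_const_mul]
  refine setIntegral_congr_fun measurableSet_Ioi fun r hr => ?_
  have hE : energy m r ≠ 0 := (energy_pos hm r).ne'
  have hD : minkowskiSq k - 4 * energy m r ^ 2 ≠ 0 := (rest_denominator_lt hm hk r).ne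
  -- The constants combine as `4π · (2π)⁻³ / 2 = (2π)⁻²`.
  have hreal : 4 * Real.pi * (c * (energy m r)⁻¹ * (-2 / (minkowskiSq k - 4 * energy m r ^ 2)) *
      (r ^ 2 * (Real.sin (r * twistLength σ k) / (r * twistLength σ k)))) =
      -2 * ((2 * Real.pi) ^ 2)⁻¹ * radialIntegrand m σ k r := by
    rw [radialIntegrand, hc]
    have := Real.pi_pos.ne'
    generalize Real.sin (r * twistLength σ k) / (r * twistLength σ k) = S
    generalize minkowskiSq k - 4 * energy m r ^ 2 = D at hD ⊢
    field_simp
    ring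
  calc ((4 * Real.pi : ℝ) : ℂ) * (ρ r *
        ((r ^ 2 * (Real.sin (r * twistLength σ k) / (r * twistLength σ k)) : ℝ) : ℂ))
      = ((4 * Real.pi * (c * (energy m r)⁻¹ * (-2 / (minkowskiSq k - 4 * energy m r ^ 2)) *
          (r ^ 2 * (Real.sin (r * twistLength σ k) / (r * twistLength σ k)))) : ℝ) : ℂ) *
          g (r ^ 2 / n ^ 2) := by
        simp only [hρ]; push_cast; ring
    _ = ((-2 * ((2 * Real.pi) ^ 2)⁻¹ * radialIntegrand m σ k r : ℝ) : ℂ) *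
          g (r ^ 2 / n ^ 2) := by rw [hreal]
    _ = _ := by push_cast; ring

/-! #### Removing the cutoff -/

theorem exists_cutoff_norm_bound (hg : ContDiff ℝ ∞ g) (hg2 : ∀ x, 2 ≤ |x| → g x = 0) :
    ∃ M, 0 ≤ M ∧ ∀ x, ‖g x‖ ≤ M := by
  obtain ⟨M, hM⟩ := (isCompact_Icc (a := (-2 : ℝ)) (b := 2)).exists_bound_of_continuousOn
    hg.continuous.continuousOn
  refine ⟨max M 0, le_max_right _ _, fun x => ?_⟩
  rcases le_total 2 |x| with hx | hx
  · rw [hg2 x hx, norm_zero]; exact le_max_right _ _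
  · exact (hM x (abs_le.1 hx)).trans (le_max_left _ _)

theorem norm_cutoff_mul_radialIntegrand_le (hm : 0 < m) (hk : k ∈ shellRegion m)
    (hl : 0 < twistLength σ k) {M : ℝ} (hM : ∀ x, ‖g x‖ ≤ M) (n : ℕ) {x : ℝ} (hx : 0 < x) :
    ‖g (x ^ 2 / n ^ 2) * (radialIntegrand m σ k x : ℂ)‖ ≤
      M * ((twistLength σ k)⁻¹ * (x ^ 2 + m ^ 2)⁻¹) := by
  rw [norm_mul, Complex.norm_real]
  exact mul_le_mul (hM _) (abs_radialIntegrand_le hm hk hl hx) (norm_nonneg _)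
    ((norm_nonneg _).trans (hM 0))

/-- For each `x` the cutoff equals `1` as soon as `n ≥ x`, and the absolutely integrable bound
dominates. -/
theorem tendsto_cutoffSelfEnergy (hm : 0 < m) (hg : ContDiff ℝ ∞ g)
    (hg1 : ∀ x, |x| ≤ 1 → g x = 1) (hg2 : ∀ x, 2 ≤ |x| → g x = 0) (hk : k ∈ shellRegion m)
    (hl : 0 < twistLength σ k) :
    Tendsto (fun n => cutoffSelfEnergy m σ g n k) atTop
      (𝓝 (nonplanarSelfEnergy m σ k : ℂ)) := by
  obtain ⟨M, -, hM⟩ := exists_cutoff_norm_bound hg hg2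
  rw [nonplanarSelfEnergy, Complex.ofReal_mul, ← integral_complex_ofReal]
  refine Tendsto.const_mul _ (tendsto_integral_of_dominated_convergence
    (fun x => M * ((twistLength σ k)⁻¹ * (x ^ 2 + m ^ 2)⁻¹)) (fun n => ?_)
    (((integrable_inv_sq_add_sq hm).const_mul _).const_mul _).integrableOn (fun n => ?_) ?_)
  · have h1 := hg.continuous.measurable
    have h2 := measurable_radialIntegrand m σ k
    exact Measurable.aestronglyMeasurable (by fun_prop)
  · filter_upwards [ae_restrict_mem measurableSet_Ioi] with x hx
    exact norm_cutoff_mul_radialIntegrand_le hm hk hl hM n hx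
  · filter_upwards [ae_restrict_mem measurableSet_Ioi] with x hx
    have hx0 : (0 : ℝ) < x := hx
    refine tendsto_const_nhds.congr' ?_
    filter_upwards [tendsto_natCast_atTop_atTop.eventually_ge_atTop x] with n hn
    have hn0 : (0 : ℝ) < n := hx0.trans_le hn
    rw [hg1, one_mul]
    rw [abs_of_nonneg (by positivity), div_le_one (by positivity)]
    gcongr

theorem norm_cutoffSelfEnergy_le (hm : 0 < m) (hk : k ∈ shellRegion m)
    (hl : 0 < twistLength σ k) {M : ℝ} (hM : ∀ x, ‖g x‖ ≤ M) (n : ℕ) :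
    ‖cutoffSelfEnergy m σ g n k‖ ≤ (2 * ((2 * Real.pi) ^ 2)⁻¹ * M *
      ∫ x in Ioi (0 : ℝ), (x ^ 2 + m ^ 2)⁻¹) * (twistLength σ k)⁻¹ := by
  have h1 : ‖∫ x in Ioi (0 : ℝ), g (x ^ 2 / n ^ 2) * (radialIntegrand m σ k x : ℂ)‖ ≤
      ∫ x in Ioi (0 : ℝ), M * ((twistLength σ k)⁻¹ * (x ^ 2 + m ^ 2)⁻¹) := by
    refine norm_integral_le_of_norm_le
      (((integrable_inv_sq_add_sq hm).const_mul _).const_mul _).integrableOn ?_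
    filter_upwards [ae_restrict_mem measurableSet_Ioi] with x hx
    exact norm_cutoff_mul_radialIntegrand_le hm hk hl hM n hx
  rw [integral_const_mul, integral_const_mul] at h1
  have h2 : |-2 * ((2 * Real.pi) ^ 2)⁻¹| = 2 * ((2 * Real.pi) ^ 2)⁻¹ := by
    rw [neg_mul, abs_neg, abs_of_nonneg (by positivity)]
  rw [cutoffSelfEnergy, norm_mul, Complex.norm_real, Real.norm_eq_abs, h2]
  refine (mul_le_mul_of_nonneg_left h1 (by positivity)).trans (le_of_eq ?_)
  ring

/-- Like the amplitude itself, the product need not be smooth in `l` at the origin, but it is smooth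
in `k` with parameter `(|l|, l)`. This supplies the measurability in `k` of the cut-off integrals.
-/
theorem isLocallySmoothLinfty_mul_amplitude (hm : 0 < m) (σ : Matrix (Fin 4) (Fin 4) ℝ) (ε : ℝ)
    {b : EuclideanSpace ℝ (Fin 4) → EuclideanSpace ℝ (Fin 3) → ℂ}
    (hb : SmoothOnProd (shellRegion m) b) :
    IsLocallySmoothLinfty (shellRegion m) (b * amplitude m σ ε) := by
  intro ρ
  obtain ⟨A, hA, hA'⟩ := exists_contDiffOn_Linfty (Ω := shellRegion m)
    (Φ := fun z : EuclideanSpace ℝ (Fin 4) × (ℝ × EuclideanSpace ℝ (Fin 3)) =>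
      Function.uncurry b (z.1, z.2.2) * scaledAmplitude m σ ε (z, 1))
    (s := fun l => (‖l‖, l)) (by fun_prop) (fun k hk l => by
      refine ContDiffAt.mul ?_ ?_
      · exact ContDiffAt.comp (g := Function.uncurry b) (f := fun z :
          EuclideanSpace ℝ (Fin 4) × (ℝ × EuclideanSpace ℝ (Fin 3)) => (z.1, z.2.2)) _
          (hb.contDiffAt_top hk l) (by fun_prop)
      · refine ContDiffAt.comp (g := scaledAmplitude m σ ε) (f := fun z :
          EuclideanSpace ℝ (Fin 4) × (ℝ × EuclideanSpace ℝ (Fin 3)) => (z, (1 : ℝ))) _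
          (contDiffAt_scaledAmplitude hm σ ε hk (Or.inl ?_) (norm_nonneg l)) (by fun_prop)
        rw [one_mul]; exact hm.ne') ρ
  refine ⟨A, hA, fun k hk => ?_⟩
  have h1 : A k =ᵐ[volume.restrict (Metric.closedBall 0 ρ)]
      (Metric.closedBall 0 ρ).indicator fun l =>
        Function.uncurry b (k, l) * scaledAmplitude m σ ε ((k, (‖l‖, l)), 1) :=
    ae_restrict_of_ae (hA' k hk)
  refine (h1.trans (indicator_ae_eq_restrict Metric.isClosed_closedBall.measurableSet)).trans
    (Eventually.of_forall fun l => ?_)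
  simp only [Pi.mul_apply, amplitude_eq_scaledAmplitude hm σ ε hk, Function.uncurry]

theorem continuous_twistLength (σ : Matrix (Fin 4) (Fin 4) ℝ) : Continuous (twistLength σ) :=
  (contDiff_minkowskiSq.continuous.comp (contDiff_twist σ).continuous).neg.sqrt

/-- The cut-off self-energies converge to the self-energy as distributions. -/
theorem tendsto_integral_cutoff (hm : 0 < m) (hσ : σ.transpose = -σ) (hσ' : σ.det ≠ 0)
    (hε : ε = 1 ∨ ε = -1) (hg : ContDiff ℝ ∞ g) (hg1 : ∀ x, |x| ≤ 1 → g x = 1)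
    (hg2 : ∀ x, 2 ≤ |x| → g x = 0) (f : 𝓓(shellRegion m, ℝ)) :
    Tendsto (fun n : ℕ => ∫ k, (f k : ℂ) *
      phaseIntegral (twistPhase σ ε) (boostCutoffOnShell m g n * amplitude m σ ε) k) atTop
      (𝓝 (∫ k, (f k : ℂ) * (nonplanarSelfEnergy m σ k : ℂ))) := by
  obtain ⟨M, hM0, hM⟩ := exists_cutoff_norm_bound hg hg2
  have hl : ∀ k ∈ shellRegion m, 0 < twistLength σ k := fun k hk => twistLength_pos hσ hσ' hm hk
  set J : ℝ := 2 * ((2 * Real.pi) ^ 2)⁻¹ * M * ∫ x in Ioi (0 : ℝ), (x ^ 2 + m ^ 2)⁻¹ with hJ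
  -- The dominating function `J/L(k)` is continuous on `Ω` since `L` does not vanish there, hence
  -- integrable against `f`.
  have hcont : ContinuousOn (fun k => ((J * (twistLength σ k)⁻¹ : ℝ) : ℂ)) (shellRegion m) :=
    Complex.continuous_ofReal.comp_continuousOn (continuousOn_const.mul
      ((continuous_twistLength σ).continuousOn.inv₀ fun k hk => (hl k hk).ne'))
  have hJ0 : 0 ≤ J := by
    have : 0 ≤ ∫ x in Ioi (0 : ℝ), (x ^ 2 + m ^ 2)⁻¹ :=
      integral_nonneg fun x => by positivity
    positivity
  have hbound := (integrable_test_mul f hcont).norm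
  -- The index is shifted to avoid `n = 0`, where the cutoff is identically `1` and has no compact
  -- support.
  refine (tendsto_add_atTop_iff_nat 1).1 ?_
  refine tendsto_integral_of_dominated_convergence _ (fun n => ?_) hbound
    (fun n => Eventually.of_forall fun k => ?_) (Eventually.of_forall fun k => ?_)
  · refine (integrable_test_mul f ?_).aestronglyMeasurable
    rw [twistPhase_eq_linearPhase]
    exact (contDiffOn_phaseIntegral (continuous_phaseGradient σ ε)
      (isLocallySmoothLinfty_mul_amplitude hm σ ε (smoothOnProd_boostCutoffOnShell hm hg (n + 1)))
      ((hasCompactSupportInL_boostCutoffOnShell hm hg2 n.succ_pos).mul_right _)).continuousOn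
  · by_cases hk : k ∈ tsupport f
    · have hkΩ : k ∈ shellRegion m := f.tsupport_subset hk
      rw [phaseIntegral_cutoff_eq hm hσ hσ' hε hg hg2 n.succ_pos hkΩ, norm_mul, norm_mul]
      refine mul_le_mul_of_nonneg_left ?_ (norm_nonneg _)
      rw [Complex.norm_real, Real.norm_of_nonneg
        (mul_nonneg hJ0 (inv_nonneg.2 (hl k hkΩ).le))]
      exact norm_cutoffSelfEnergy_le hm hkΩ (hl k hkΩ) hM _
    · simp [image_eq_zero_of_notMem_tsupport hk]
  · by_cases hk : k ∈ tsupport f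
    · have hkΩ : k ∈ shellRegion m := f.tsupport_subset hk
      simp only [phaseIntegral_cutoff_eq hm hσ hσ' hε hg hg2 (Nat.succ_pos _) hkΩ]
      exact ((tendsto_add_atTop_iff_nat 1).2
        (tendsto_cutoffSelfEnergy hm hg hg1 hg2 hkΩ (hl k hkΩ))).const_mul _
    · simp [image_eq_zero_of_notMem_tsupport hk]

end Evaluation

end

/-! ### The theorem. -/

theorem mainTheorem1 (m : ℝ) (hm : 0 < m) (σ : Matrix (Fin 4) (Fin 4) ℝ)
    (hσ : σ.transpose = -σ) (hσ' : σ.det ≠ 0) (ε : ℝ) (hε : ε = 1 ∨ ε = -1) :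
    -- the singularities of the propagators are not met
    (∀ k ∈ shellRegion m, ∀ l : EuclideanSpace ℝ (Fin 3),
      minkowskiSq (k - onShell m l) ≠ m ^ 2 ∧ minkowskiSq (k + onShell m l) ≠ m ^ 2) ∧
    -- the self-energy is the integral with amplitude `a` and phase `φ`
    (∀ k l, amplitude m σ ε k l * Complex.exp (Complex.I * (twistPhase σ ε k l : ℂ)) =
      (((2 * Real.pi)⁻¹ * (1 / (2 * energy m ‖l‖)) : ℝ) : ℂ) *
        selfEnergyIntegrand m σ ε k (onShell m l)) ∧
    -- the oscillatory integral is well defined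
    IsPhaseFunction (shellRegion m) (twistPhase σ ε) ∧
    amplitude m σ ε ∈ asymptoticSymbolsOfOrder (shellRegion m) 3 (-3) ∧
    (∃! T : asymptoticSymbols (shellRegion m) 3 →ₗ[ℂ] 𝓓'(shellRegion m, ℂ),
      IsOscillatoryIntegral (shellRegion m) (twistPhase σ ε) T) ∧
    -- its value: an absolutely convergent integral, smooth in `k`
    (∀ k ∈ shellRegion m, 0 < twistLength σ k ∧
      IntegrableOn (radialIntegrand m σ k) (Ioi 0) volume) ∧
    ContDiffOn ℝ ∞ (nonplanarSelfEnergy m σ) (shellRegion m) ∧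
    (∀ T : asymptoticSymbols (shellRegion m) 3 →ₗ[ℂ] 𝓓'(shellRegion m, ℂ),
      IsOscillatoryIntegral (shellRegion m) (twistPhase σ ε) T →
      ∀ a : asymptoticSymbols (shellRegion m) 3, a.1 = amplitude m σ ε →
        IsGivenBy (T a) (fun k => (nonplanarSelfEnergy m σ k : ℂ))) ∧
    -- the boosts
    (∀ k ∈ shellRegion m,
      (∀ p, minkowskiSq (restBoost k p) = minkowskiSq p) ∧
      restBoost k k = fourVector (SignType.sign (k 0) * √(minkowskiSq k)) 0) ∧
    -- the boost-adapted cutoffs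
    (∀ g : ℝ → ℂ, ContDiff ℝ ∞ g → (∀ x, |x| ≤ 1 → g x = 1) → (∀ x, 2 ≤ |x| → g x = 0) →
      (∀ n : ℕ, 0 < n → HasCompactSupportInL (shellRegion m) (boostCutoffOnShell m g n)) ∧
      (∀ n : ℕ, boostCutoffOnShell m g n ∈ symSubmodule (shellRegion m) 3 0) ∧
      (∃ (G : ℕ → SymbolSpace (shellRegion m) 3 1) (one : SymbolSpace (shellRegion m) 3 1),
        (∀ n, (G n).1 = boostCutoffOnShell m g n) ∧ one.1 = (fun _ _ => 1) ∧
        Tendsto G atTop (𝓝 one)) ∧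
      (∀ n : ℕ, 0 < n → ∀ k ∈ shellRegion m,
        Integrable (fun l => boostCutoff g n k l * selfEnergyIntegrand m σ ε k l)
          (positiveFrequencyMeasure m)) ∧
      (∀ f : 𝓓(shellRegion m, ℝ),
        Tendsto (fun n : ℕ => ∫ k, (f k : ℂ) *
            ∫ l, boostCutoff g n k l * selfEnergyIntegrand m σ ε k l
              ∂(positiveFrequencyMeasure m))
          atTop (𝓝 (∫ k, (f k : ℂ) * (nonplanarSelfEnergy m σ k : ℂ))))) := by
  have hl : ∀ k ∈ shellRegion m, 0 < twistLength σ k := fun k hk => twistLength_pos hσ hσ' hm hk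
  have ha := amplitude_mem_asymptoticSymbolsOfOrder hm σ ε
  obtain ⟨c, hc, hcw⟩ := exists_le_norm_phaseGradient hσ' hε
  have hw := continuous_phaseGradient σ ε
  -- Uniqueness and the value of the oscillatory integral do not mention a cutoff, so one is fixed
  -- for their proofs.
  obtain ⟨g₀, hg₀, hg₀1, hg₀2⟩ := exists_lineCutoff
  have hG := isCutoffSequence_boostCutoffSymbol hm hg₀ hg₀1 hg₀2
  refine ⟨fun k hk l => off_shell hm hk l, amplitude_mul_exp m σ ε,
    isPhaseFunction_twistPhase _ hσ' hε, ha, ?_,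
    fun k hk => ⟨hl k hk, integrableOn_radialIntegrand hm hk (hl k hk)⟩,
    contDiffOn_nonplanarSelfEnergy hm hl, ?_,
    fun k hk => ⟨minkowskiSq_restBoost hm hk, restBoost_self hm hk⟩, ?_⟩
  · refine ⟨linearPhaseOscillatoryIntegral (shellRegion m) hw hc hcw, ?_, fun T hT => ?_⟩
    · rw [twistPhase_eq_linearPhase]
      exact isOscillatoryIntegral_linearPhase hw hc hcw
    · rw [twistPhase_eq_linearPhase] at hT
      exact hT.unique hG (isOscillatoryIntegral_linearPhase hw hc hcw)
  · intro T hT a haT f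
    have h1 := tendsto_integral_cutoff hm hσ hσ' hε hg₀ hg₀1 hg₀2 f
    rw [twistPhase_eq_linearPhase] at hT h1
    have h2 := hT.tendsto_of_mem_order hG hw a (haT ▸ ha) f
    rw [haT] at h2
    -- The same cut-off integrals converge to `T a f` by the axioms of an oscillatory integral, and
    -- to the integral of `f F` by the rest-frame computation.
    exact tendsto_nhds_unique h2 h1
  · intro g hg hg1 hg2
    refine ⟨fun n hn => hasCompactSupportInL_boostCutoffOnShell hm hg2 hn,
      fun n => boostCutoffOnShell_mem_symSubmodule hm hg hg1 hg2 n le_rfl,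
      ⟨boostCutoffSymbol hm hg hg1 hg2, oneSymbol m, fun n => rfl, rfl,
        tendsto_boostCutoffSymbol hm hg hg1 hg2⟩,
      fun n hn k hk => integrable_cutoffIntegrand hm hg hg2 hn σ ε hk, fun f => ?_⟩
    simp only [integral_cutoff_eq_phaseIntegral]
    exact tendsto_integral_cutoff hm hσ hσ' hε hg hg1 hg2 f
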